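/- Notation: $[z^n]f$ is the coefficient of $z^n$ in a formal power series $f\in\mathbb C[[z]]$; for $f(0)=1$ and $s\in\mathbb C$, $f(z)^s:=\sum_{j\ge0}\binom sj (f(z)-1)^j$. We call $f$ *subfactorial* if $[z^n]f=O(\varepsilon^n n!)$ as $n\to\infty$, for every $\varepsilon>0$; every power series with positive radius of convergence is subfactorial. **Theorem.** Let $\alpha\in\mathbb Z^+$ and let $d(z)=\sum_j d_jz^j$ and $e(z)=\sum_j e_jz^j$ be subfactorial formal power series with complex coefficients such that $d(0)=e(0)=1$ and $e_1=e'(0)\neq0$. For $\omega_0,\omega\in\mathbb C$ put $$a_n(\omega_0,\omega):=[z^n]\sum_{k\ge0}d(z)^{k+\omega_0}\prod_{1\le j\le k}\bigl(e(z)^{j+\omega}-1\bigr)^\alpha ,$$ $$\rho:=\frac{12\,e_1}{\mathrm e\,\alpha\pi^2},\qquad c(\omega):=\frac{\sqrt6}{\alpha\pi}\left(\frac{2\sqrt6}{\sqrt{\alpha\pi}\;\Gamma(1+\omega)}\Bigl(\frac{12}{\alpha\pi^2}\Bigr)^{\omega}\right)^{\alpha}2^{d_1/e_1}\exp\left(\frac{\alpha\pi^2}{12}\Bigl(\frac{e_2}{e_1^2}-\frac12\Bigr)\right),$$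 where $\mathrm e=\exp(1)$ and $1/\Gamma(1+\omega)$ is read as $0$ for $\omega\in\{-1,-2,\dots\}$. Then, for every $R$: (i) for every $\delta>0$, $$a_n(\omega_0,\omega)=c(\omega)\,\rho^n\,n^{\,n+\alpha(\frac12+\omega)}\bigl(1+O(n^{-1})\bigr)\qquad(n\to\infty),$$ uniformly for $|\omega_0|\le R$ and $|\omega|\le R$ with $|\omega+m|\ge\delta$ for all $m\in\{1,2,\dots\}$; (ii) $$a_n(\omega_0,\omega)=\rho^n\,n^{\,n+\alpha(\frac12+\omega)}\bigl(c(\omega)+O(n^{-1})\bigr)\qquad(n\to\infty),$$ uniformly for all $|\omega_0|\le R$ and $|\omega|\le R$. The $O$-constants may depend on $\alpha,d,e,R$ (and on $\delta$ in (i)), but not on $\omega_0,\omega,n$. -/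

import Mathlib

open Filter Asymptotics

noncomputable section

/-- The complex power `f ^ s` of a formal power series `f` with constant term `1`, through the
binomial series `∑ⱼ (s choose j) (f - 1) ^ j`. Since `f - 1` has no constant term, the terms with
`j > n` do not contribute to the coefficient of `z ^ n`. -/
def seriesCpow (f : PowerSeries ℂ) (s : ℂ) : PowerSeries ℂ :=
  PowerSeries.mk fun n =>
    ∑ j ∈ Finset.range (n + 1), Ring.choose s j * PowerSeries.coeff n ((f - 1) ^ j)

/-- The `k`-th summand `d(z) ^ (k + ω₀) * ∏_{1 ≤ j ≤ k} (e(z) ^ (j + ω) - 1) ^ α`. -/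
def summand (α : ℕ) (d e : PowerSeries ℂ) (ω₀ ω : ℂ) (k : ℕ) : PowerSeries ℂ :=
  seriesCpow d (k + ω₀) * ∏ j ∈ Finset.Icc 1 k, (seriesCpow e (j + ω) - 1) ^ α

/-- The coefficient of `z ^ n` in `∑_{k ≥ 0} summand α d e ω₀ ω k`. For `α ≥ 1` only the terms
with `k ≤ n` contribute to it, see `coeff_summand_eq_zero`. -/
def sumCoeff (α : ℕ) (d e : PowerSeries ℂ) (ω₀ ω : ℂ) (n : ℕ) : ℂ :=
  ∑ k ∈ Finset.range (n + 1), PowerSeries.coeff n (summand α d e ω₀ ω k)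

theorem constantCoeff_seriesCpow (f : PowerSeries ℂ) (s : ℂ) :
    PowerSeries.constantCoeff (seriesCpow f s) = 1 := by
  rw [← PowerSeries.coeff_zero_eq_constantCoeff_apply]
  simp [seriesCpow]

theorem coeff_summand_eq_zero {α : ℕ} (hα : 1 ≤ α) (d e : PowerSeries ℂ) (ω₀ ω : ℂ)
    {n k : ℕ} (h : n < k) : PowerSeries.coeff n (summand α d e ω₀ ω k) = 0 := by
  have hX : (PowerSeries.X : PowerSeries ℂ) ^ k ∣
      ∏ j ∈ Finset.Icc 1 k, (seriesCpow e (j + ω) - 1) ^ α := by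
    have := Finset.prod_dvd_prod_of_dvd (s := Finset.Icc 1 k)
      (fun _ => (PowerSeries.X : PowerSeries ℂ))
      (fun j => (seriesCpow e (j + ω) - 1) ^ α) (fun j _ => by
        refine dvd_pow ?_ (by omega)
        rw [PowerSeries.X_dvd_iff]
        simp [constantCoeff_seriesCpow])
    simpa using this
  exact PowerSeries.X_pow_dvd_iff.mp (Dvd.dvd.mul_left hX _) n h

/-- `ρ = 12 e₁ / (𝐞 α π²)`, with `𝐞` the base of the natural logarithm. -/
def rhoConst (α : ℕ) (e : PowerSeries ℂ) : ℂ :=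
  12 * PowerSeries.coeff 1 e / (Complex.exp 1 * α * (Real.pi : ℂ) ^ 2)

/-- The leading constant `c`. Mathlib's `Complex.Gamma` vanishes at its poles, so
`(Complex.Gamma (1 + ω))⁻¹` is the entire function `1 / Γ(1 + ω)`, equal to `0` at
`ω = -1, -2, …`. -/
def cConst (α : ℕ) (d e : PowerSeries ℂ) (ω : ℂ) : ℂ :=
  ((Real.sqrt 6 / (α * Real.pi) : ℝ) : ℂ) *
    (((2 * Real.sqrt 6 / Real.sqrt (α * Real.pi) : ℝ) : ℂ) * (Complex.Gamma (1 + ω))⁻¹ *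
      ((12 / (α * Real.pi ^ 2) : ℝ) : ℂ) ^ ω) ^ α *
    (2 : ℂ) ^ (PowerSeries.coeff 1 d / PowerSeries.coeff 1 e) *
    Complex.exp (α * (Real.pi : ℂ) ^ 2 / 12 *
      (PowerSeries.coeff 2 e / PowerSeries.coeff 1 e ^ 2 - 1 / 2))

/-- The scale `ρ ^ n * n ^ (n + α (1/2 + ω))`. -/
def growthScale (α : ℕ) (e : PowerSeries ℂ) (ω : ℂ) (n : ℕ) : ℂ :=
  rhoConst α e ^ n * (n : ℂ) ^ ((n : ℂ) + α * (1 / 2 + ω))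

/-- The coefficients of `f` grow more slowly than `ε ^ n * n!` for every `ε > 0`.
Every power series with a positive radius of convergence has this property. -/
def IsSubfactorial (f : PowerSeries ℂ) : Prop :=
  ∀ ε : ℝ, 0 < ε →
    (fun n : ℕ => PowerSeries.coeff n f) =O[atTop] fun n : ℕ => ε ^ n * (n.factorial : ℝ)

end

/-!
The coefficient of `z ^ n` in the `k`-th summand is computed by Cauchy's formula on a circle that
depends on `k`. Subfactorial series need not converge, but the coefficient of `z ^ n` only sees
their truncations at order `n`, and on disks of radius `O(1 / n)` these are uniformly close to
their low-order Taylor polynomials (`IsSubfactorial.truncEval_sub_le`). With `z = w / (k e₁)`,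
`‖w‖ = log 2`, one has `log (e z) ≈ w / k`, so that the product in the summand is close to
`∏ (exp ((j + ω) w / k) - 1)`. Writing `exp x - 1 = x * expQuot x` splits off `k! ∏ (1 + ω / j)`,
and the midpoint rule evaluates the sum of the logarithms of `expQuot`. This gives
`prod_exp_sub_one_asymp`: the product decays like `exp (-k * rate θ)` for
`w = circlePt θ = log 2 * exp (i θ)`, with explicit corrections and relative error `O(1 / k)`.

For `k ≤ η n` with a small constant `η` both the coefficients and their approximations are
exponentially small relative to the growth scale (`coeff_summand_sub_approxCoeff_le_of_le`). For `k ≥ η n` the errors `O(1 / k)`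
can be summed, because `Re (rate θ)` is minimal at `θ = 0` with quadratic growth
(`rate_re_ge_quadratic`), and this costs a relative error `O(1 / n)` only
(`sumCoeff_sub_tsum_approxCoeff_le`). It even covers `k > n`, where the coefficient vanishes, so the
approximations can be summed over all `k`.

The sum over `k` of `k ^ (n + β) * exp (-k * α * rate θ)`, `β = α (1 / 2 + ω)`, is replaced by
`Γ(n + β + 1) * (α * rate θ) ^ (-(n + β + 1))` through the trapezoid rule
(`norm_tsum_cpow_mul_exp_sub_le`), and the remaining integral over `θ` has the phase
`i θ + log (rate θ)` with a nondegenerate saddle point at `θ = 0`, which is the reason for the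
radius `log 2` (`deriv_phase_zero`, `deriv_deriv_phase_zero`, `saddle_integral_phase`). The value
`rate 0 = π² / (12 log 2)` comes from `∫ log x / (x - 1)` over `[1, 2]` being `π² / 12`
(`integral_dslope_log`). Stirling's formula then gives the estimate relative to the growth scale,
`sumCoeff_asymp`. The version with relative error follows since `1 / Γ(1 + ω)` is continuous and
vanishes only at `ω = -1, -2, …`, so the leading constant is bounded below on the compact set in
question (`exists_one_le_mul_norm_cConst`).
-/

/-! ### The Gamma function and factorials, with relative error `O(1/n)` -/

/-- A sequence whose relative increments are `O(1/k²)` approaches its limit with relative error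
`O(1/k)`; the constants depend only on the constant in the hypothesis. -/
theorem norm_sub_le_of_relative_increment {C : ℝ} (hC : 0 ≤ C) {N : ℕ} {u : ℕ → ℂ} {L : ℂ}
    (hu : ∀ k, N ≤ k → ‖u (k + 1) - u k‖ ≤ C / (k : ℝ) ^ 2 * ‖u k‖)
    (hL : Tendsto u atTop (nhds L)) {k : ℕ} (hN : N ≤ k) (hk : 4 * C + 2 ≤ k) :
    ‖u k - L‖ ≤ 8 * C / k * ‖L‖ := by
  have hk1 : (1 : ℝ) ≤ k - 1 := by linarith
  have key : ∀ l, k ≤ l →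
      ‖u l - u k‖ ≤ 2 * C * (1 / ((k : ℝ) - 1) - 1 / ((l : ℝ) - 1)) * ‖u k‖ := by
    intro l hl
    induction l, hl using Nat.le_induction with
    | base => simp
    | succ l hl ih =>
      have hl' : (k : ℝ) ≤ l := by exact_mod_cast hl
      have hl1 : (1 : ℝ) ≤ l - 1 := by linarith
      have h1 : 2 * C * (1 / ((k : ℝ) - 1) - 1 / ((l : ℝ) - 1)) ≤ 1 := by
        have : 2 * C * (1 / ((k : ℝ) - 1)) ≤ 1 := by
          rw [mul_one_div, div_le_one (by linarith)]; linarith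
        have : 0 ≤ 2 * C * (1 / ((l : ℝ) - 1)) := by positivity
        linarith
      have hul : ‖u l‖ ≤ 2 * ‖u k‖ := by
        have := norm_sub_norm_le (u l) (u k)
        nlinarith [norm_nonneg (u k)]
      have h2 : C / (l : ℝ) ^ 2 ≤ C * (1 / ((l : ℝ) - 1) - 1 / l) := by
        have : 1 / ((l : ℝ) - 1) - 1 / l = 1 / (((l : ℝ) - 1) * l) := by
          rw [div_sub_div _ _ (by linarith) (by linarith)]; ring_nf
        rw [this, mul_one_div]
        apply div_le_div_of_nonneg_left hC (by nlinarith) (by nlinarith)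
      have h3 := hu l (hN.trans hl)
      have h4 : ‖u (l + 1) - u k‖ ≤ ‖u (l + 1) - u l‖ + ‖u l - u k‖ :=
        norm_sub_le_norm_sub_add_norm_sub _ _ _
      have h5 : C / (l : ℝ) ^ 2 * ‖u l‖ ≤ C * (1 / ((l : ℝ) - 1) - 1 / l) * (2 * ‖u k‖) := by
        gcongr
        exact le_trans (by positivity) h2
      push_cast
      have : (l : ℝ) + 1 - 1 = l := by ring
      rw [this]
      nlinarith
  have hlim : ‖L - u k‖ ≤ 2 * C / ((k : ℝ) - 1) * ‖u k‖ := by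
    refine le_of_tendsto ((hL.sub_const (u k)).norm) ?_
    filter_upwards [eventually_ge_atTop k] with l hl
    refine (key l hl).trans ?_
    have hl' : (k : ℝ) ≤ l := by exact_mod_cast hl
    have : 0 ≤ 1 / ((l : ℝ) - 1) := by
      have : (0 : ℝ) ≤ l - 1 := by linarith
      positivity
    have h6 : 2 * C * (1 / ((k : ℝ) - 1) - 1 / ((l : ℝ) - 1)) ≤ 2 * C / ((k : ℝ) - 1) := by
      have : 0 ≤ 2 * C * (1 / ((l : ℝ) - 1)) := by positivity
      rw [mul_sub, mul_one_div]; linarith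
    gcongr
  have hhalf : 2 * C / ((k : ℝ) - 1) ≤ 1 / 2 := by
    rw [div_le_iff₀ (by linarith)]; linarith
  have hul : ‖u k‖ ≤ 2 * ‖L‖ := by
    have := norm_sub_norm_le (u k) L
    rw [norm_sub_rev] at this
    nlinarith [norm_nonneg (u k)]
  rw [norm_sub_rev]
  calc ‖L - u k‖ ≤ 2 * C / ((k : ℝ) - 1) * ‖u k‖ := hlim
    _ ≤ 2 * C / ((k : ℝ) / 2) * (2 * ‖L‖) := by
        gcongr <;> linarith
    _ = 8 * C / k * ‖L‖ := by
        have : (k : ℝ) ≠ 0 := by linarith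
        field_simp; ring

/-- The consecutive quotients of `∏_{j ≤ k} (1 + ω / j) * k ^ (-ω)` are `1 + O(1/k²)`. -/
theorem norm_gamma_ratio_sub_one_le {M : ℝ} {ω : ℂ} (hω : ‖ω‖ ≤ M) {k : ℕ}
    (hk : M + 1 ≤ k) :
    ‖(1 + ω / ((k : ℂ) + 1)) * (((k : ℂ) + 1) ^ (-ω) / (k : ℂ) ^ (-ω)) - 1‖ ≤
      (3 * M ^ 2 + M) / (k : ℝ) ^ 2 := by
  have hM : 0 ≤ M := (norm_nonneg _).trans hω
  have hk0 : (0 : ℝ) < k := by linarith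
  have hk0' : (k : ℂ) ≠ 0 := by exact_mod_cast hk0.ne'
  set x : ℝ := Real.log ((k + 1) / k) with hx
  have hx0 : 0 ≤ x := Real.log_nonneg (by rw [le_div_iff₀ hk0]; linarith)
  have hx1 : x ≤ 1 / k := by
    have := Real.log_le_sub_one_of_pos (x := ((k : ℝ) + 1) / k) (by positivity)
    have h2 : ((k : ℝ) + 1) / k - 1 = 1 / k := by field_simp; ring
    linarith
  have hMx : M * x ≤ 1 := by
    calc M * x ≤ M * (1 / k) := by gcongr
      _ ≤ 1 := by rw [mul_one_div, div_le_one hk0]; linarith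
  have hx11 : x ≤ 1 := hx1.trans (by rw [div_le_one hk0]; linarith)
  have hb : ((k : ℂ) + 1) ^ (-ω) / (k : ℂ) ^ (-ω) = Complex.exp (-(ω * x)) := by
    have h1 : ((k : ℂ) + 1) = ((k + 1 : ℝ) : ℂ) := by push_cast; ring
    have h2 : (k : ℂ) = ((k : ℝ) : ℂ) := by push_cast; ring
    rw [Complex.cpow_def_of_ne_zero (by exact_mod_cast Nat.succ_ne_zero k),
      Complex.cpow_def_of_ne_zero hk0', ← Complex.exp_sub, h1, h2, ← Complex.ofReal_log (by linarith),
      ← Complex.ofReal_log hk0.le]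
    congr 1
    rw [hx, Real.log_div (by linarith) hk0.ne']
    push_cast; ring
  have ha : (1 : ℂ) / ((k : ℂ) + 1) = 1 - Complex.exp (-(x : ℂ)) := by
    have : Real.exp (-x) = k / (k + 1) := by
      rw [Real.exp_neg, hx, Real.exp_log (by positivity), inv_div]
    rw [← Complex.ofReal_neg, ← Complex.ofReal_exp, this]
    push_cast
    have : (k : ℂ) + 1 ≠ 0 := by exact_mod_cast Nat.succ_ne_zero k
    field_simp; ring
  have hωx : ‖ω * (x : ℂ)‖ ≤ M * x := by
    rw [norm_mul, Complex.norm_real, Real.norm_of_nonneg hx0]; gcongr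
  set b := Complex.exp (-(ω * x)) with hbdef
  set a := ω * (1 - Complex.exp (-(x : ℂ))) with hadef
  have e1 : ‖b - 1 + ω * x‖ ≤ (M * x) ^ 2 := by
    have := Complex.norm_exp_sub_one_sub_id_le (x := -(ω * x)) (by rw [norm_neg]; linarith)
    rw [norm_neg, sub_neg_eq_add] at this
    exact this.trans (by gcongr)
  have e2' : ‖(1 - Complex.exp (-(x : ℂ))) - x‖ ≤ x ^ 2 := by
    have := Complex.norm_exp_sub_one_sub_id_le (x := -(x : ℂ)) (by
      rw [norm_neg, Complex.norm_real, Real.norm_of_nonneg hx0]; exact hx11)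
    rw [norm_neg, Complex.norm_real, Real.norm_of_nonneg hx0, sub_neg_eq_add] at this
    rw [← norm_neg]
    refine le_of_eq_of_le (congrArg norm ?_) this
    ring
  have e2 : ‖a - ω * x‖ ≤ M * x ^ 2 := by
    rw [hadef, ← mul_sub, norm_mul]; gcongr
  have e3 : ‖b - 1‖ ≤ 2 * (M * x) := by
    calc ‖b - 1‖ = ‖(b - 1 + ω * x) - ω * x‖ := by congr 1; abel
      _ ≤ (M * x) ^ 2 + M * x := (norm_sub_le _ _).trans (add_le_add e1 hωx)
      _ ≤ 2 * (M * x) := by nlinarith [mul_nonneg hM hx0]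
  have e4 : ‖a‖ ≤ M * x := by
    have h1 : ‖(1 : ℂ) / ((k : ℂ) + 1)‖ ≤ x := by
      have h2 : (1 : ℂ) / ((k : ℂ) + 1) = ((1 / (k + 1) : ℝ) : ℂ) := by push_cast; ring
      rw [h2, Complex.norm_real, Real.norm_of_nonneg (by positivity), hx]
      have := Real.one_sub_inv_le_log_of_pos (x := ((k : ℝ) + 1) / k) (by positivity)
      refine le_trans (le_of_eq ?_) this
      field_simp; ring
    rw [hadef, ← ha, norm_mul]; gcongr
  have : (1 + ω / ((k : ℂ) + 1)) * (((k : ℂ) + 1) ^ (-ω) / (k : ℂ) ^ (-ω)) - 1 =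
      (b - 1 + ω * x) + (a - ω * x) + a * (b - 1) := by
    rw [hb, div_eq_mul_one_div ω, ha]; ring
  rw [this]
  calc _ ≤ (M * x) ^ 2 + M * x ^ 2 + (M * x) * (2 * (M * x)) := by
        refine (norm_add_le _ _).trans (add_le_add ((norm_add_le _ _).trans (add_le_add e1 e2)) ?_)
        rw [norm_mul]; gcongr
    _ = (3 * M ^ 2 + M) * x ^ 2 := by ring
    _ ≤ (3 * M ^ 2 + M) * (1 / k) ^ 2 := by gcongr
    _ = _ := by ring

theorem prod_one_add_div_tendsto (ω : ℂ) :
    Tendsto (fun k : ℕ => (∏ j ∈ Finset.Icc 1 k, (1 + ω / (j : ℂ))) * (k : ℂ) ^ (-ω)) atTop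
      (nhds (Complex.Gamma (1 + ω))⁻¹) := by
  by_cases hpole : ∃ m : ℕ, ω = -((m : ℂ) + 1)
  · obtain ⟨m, rfl⟩ := hpole
    have h0 : Complex.Gamma (1 + -((m : ℂ) + 1)) = 0 := by
      have : 1 + -((m : ℂ) + 1) = -m := by ring
      rw [this, Complex.Gamma_neg_nat_eq_zero]
    rw [h0, inv_zero]
    refine tendsto_const_nhds.congr' ?_
    filter_upwards [eventually_ge_atTop (m + 1)] with k hk
    rw [Finset.prod_eq_zero (i := m + 1) (Finset.mem_Icc.2 ⟨by omega, hk⟩), zero_mul]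
    have : (m : ℂ) + 1 ≠ 0 := by exact_mod_cast Nat.succ_ne_zero m
    push_cast
    field_simp; ring
  by_cases h0 : ω = 0
  · subst h0; simp
  push Not at hpole
  have hne : ∀ m : ℕ, ω ≠ -m := by
    intro m
    cases m with
    | zero => simpa using h0
    | succ m => simpa using hpole m
  have hG := Complex.GammaSeq_tendsto_Gamma ω
  have hG0 : Complex.Gamma ω ≠ 0 := Complex.Gamma_ne_zero hne
  have h1 := (hG.const_mul ω).inv₀ (mul_ne_zero h0 hG0)
  rw [add_comm, Complex.Gamma_add_one _ h0]
  refine h1.congr' ?_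
  filter_upwards [eventually_gt_atTop 0] with k hk
  have hk' : (k : ℂ) ≠ 0 := by exact_mod_cast hk.ne'
  have hprod : ∏ j ∈ Finset.range (k + 1), (ω + (j : ℂ)) =
      ω * ((k.factorial : ℂ) * ∏ j ∈ Finset.Icc 1 k, (1 + ω / (j : ℂ))) := by
    clear hk hk'
    induction k with
    | zero => simp
    | succ k ih =>
      rw [Finset.prod_range_succ, ih, Finset.prod_Icc_succ_top (by omega), Nat.factorial_succ]
      have : (k : ℂ) + 1 ≠ 0 := by exact_mod_cast Nat.succ_ne_zero k
      push_cast
      field_simp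
      ring
  rw [Complex.GammaSeq, hprod, Complex.cpow_neg]
  have : (k.factorial : ℂ) ≠ 0 := by exact_mod_cast k.factorial_ne_zero
  have : (k : ℂ) ^ ω ≠ 0 := by simp [Complex.cpow_eq_zero_iff, hk']
  field_simp

/-- Gauss's product for `1 / Γ(1 + ω)`, uniformly with relative error `O(1/k)`; in particular
without exception near the zeros `-1, -2, …`. -/
theorem prod_one_add_div_asymp (M : ℝ) :
    ∃ C : ℝ, 0 ≤ C ∧ ∃ K : ℕ, 1 ≤ K ∧ ∀ k : ℕ, K ≤ k → ∀ ω : ℂ, ‖ω‖ ≤ M →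
      ‖∏ j ∈ Finset.Icc 1 k, (1 + ω / (j : ℂ)) - (k : ℂ) ^ ω * (Complex.Gamma (1 + ω))⁻¹‖ ≤
        C / k * ‖(k : ℂ) ^ ω * (Complex.Gamma (1 + ω))⁻¹‖ := by
  set C := 3 * M ^ 2 + |M| with hCdef
  have hC : 0 ≤ C := by positivity
  obtain ⟨K, hK⟩ := exists_nat_ge (4 * C + 2 + |M|)
  refine ⟨8 * C, by positivity, K, ?_, ?_⟩
  · have : (1 : ℝ) ≤ K := by linarith [abs_nonneg M]
    exact_mod_cast this
  intro k hk ω hω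
  have hM : 0 ≤ M := (norm_nonneg _).trans hω
  rw [abs_of_nonneg hM] at hCdef hK
  have hk' : (K : ℝ) ≤ k := by exact_mod_cast hk
  have key := norm_sub_le_of_relative_increment hC (N := K) (k := k) (fun i hi => ?_)
    (prod_one_add_div_tendsto ω) hk (by linarith)
  · have hk0 : (k : ℂ) ≠ 0 := by
      have : (0 : ℝ) < k := by linarith
      exact_mod_cast this.ne'
    have hp : (k : ℂ) ^ ω ≠ 0 := by simp [Complex.cpow_eq_zero_iff, hk0]
    have : ∏ j ∈ Finset.Icc 1 k, (1 + ω / (j : ℂ)) - (k : ℂ) ^ ω * (Complex.Gamma (1 + ω))⁻¹ =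
      (k : ℂ) ^ ω * ((∏ j ∈ Finset.Icc 1 k, (1 + ω / (j : ℂ))) * (k : ℂ) ^ (-ω) -
        (Complex.Gamma (1 + ω))⁻¹) := by
      rw [Complex.cpow_neg]; field_simp
    rw [this, norm_mul, norm_mul]
    nlinarith [norm_nonneg ((k : ℂ) ^ ω)]
  · have hi' : (K : ℝ) ≤ i := by exact_mod_cast hi
    have hi0 : (i : ℂ) ≠ 0 := by
      have : (0 : ℝ) < i := by linarith
      exact_mod_cast this.ne'
    have hp : (i : ℂ) ^ (-ω) ≠ 0 := by simp [Complex.cpow_eq_zero_iff, hi0]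
    have := norm_gamma_ratio_sub_one_le hω (k := i) (by linarith)
    rw [← hCdef] at this
    refine le_trans (le_of_eq ?_) (mul_le_mul_of_nonneg_right this (norm_nonneg _))
    rw [← norm_mul, Finset.prod_Icc_succ_top (by omega)]
    congr 1
    push_cast
    field_simp

/-- The qualitative version for `Re β > -1 - q`, by induction on `q` through
`Γ(s + 1) = s Γ(s)`. -/
theorem gamma_nat_add_div_tendsto_aux (q : ℕ) : ∀ β : ℂ, -1 < β.re + q →
    Tendsto (fun n : ℕ => Complex.Gamma (n + 1 + β) / n.factorial * (n : ℂ) ^ (-β)) atTop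
      (nhds 1) := by
  induction q with
  | zero =>
    intro β hβ
    simp only [CharP.cast_eq_zero, add_zero] at hβ
    have hG0 : Complex.Gamma (1 + β) ≠ 0 :=
      Complex.Gamma_ne_zero_of_re_pos (by simp; linarith)
    have h := (prod_one_add_div_tendsto β).const_mul (Complex.Gamma (1 + β))
    rw [mul_inv_cancel₀ hG0] at h
    refine h.congr fun n => ?_
    rw [← mul_assoc]
    congr 1
    induction n with
    | zero => simp
    | succ n ih =>
      have h1 : ((n : ℂ) + 1 + β) ≠ 0 := by
        intro h
        have := congrArg Complex.re h
        simp at this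
        have : (0 : ℝ) ≤ n := Nat.cast_nonneg n
        linarith
      have h2 : (n : ℂ) + 1 ≠ 0 := by exact_mod_cast Nat.succ_ne_zero n
      have h3 : (n.factorial : ℂ) ≠ 0 := by exact_mod_cast n.factorial_ne_zero
      have h4 : ((n + 1 : ℕ) : ℂ) + 1 + β = ((n : ℂ) + 1 + β) + 1 := by push_cast; ring
      rw [Finset.prod_Icc_succ_top (by omega), ← mul_assoc, ih, h4, Complex.Gamma_add_one _ h1,
        Nat.factorial_succ]
      push_cast
      field_simp
  | succ q ih =>
    intro β hβ
    have h := ih (β + 1) (by push_cast at hβ; simp; linarith)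
    have h2 : Tendsto (fun n : ℕ => (n : ℂ) / (n + 1 + β)) atTop (nhds 1) := by
      have := tendsto_natCast_div_add_atTop (𝕜 := ℂ) (1 + β)
      simpa [add_assoc] using this
    have h3 := h.mul h2
    rw [one_mul] at h3
    refine h3.congr' ?_
    obtain ⟨N, hN⟩ := exists_nat_gt ‖β‖
    filter_upwards [eventually_ge_atTop N, eventually_gt_atTop 0] with n hn hn0
    have hne : (n : ℂ) + 1 + β ≠ 0 := by
      intro h0
      have h5 : β = -((n + 1 : ℕ) : ℂ) := by push_cast; linear_combination h0
      rw [h5, norm_neg, Complex.norm_natCast] at hN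
      have : (N : ℝ) ≤ n := by exact_mod_cast hn
      push_cast at hN
      linarith
    have hn0' : (n : ℂ) ≠ 0 := by exact_mod_cast hn0.ne'
    have h4 : (n : ℂ) + 1 + (β + 1) = ((n : ℂ) + 1 + β) + 1 := by ring
    have h5 : (n : ℂ) ^ (-(β + 1)) = (n : ℂ) ^ (-β) / n := by
      rw [neg_add, Complex.cpow_add _ _ hn0', Complex.cpow_neg_one]; rfl
    rw [h4, Complex.Gamma_add_one _ hne, h5]
    field_simp

/-- `Γ(n + 1 + β) = n! n ^ β (1 + O(1/n))`, uniformly for bounded `β`. -/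
theorem gamma_nat_add_asymp (M : ℝ) :
    ∃ C : ℝ, 0 ≤ C ∧ ∃ K : ℕ, 1 ≤ K ∧ ∀ n : ℕ, K ≤ n → ∀ β : ℂ, ‖β‖ ≤ M →
      ‖Complex.Gamma (n + 1 + β) - n.factorial * (n : ℂ) ^ β‖ ≤
        C / n * ‖(n.factorial : ℂ) * (n : ℂ) ^ β‖ := by
  set C := 3 * M ^ 2 + |M| with hCdef
  have hC : 0 ≤ C := by positivity
  obtain ⟨K, hK⟩ := exists_nat_ge (4 * C + 2 + |M|)
  refine ⟨8 * C, by positivity, K, ?_, ?_⟩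
  · have : (1 : ℝ) ≤ K := by linarith [abs_nonneg M]
    exact_mod_cast this
  intro n hn β hβ
  have hM : 0 ≤ M := (norm_nonneg _).trans hβ
  rw [abs_of_nonneg hM] at hCdef hK
  have hn' : (K : ℝ) ≤ n := by exact_mod_cast hn
  obtain ⟨q, hq⟩ := exists_nat_gt ‖β‖
  have key := norm_sub_le_of_relative_increment hC (N := K) (k := n) (fun i hi => ?_)
    (gamma_nat_add_div_tendsto_aux q β (by
      have := Complex.abs_re_le_norm β
      have := neg_abs_le β.re
      linarith)) hn (by linarith)
  · have hn0 : (n : ℂ) ≠ 0 := by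
      have : (0 : ℝ) < n := by linarith
      exact_mod_cast this.ne'
    have hp : (n : ℂ) ^ β ≠ 0 := by simp [Complex.cpow_eq_zero_iff, hn0]
    have hf : (n.factorial : ℂ) ≠ 0 := by exact_mod_cast n.factorial_ne_zero
    have : Complex.Gamma (n + 1 + β) - n.factorial * (n : ℂ) ^ β =
      (n.factorial : ℂ) * (n : ℂ) ^ β *
        (Complex.Gamma (n + 1 + β) / n.factorial * (n : ℂ) ^ (-β) - 1) := by
      rw [Complex.cpow_neg]; field_simp
    rw [this, norm_mul]
    rw [norm_one, mul_one] at key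
    nlinarith [norm_nonneg ((n.factorial : ℂ) * (n : ℂ) ^ β)]
  · have hi' : (K : ℝ) ≤ i := by exact_mod_cast hi
    have hi0 : (i : ℂ) ≠ 0 := by
      have : (0 : ℝ) < i := by linarith
      exact_mod_cast this.ne'
    have hp : (i : ℂ) ^ (-β) ≠ 0 := by simp [Complex.cpow_eq_zero_iff, hi0]
    have := norm_gamma_ratio_sub_one_le hβ (k := i) (by linarith)
    rw [← hCdef] at this
    refine le_trans (le_of_eq ?_) (mul_le_mul_of_nonneg_right this (norm_nonneg _))
    rw [← norm_mul]
    congr 1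
    have hne : (i : ℂ) + 1 + β ≠ 0 := by
      intro h0
      have h5 : β = -((i + 1 : ℕ) : ℂ) := by push_cast; linear_combination h0
      rw [h5, norm_neg, Complex.norm_natCast] at hβ
      push_cast at hβ
      linarith
    have h4 : ((i + 1 : ℕ) : ℂ) + 1 + β = ((i : ℂ) + 1 + β) + 1 := by push_cast; ring
    have h3 : (i.factorial : ℂ) ≠ 0 := by exact_mod_cast i.factorial_ne_zero
    have h2 : (i : ℂ) + 1 ≠ 0 := by exact_mod_cast Nat.succ_ne_zero i
    rw [h4, Complex.Gamma_add_one _ hne, Nat.factorial_succ]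
    push_cast
    field_simp

/-- Stirling's formula with relative error `O(1/n)`. -/
theorem factorial_asymp :
    ∃ C : ℝ, 0 ≤ C ∧ ∃ K : ℕ, 1 ≤ K ∧ ∀ n : ℕ, K ≤ n →
      |(n.factorial : ℝ) - Real.sqrt (2 * Real.pi * n) * (n / Real.exp 1) ^ n| ≤
        C / n * (Real.sqrt (2 * Real.pi * n) * (n / Real.exp 1) ^ n) := by
  refine ⟨8 * (1 / 4), by norm_num, 3, by norm_num, fun n hn => ?_⟩
  have hn3 : (3 : ℝ) ≤ n := by exact_mod_cast hn
  have hs : ∀ i : ℕ, 1 ≤ i → 0 < Stirling.stirlingSeq i := by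
    intro i hi
    obtain ⟨j, rfl⟩ : ∃ j, i = j + 1 := ⟨i - 1, by omega⟩
    exact Stirling.stirlingSeq'_pos j
  have key := norm_sub_le_of_relative_increment (C := 1 / 4) (by norm_num) (N := 1) (k := n)
    (u := fun i => (Stirling.stirlingSeq i : ℂ)) (L := (Real.sqrt Real.pi : ℂ)) (fun i hi => ?_)
    ((Complex.continuous_ofReal.tendsto _).comp Stirling.tendsto_stirlingSeq_sqrt_pi) (by omega)
    (by linarith)
  · rw [← Complex.ofReal_sub, Complex.norm_real, Complex.norm_real, Real.norm_eq_abs,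
      Real.norm_of_nonneg (Real.sqrt_nonneg _)] at key
    have hD : 0 < Real.sqrt (2 * n) * (n / Real.exp 1) ^ n := by positivity
    have h1 : (n.factorial : ℝ) = Stirling.stirlingSeq n * (Real.sqrt (2 * n) * (n / Real.exp 1) ^ n) := by
      rw [Stirling.stirlingSeq]
      field_simp
    have h2 : Real.sqrt (2 * Real.pi * n) = Real.sqrt Real.pi * Real.sqrt (2 * n) := by
      rw [← Real.sqrt_mul Real.pi_pos.le]; ring_nf
    rw [h1, h2, mul_assoc, ← sub_mul, abs_mul, abs_of_pos hD, ← mul_assoc]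
    rw [mul_assoc, ← mul_assoc (8 * (1 / 4) / (n : ℝ))]
    exact mul_le_mul_of_nonneg_right key hD.le
  · rw [← Complex.ofReal_sub, Complex.norm_real, Complex.norm_real, Real.norm_eq_abs,
      Real.norm_of_nonneg (hs i hi).le]
    have hd := Stirling.log_stirlingSeq_sdiff_le i
    have hi0 : (0 : ℝ) < i := by exact_mod_cast hi
    set a := Stirling.stirlingSeq i
    set b := Stirling.stirlingSeq (i + 1)
    have ha : 0 < a := hs i hi
    have hb : 0 < b := hs (i + 1) (by omega)
    have hab : b ≤ a := by
      obtain ⟨j, rfl⟩ : ∃ j, i = j + 1 := ⟨i - 1, by omega⟩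
      exact Stirling.stirlingSeq'_antitone (Nat.le_succ j)
    rw [abs_of_nonpos (by linarith)]
    have h3 : 1 - b / a ≤ Real.log a - Real.log b := by
      have := Real.log_le_sub_one_of_pos (x := b / a) (by positivity)
      rw [Real.log_div hb.ne' ha.ne'] at this
      linarith
    have h4 : 1 - b / a ≤ 1 / 4 / (i : ℝ) ^ 2 := by
      refine (h3.trans hd).trans ?_
      rw [div_div]
      exact one_div_le_one_div_of_le (by positivity) (by nlinarith)
    have h5 : -(b - a) = (1 - b / a) * a := by field_simp; ring
    rw [h5]
    gcongr

/-! ### Sums `∑ k ^ s * exp (-k λ)` through the trapezoidal rule -/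

open MeasureTheory Set in
theorem integrableOn_cpow_mul_exp {a lam : ℂ} (ha : 0 < a.re) (hl : 0 < lam.re) :
    IntegrableOn (fun t : ℝ => (t : ℂ) ^ (a - 1) * Complex.exp (-(lam * t))) (Ioi 0) := by
  have h : IntegrableOn (fun t : ℝ => t ^ (a.re - 1) * Real.exp (-lam.re * t)) (Ioi 0) := by
    have := integrableOn_rpow_mul_exp_neg_mul_rpow (p := 1) (s := a.re - 1) (b := lam.re)
      (by linarith) one_pos hl
    simpa using this
  refine Integrable.mono' h ?_ ?_
  · refine ContinuousOn.aestronglyMeasurable (fun t ht => ?_) measurableSet_Ioi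
    have ht' : (t : ℂ) ∈ Complex.slitPlane := Complex.ofReal_mem_slitPlane.2 ht
    refine ContinuousAt.continuousWithinAt ?_
    refine ContinuousAt.mul ?_ (by fun_prop)
    exact (Complex.continuous_ofReal.continuousAt).cpow continuousAt_const ht'
  · refine (ae_restrict_iff' measurableSet_Ioi).2 (Eventually.of_forall fun t ht => ?_)
    rw [norm_mul, Complex.norm_exp, Complex.norm_cpow_eq_rpow_re_of_pos ht]
    simp

open MeasureTheory Set in
/-- The Gamma integral with a complex rate: both sides are holomorphic in the rate and agree on
the positive real axis. -/
theorem integral_cpow_mul_exp_neg_mul_Ioi_complex {a : ℂ} (ha : 0 < a.re) {lam : ℂ}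
    (hl : 0 < lam.re) :
    ∫ t : ℝ in Ioi 0, (t : ℂ) ^ (a - 1) * Complex.exp (-(lam * t)) =
      lam ^ (-a) * Complex.Gamma a := by
  set U : Set ℂ := {z | 0 < z.re} with hU
  have hUo : IsOpen U := isOpen_lt continuous_const Complex.continuous_re
  have hd : DifferentiableOn ℂ (fun l : ℂ => ∫ t : ℝ in Ioi 0,
      (t : ℂ) ^ (a - 1) * Complex.exp (-(l * t))) U := by
    intro z hz
    refine DifferentiableAt.differentiableWithinAt ?_
    have hz' : 0 < z.re := hz
    have hs : {w : ℂ | z.re / 2 < w.re} ∈ nhds z :=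
      (isOpen_lt continuous_const Complex.continuous_re).mem_nhds (by
        simp only [mem_ofPred_eq]; linarith)
    have hint : ∀ w : ℂ, 0 < w.re → IntegrableOn
        (fun t : ℝ => (t : ℂ) ^ ((a + 1) - 1) * Complex.exp (-(w * t))) (Ioi 0) :=
      fun w hw => integrableOn_cpow_mul_exp (by simp; linarith) hw
    have hF' : ∀ w : ℂ, ∀ t ∈ Ioi (0 : ℝ), (t : ℂ) ^ (a - 1) * (Complex.exp (-(w * t)) * (-t)) =
        -((t : ℂ) ^ ((a + 1) - 1) * Complex.exp (-(w * t))) := by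
      intro w t ht
      have ht0 : (t : ℂ) ≠ 0 := by exact_mod_cast (ne_of_gt ht)
      have : (t : ℂ) ^ ((a + 1) - 1) = (t : ℂ) ^ (a - 1) * t := by
        rw [show (a + 1) - 1 = (a - 1) + 1 by ring, Complex.cpow_add _ _ ht0, Complex.cpow_one]
      rw [this]; ring
    have key := hasDerivAt_integral_of_dominated_loc_of_deriv_le (𝕜 := ℂ)
      (μ := volume.restrict (Ioi (0 : ℝ)))
      (F := fun l t => (t : ℂ) ^ (a - 1) * Complex.exp (-(l * t)))
      (F' := fun l t => (t : ℂ) ^ (a - 1) * (Complex.exp (-(l * t)) * (-t)))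
      (bound := fun t => ‖(t : ℂ) ^ ((a + 1) - 1) * Complex.exp (-(((z.re / 2 : ℝ) : ℂ) * t))‖)
      (x₀ := z) hs ?_ (integrableOn_cpow_mul_exp ha hz') ?_ ?_ ?_ ?_
    · exact key.2.differentiableAt
    · filter_upwards [hUo.mem_nhds hz] with w hw
      exact (integrableOn_cpow_mul_exp ha hw).aestronglyMeasurable
    · have : IntegrableOn (fun t : ℝ => (t : ℂ) ^ (a - 1) * (Complex.exp (-(z * t)) * (-t)))
          (Ioi 0) := (hint z hz').neg.congr_fun (fun t ht => (hF' z t ht).symm) measurableSet_Ioi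
      exact this.aestronglyMeasurable
    · refine (ae_restrict_iff' measurableSet_Ioi).2 (Eventually.of_forall fun t ht w hw => ?_)
      rw [hF' w t ht, norm_neg, norm_mul, norm_mul]
      gcongr
      rw [Complex.norm_exp, Complex.norm_exp]
      apply Real.exp_le_exp.2
      have ht' : 0 < t := ht
      have hw' : z.re / 2 < w.re := hw
      simp
      nlinarith
    · exact (hint _ (by simp; linarith)).norm
    · refine Eventually.of_forall fun t w _ => ?_
      have h1 : HasDerivAt (fun w : ℂ => -(w * t)) (-t : ℂ) w := by
        simpa using ((hasDerivAt_id w).mul_const (t : ℂ)).fun_neg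
      exact h1.cexp.const_mul _
  have hd2 : DifferentiableOn ℂ (fun l : ℂ => l ^ (-a) * Complex.Gamma a) U := by
    intro z hz
    have : z ∈ Complex.slitPlane := Or.inl hz
    exact (((differentiableAt_id).cpow_const this).mul_const _).differentiableWithinAt
  have hpre : IsPreconnected U := (convex_halfSpace_re_gt 0).isPreconnected
  refine (hd.analyticOnNhd hUo).eqOn_of_preconnected_of_frequently_eq
    (hd2.analyticOnNhd hUo) hpre (z₀ := 1) (by simp [hU]) ?_ hl
  have hreal : ∀ r : ℝ, 0 < r → (∫ t : ℝ in Ioi 0, (t : ℂ) ^ (a - 1) * Complex.exp (-((r : ℂ) * t)))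
      = (r : ℂ) ^ (-a) * Complex.Gamma a := by
    intro r hr
    rw [Complex.integral_cpow_mul_exp_neg_mul_Ioi ha hr, one_div, Complex.cpow_neg,
      Complex.inv_cpow _ _ (by rw [Complex.arg_ofReal_of_nonneg hr.le]; exact Real.pi_pos.ne)]
  have hseq : Tendsto (fun n : ℕ => ((1 + 1 / ((n : ℝ) + 1) : ℝ) : ℂ)) atTop
      (nhdsWithin 1 {1}ᶜ) := by
    refine tendsto_nhdsWithin_iff.2 ⟨?_, Eventually.of_forall fun n => ?_⟩
    · have := (tendsto_one_div_add_atTop_nhds_zero_nat (𝕜 := ℝ)).const_add 1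
      rw [add_zero] at this
      exact_mod_cast (Complex.continuous_ofReal.tendsto 1).comp this
    · have h : (1 / ((n : ℝ) + 1)) ≠ 0 := by positivity
      simp only [mem_compl_iff, mem_singleton_iff]
      rw [← Complex.ofReal_one, Complex.ofReal_inj]
      simpa using h
  exact hseq.frequently (Frequently.of_forall fun n => hreal _ (by positivity))

open MeasureTheory Set intervalIntegral in
/-- The trapezoidal rule on an interval of length one. -/
theorem trapezoid_unit {f f' f'' : ℝ → ℂ} (hf : Continuous f) (hf' : Continuous f')
    (hf'' : Continuous f'') (h1 : ∀ x, 0 < x → HasDerivAt f (f' x) x)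
    (h2 : ∀ x, 0 < x → HasDerivAt f' (f'' x) x) (k : ℕ) :
    ‖(f k + f (k + 1 : ℕ)) / 2 - ∫ x in (k : ℝ)..(k + 1 : ℕ), f x‖ ≤
      1 / 8 * ∫ x in (k : ℝ)..(k + 1 : ℕ), ‖f'' x‖ := by
  have hk : (k : ℝ) ≤ (k + 1 : ℕ) := by push_cast; linarith
  -- the kernel of the error, `p'' = -1`
  set p : ℝ → ℂ := fun x => (((x - k) * (k + 1 - x) / 2 : ℝ) : ℂ) with hp
  set p' : ℝ → ℂ := fun x => (((2 * k + 1 - 2 * x) / 2 : ℝ) : ℂ) with hp'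
  have hpd : ∀ x, HasDerivAt p (p' x) x := by
    intro x
    refine HasDerivAt.ofReal_comp ?_
    have := (((hasDerivAt_id x).sub_const (k : ℝ)).mul
      ((hasDerivAt_id x).const_sub ((k : ℝ) + 1))).div_const 2
    refine this.congr_deriv ?_
    simp only [id]; ring
  have hpd' : ∀ x, HasDerivAt p' (-1) x := by
    intro x
    have := ((((hasDerivAt_id x).const_mul (2 : ℝ)).const_sub (2 * (k : ℝ) + 1)).div_const 2).ofReal_comp
    refine this.congr_deriv ?_
    push_cast; ring
  have hpc : Continuous p := by simp only [hp]; fun_prop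
  have hpc' : Continuous p' := by simp only [hp']; fun_prop
  have hFTC := integral_eq_sub_of_hasDerivAt_of_le hk
    (f := fun x => p x * f' x - p' x * f x) (f' := fun x => p x * f'' x + f x)
    (by fun_prop) (fun x hx => by
      have hx0 : 0 < x := lt_of_le_of_lt (Nat.cast_nonneg k) hx.1
      have := ((hpd x).mul (h2 x hx0)).sub ((hpd' x).mul (h1 x hx0))
      refine this.congr_deriv ?_
      ring) (Continuous.intervalIntegrable (by fun_prop) _ _)
  rw [integral_add (Continuous.intervalIntegrable (by fun_prop) _ _)
    (hf.intervalIntegrable _ _)] at hFTC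
  have hends : (p ((k + 1 : ℕ) : ℝ) * f' ((k + 1 : ℕ) : ℝ) - p' ((k + 1 : ℕ) : ℝ) * f ((k + 1 : ℕ) : ℝ))
      - (p k * f' k - p' k * f k) = (f k + f (k + 1 : ℕ)) / 2 := by
    simp only [hp, hp']
    push_cast
    ring
  rw [hends] at hFTC
  rw [← hFTC, add_sub_cancel_right, ← intervalIntegral.integral_const_mul]
  refine norm_integral_le_of_norm_le hk ?_ (Continuous.intervalIntegrable (by fun_prop) _ _)
  refine Eventually.of_forall fun x hx => ?_
  rw [norm_mul]
  gcongr
  have hx1 := hx.1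
  have hx2 := hx.2
  push_cast at hx2
  rw [hp, Complex.norm_real, Real.norm_eq_abs, abs_of_nonneg (by nlinarith)]
  nlinarith [sq_nonneg (x - k - 1 / 2)]

open MeasureTheory Set intervalIntegral in
/-- The trapezoidal rule on `[0, ∞)`: its error is at most the integral of the second derivative. -/
theorem norm_tsum_sub_integral_le {f f' f'' : ℝ → ℂ} (hf : Continuous f) (hf' : Continuous f')
    (hf'' : Continuous f'') (h1 : ∀ x, 0 < x → HasDerivAt f (f' x) x)
    (h2 : ∀ x, 0 < x → HasDerivAt f' (f'' x) x) (h0 : f 0 = 0)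
    (hi : IntegrableOn f (Ioi 0)) (hi2 : IntegrableOn f'' (Ioi 0))
    (hs : Summable fun k : ℕ => f k) :
    ‖∑' k : ℕ, f k - ∫ x in Ioi 0, f x‖ ≤ 1 / 8 * ∫ x in Ioi 0, ‖f'' x‖ := by
  have hfin : ∀ N : ℕ, ‖(∑ k ∈ Finset.range N, f k + f N / 2) - ∫ x in (0 : ℝ)..N, f x‖ ≤
      1 / 8 * ∫ x in (0 : ℝ)..N, ‖f'' x‖ := by
    intro N
    induction N with
    | zero => simp [h0]
    | succ N ih =>
      have hT := trapezoid_unit hf hf' hf'' h1 h2 N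
      rw [← integral_add_adjacent_intervals (hf.intervalIntegrable 0 N)
          (hf.intervalIntegrable N (N + 1 : ℕ)),
        ← integral_add_adjacent_intervals (hf''.norm.intervalIntegrable 0 N)
          (hf''.norm.intervalIntegrable N (N + 1 : ℕ)), Finset.sum_range_succ]
      rw [mul_add]
      refine le_trans (le_of_eq_of_le ?_ (norm_add_le _ _)) (add_le_add ih hT)
      congr 1
      ring
  have hfN : Tendsto (fun N : ℕ => f N / 2) atTop (nhds 0) := by
    simpa using hs.tendsto_atTop_zero.div_const 2
  have hsum : Tendsto (fun N : ℕ => (∑ k ∈ Finset.range N, f k + f N / 2) - ∫ x in (0 : ℝ)..N, f x)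
      atTop (nhds (∑' k : ℕ, f k + 0 - ∫ x in Ioi 0, f x)) :=
    (hs.hasSum.tendsto_sum_nat.add hfN).sub
      (intervalIntegral_tendsto_integral_Ioi 0 hi tendsto_natCast_atTop_atTop)
  rw [add_zero] at hsum
  have hbd := (intervalIntegral_tendsto_integral_Ioi 0 hi2.norm
    tendsto_natCast_atTop_atTop).const_mul (1 / 8)
  exact le_of_tendsto_of_tendsto' hsum.norm hbd hfin

theorem summable_cpow_mul_exp {s lam : ℂ} (hl : 0 < lam.re) :
    Summable fun k : ℕ => (k : ℂ) ^ s * Complex.exp (-(lam * k)) := by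
  obtain ⟨m, hm⟩ := exists_nat_ge s.re
  have h := Real.summable_pow_mul_exp_neg_nat_mul m hl
  rw [← summable_nat_add_iff 1] at h ⊢
  refine Summable.of_norm_bounded h fun k => ?_
  rw [norm_mul, Complex.norm_exp, Complex.norm_natCast_cpow_of_pos (by omega)]
  have h1 : (1 : ℝ) ≤ (k + 1 : ℕ) := by push_cast; linarith [Nat.cast_nonneg (α := ℝ) k]
  have h2 : (-(lam * ((k + 1 : ℕ) : ℂ))).re = -lam.re * ((k + 1 : ℕ) : ℝ) := by
    rw [Complex.neg_re, ← Complex.ofReal_natCast, Complex.re_mul_ofReal]; ring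
  rw [h2, ← Real.rpow_natCast]
  gcongr

/-- The sum `∑ k ^ s exp (-λ k)` equals the corresponding Gamma integral up to a relative error
`O(1/s + (Im λ)²)`, where the error is measured against the integral of the absolute value. The
second derivative in the trapezoidal rule is
`((s / x - λ) ^ 2 - s / x ^ 2) * x ^ s exp (-λ x)`, and `x` has variance `O(1/s)` under the Gamma
density. -/
theorem norm_tsum_cpow_mul_exp_sub_le {s lam : ℂ} {M : ℝ} (hs : 3 ≤ s.re) (hM : |s.im| ≤ M)
    (hl : 0 < lam.re) :
    ‖∑' k : ℕ, (k : ℂ) ^ s * Complex.exp (-(lam * k)) -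
        lam ^ (-(s + 1)) * Complex.Gamma (s + 1)‖ ≤
      (lam.re ^ 2 * (3 + 4 * M ^ 2 + M) / s.re + lam.im ^ 2) *
        (lam.re ^ (-(s.re + 1)) * Real.Gamma (s.re + 1)) := by
  have hM0 : 0 ≤ M := (abs_nonneg _).trans hM
  set σ := s.re with hσ
  set μ := lam.re with hμ
  have hs0 : s ≠ 0 := by intro h; rw [h] at hσ; simp at hσ; linarith
  set f : ℝ → ℂ := fun x => (x : ℂ) ^ s * Complex.exp (-(lam * x)) with hf
  set f' : ℝ → ℂ := fun x => (s * (x : ℂ) ^ (s - 1) - lam * (x : ℂ) ^ s) *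
    Complex.exp (-(lam * x)) with hf'
  set f'' : ℝ → ℂ := fun x => (s * (s - 1) * (x : ℂ) ^ (s - 2) - 2 * lam * s * (x : ℂ) ^ (s - 1) +
    lam ^ 2 * (x : ℂ) ^ s) * Complex.exp (-(lam * x)) with hf''
  have c0 : Continuous fun x : ℝ => (x : ℂ) ^ s :=
    Complex.continuous_ofReal_cpow_const (by linarith)
  have c1 : Continuous fun x : ℝ => (x : ℂ) ^ (s - 1) :=
    Complex.continuous_ofReal_cpow_const (by simp; linarith)
  have c2 : Continuous fun x : ℝ => (x : ℂ) ^ (s - 2) :=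
    Complex.continuous_ofReal_cpow_const (by simp; linarith)
  have dexp : ∀ x : ℝ, HasDerivAt (fun x : ℝ => Complex.exp (-(lam * x)))
      (Complex.exp (-(lam * x)) * (-lam)) x := by
    intro x
    have : HasDerivAt (fun z : ℂ => -(lam * z)) (-lam) (x : ℂ) := by
      simpa using ((hasDerivAt_id (x : ℂ)).const_mul lam).fun_neg
    exact this.cexp.comp_ofReal
  have dpow : ∀ r : ℂ, ∀ x : ℝ, 0 < x → HasDerivAt (fun x : ℝ => (x : ℂ) ^ r)
      (r * (x : ℂ) ^ (r - 1)) x := by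
    intro r x hx
    have := (hasDerivAt_id (x : ℂ)).cpow_const (c := r) (Complex.ofReal_mem_slitPlane.2 hx)
    simpa using this.comp_ofReal
  have hd1 : ∀ x, 0 < x → HasDerivAt f (f' x) x := by
    intro x hx
    refine ((dpow s x hx).mul (dexp x)).congr_deriv ?_
    simp only [hf']; ring
  have hd2 : ∀ x, 0 < x → HasDerivAt f' (f'' x) x := by
    intro x hx
    refine (((((dpow (s - 1) x hx).const_mul s)).fun_sub ((dpow s x hx).const_mul lam)).mul
      (dexp x)).congr_deriv ?_
    simp only [hf'']
    rw [show s - 1 - 1 = s - 2 by ring]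
    ring
  have hint : ∀ j : ℝ, j ≤ 2 → ∀ l : ℂ, 0 < l.re → MeasureTheory.IntegrableOn (fun x : ℝ =>
      (x : ℂ) ^ (s - j) * Complex.exp (-(l * x))) (Set.Ioi 0) := by
    intro j hj l hl
    have := integrableOn_cpow_mul_exp (a := s - j + 1) (lam := l) (by simp; linarith) hl
    simpa using this
  have i0 := hint 0 (by norm_num) lam hl
  have i1 := hint 1 (by norm_num) lam hl
  have i2 := hint 2 (by norm_num) lam hl
  simp only [Complex.ofReal_zero, sub_zero, Complex.ofReal_one, Complex.ofReal_ofNat] at i0 i1 i2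
  have hi2 : MeasureTheory.IntegrableOn f'' (Set.Ioi 0) := by
    refine (((i2.const_mul (s * (s - 1))).sub (i1.const_mul (2 * lam * s))).add
      (i0.const_mul (lam ^ 2))).congr (Eventually.of_forall fun x => ?_)
    simp only [hf'', Pi.add_apply, Pi.sub_apply]; ring
  have key := norm_tsum_sub_integral_le (f := f) (f' := f') (f'' := f'') (by fun_prop)
    (by fun_prop) (by fun_prop) hd1 hd2 (by simp [hf, hs0]) i0 hi2 (summable_cpow_mul_exp hl)
  have hgam : ∫ x in Set.Ioi (0 : ℝ), f x = lam ^ (-(s + 1)) * Complex.Gamma (s + 1) := by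
    rw [← integral_cpow_mul_exp_neg_mul_Ioi_complex (by simp; linarith) hl]
    simp [hf]
  rw [hgam] at key
  refine key.trans ?_
  -- the dominating function and its integral
  have r0 : ∀ j : ℝ, j ≤ 2 → MeasureTheory.IntegrableOn (fun x : ℝ =>
      x ^ (σ - j) * Real.exp (-(μ * x))) (Set.Ioi 0) := by
    intro j hj
    have := integrableOn_rpow_mul_exp_neg_mul_rpow (p := 1) (s := σ - j) (b := μ)
      (by linarith) one_pos hl
    simpa using this
  have rv : ∀ j : ℝ, j ≤ 2 → ∫ x in Set.Ioi (0 : ℝ), x ^ (σ - j) * Real.exp (-(μ * x)) =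
      μ ^ (-(σ + 1)) * μ ^ j * Real.Gamma (σ - j + 1) := by
    intro j hj
    have := Real.integral_rpow_mul_exp_neg_mul_Ioi (a := σ - j + 1) (r := μ) (by linarith) hl
    rw [add_sub_cancel_right] at this
    rw [this, one_div, Real.inv_rpow hl.le, ← Real.rpow_neg hl.le, ← Real.rpow_add hl]
    congr 2
    ring
  set A := 2 * σ ^ 2 + 4 * M ^ 2 + σ + M with hA
  set B := 2 * μ ^ 2 + 4 * lam.im ^ 2 with hB
  have hdom : ∀ x ∈ Set.Ioi (0 : ℝ), ‖f'' x‖ ≤ A * (x ^ (σ - 2) * Real.exp (-(μ * x))) -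
      4 * σ * μ * (x ^ (σ - 1) * Real.exp (-(μ * x))) + B * (x ^ (σ - 0) * Real.exp (-(μ * x))) := by
    intro x hx
    have hx0 : 0 < x := hx
    have hxc : (x : ℂ) ≠ 0 := by exact_mod_cast hx0.ne'
    have e1 : (x : ℂ) ^ (s - 1) = (x : ℂ) ^ (s - 2) * x := by
      rw [show s - 1 = s - 2 + 1 by ring, Complex.cpow_add _ _ hxc, Complex.cpow_one]
    have e0 : (x : ℂ) ^ s = (x : ℂ) ^ (s - 2) * x ^ 2 := by
      conv_lhs => rw [show s = s - 2 + 2 by ring]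
      rw [Complex.cpow_add _ _ hxc]
      norm_cast
    have e : f'' x = ((s - lam * x) ^ 2 - s) * ((x : ℂ) ^ (s - 2) * Complex.exp (-(lam * x))) := by
      simp only [hf'']; rw [e1, e0]; ring
    have n1 : ‖(x : ℂ) ^ (s - 2) * Complex.exp (-(lam * x))‖ = x ^ (σ - 2) * Real.exp (-(μ * x)) := by
      rw [norm_mul, Complex.norm_exp, Complex.norm_cpow_eq_rpow_re_of_pos hx0]
      simp [hσ, hμ]
    have r1 : x ^ (σ - 1) = x ^ (σ - 2) * x := by
      rw [show σ - 1 = σ - 2 + 1 by ring, Real.rpow_add hx0, Real.rpow_one]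
    have r2 : x ^ (σ - 0) = x ^ (σ - 2) * x ^ 2 := by
      rw [show σ - 0 = σ - 2 + 2 by ring, Real.rpow_add hx0, Real.rpow_two]
    have n2 : ‖(s - lam * x) ^ 2 - s‖ ≤ A - 4 * σ * μ * x + B * x ^ 2 := by
      have hns : ‖s‖ ≤ σ + M := by
        refine (Complex.norm_le_abs_re_add_abs_im s).trans ?_
        rw [abs_of_nonneg (by linarith)]; linarith
      have hsq : ‖s - lam * x‖ ^ 2 = (σ - μ * x) ^ 2 + (s.im - lam.im * x) ^ 2 := by
        rw [Complex.sq_norm, Complex.normSq_apply]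
        simp [hσ, hμ]; ring
      have him : (s.im) ^ 2 ≤ M ^ 2 := by
        rw [← sq_abs]; gcongr
      calc ‖(s - lam * x) ^ 2 - s‖ ≤ ‖s - lam * x‖ ^ 2 + ‖s‖ := by
            refine (norm_sub_le _ _).trans ?_
            rw [norm_pow]
        _ ≤ A - 4 * σ * μ * x + B * x ^ 2 := by
            rw [hsq, hA, hB]
            nlinarith [sq_nonneg (σ - μ * x), sq_nonneg (s.im + lam.im * x)]
    rw [e, norm_mul, n1, r1, r2]
    calc _ ≤ (A - 4 * σ * μ * x + B * x ^ 2) * (x ^ (σ - 2) * Real.exp (-(μ * x))) := by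
          gcongr
      _ = _ := by ring
  have hi : MeasureTheory.IntegrableOn (fun x : ℝ => A * (x ^ (σ - 2) * Real.exp (-(μ * x))) -
      4 * σ * μ * (x ^ (σ - 1) * Real.exp (-(μ * x)))) (Set.Ioi 0) := ((r0 2 le_rfl).const_mul A).sub ((r0 1 (by norm_num)).const_mul (4 * σ * μ))
  have hle : ∫ x in Set.Ioi (0 : ℝ), ‖f'' x‖ ≤ ∫ x in Set.Ioi (0 : ℝ),
      (A * (x ^ (σ - 2) * Real.exp (-(μ * x))) - 4 * σ * μ * (x ^ (σ - 1) * Real.exp (-(μ * x))) +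
        B * (x ^ (σ - 0) * Real.exp (-(μ * x)))) := MeasureTheory.setIntegral_mono_on hi2.norm
    (hi.add ((r0 0 (by norm_num)).const_mul B)) measurableSet_Ioi hdom
  have hval : ∫ x in Set.Ioi (0 : ℝ), (A * (x ^ (σ - 2) * Real.exp (-(μ * x))) -
      4 * σ * μ * (x ^ (σ - 1) * Real.exp (-(μ * x))) + B * (x ^ (σ - 0) * Real.exp (-(μ * x)))) =
      (μ ^ 2 * (3 * σ + 4 * M ^ 2 + M) / (σ * (σ - 1)) + 4 * lam.im ^ 2) *
        (μ ^ (-(σ + 1)) * Real.Gamma (σ + 1)) := by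
    rw [MeasureTheory.integral_add hi ((r0 0 (by norm_num)).const_mul B),
      MeasureTheory.integral_sub ((r0 2 le_rfl).const_mul A)
        ((r0 1 (by norm_num)).const_mul (4 * σ * μ)),
      MeasureTheory.integral_const_mul, MeasureTheory.integral_const_mul,
      MeasureTheory.integral_const_mul, rv 2 le_rfl, rv 1 (by norm_num), rv 0 (by norm_num)]
    have g1 : Real.Gamma (σ + 1) = σ * Real.Gamma σ := Real.Gamma_add_one (by linarith)
    have g2 : Real.Gamma σ = (σ - 1) * Real.Gamma (σ - 1) := by
      have := Real.Gamma_add_one (s := σ - 1) (by linarith)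
      rwa [sub_add_cancel] at this
    have a1 : σ - 2 + 1 = σ - 1 := by ring
    have a2 : σ - 1 + 1 = σ := by ring
    have a3 : σ - 0 + 1 = σ + 1 := by ring
    have n1 : σ - 1 ≠ 0 := by linarith
    have n2 : σ ≠ 0 := by linarith
    rw [a1, a2, a3, g1, g2, Real.rpow_two, Real.rpow_one, Real.rpow_zero, hA, hB]
    field_simp
    ring
  have hfin : 1 / 8 * (μ ^ 2 * (3 * σ + 4 * M ^ 2 + M) / (σ * (σ - 1)) + 4 * lam.im ^ 2) ≤
      μ ^ 2 * (3 + 4 * M ^ 2 + M) / σ + lam.im ^ 2 := by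
    have h1 : μ ^ 2 * (3 * σ + 4 * M ^ 2 + M) / (σ * (σ - 1)) ≤
        8 * (μ ^ 2 * (3 + 4 * M ^ 2 + M) / σ) := by
      rw [← mul_div_assoc, div_le_div_iff₀ (by nlinarith) (by linarith)]
      have h2 : (3 * σ + 4 * M ^ 2 + M) ≤ 8 * (3 + 4 * M ^ 2 + M) * (σ - 1) := by
        nlinarith [sq_nonneg M]
      have h3 : 0 ≤ μ ^ 2 * σ := by positivity
      nlinarith [mul_le_mul_of_nonneg_left h2 h3]
    nlinarith [sq_nonneg lam.im]
  have hT : 0 ≤ μ ^ (-(σ + 1)) * Real.Gamma (σ + 1) := by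
    have := Real.Gamma_pos_of_pos (s := σ + 1) (by linarith)
    positivity
  calc 1 / 8 * ∫ x in Set.Ioi (0 : ℝ), ‖f'' x‖ ≤ 1 / 8 * _ :=
        mul_le_mul_of_nonneg_left hle (by norm_num)
    _ = (1 / 8 * (μ ^ 2 * (3 * σ + 4 * M ^ 2 + M) / (σ * (σ - 1)) + 4 * lam.im ^ 2)) *
        (μ ^ (-(σ + 1)) * Real.Gamma (σ + 1)) := by
        rw [hval, ← mul_assoc]
    _ ≤ _ := by gcongr

/-! ### The functions `(exp x - 1) / x`, its logarithm, and the mean of the logarithm -/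

/-- The entire function `(exp x - 1) / x`, with value `1` at `0`. -/
noncomputable def expQuot (x : ℂ) : ℂ := dslope Complex.exp 0 x

/-- The principal logarithm of `(exp x - 1) / x`; only used for `‖x‖ < 1`, where it is
holomorphic. -/
noncomputable def logExpQuot (x : ℂ) : ℂ := Complex.log (expQuot x)

/-- The mean value `∫₀¹ log ((exp (x w) - 1) / (x w)) dx`. -/
noncomputable def meanLog (w : ℂ) : ℂ := ∫ x in (0 : ℝ)..1, logExpQuot (x * w)

theorem mul_expQuot (x : ℂ) : x * expQuot x = Complex.exp x - 1 := by
  have := sub_smul_dslope Complex.exp 0 x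
  simpa [expQuot] using this

theorem expQuot_zero : expQuot 0 = 1 := by simp [expQuot]

theorem differentiable_expQuot : Differentiable ℂ expQuot := by
  have h : DifferentiableOn ℂ (dslope Complex.exp 0) Set.univ :=
    (Complex.differentiableOn_dslope Filter.univ_mem).2 Complex.differentiable_exp.differentiableOn
  exact differentiableOn_univ.1 h

theorem norm_expQuot_sub_one_le {x : ℂ} (hx : ‖x‖ ≤ 1) : ‖expQuot x - 1‖ ≤ ‖x‖ := by
  rcases eq_or_ne x 0 with rfl | h0
  · simp [expQuot_zero]
  have h := Complex.norm_exp_sub_one_sub_id_le hx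
  have h2 : Complex.exp x - 1 - x = x * (expQuot x - 1) := by rw [← mul_expQuot]; ring
  rw [h2, norm_mul, sq] at h
  exact le_of_mul_le_mul_left h (norm_pos_iff.2 h0)

theorem expQuot_mem_slitPlane {x : ℂ} (hx : ‖x‖ < 1) : expQuot x ∈ Complex.slitPlane := by
  have := Complex.mem_slitPlane_of_norm_lt_one
    (lt_of_le_of_lt (norm_expQuot_sub_one_le hx.le) hx)
  simpa using this

theorem expQuot_ne_zero {x : ℂ} (hx : ‖x‖ < 1) : expQuot x ≠ 0 :=
  Complex.slitPlane_ne_zero (expQuot_mem_slitPlane hx)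

theorem exp_logExpQuot {x : ℂ} (hx : ‖x‖ < 1) : Complex.exp (logExpQuot x) = expQuot x :=
  Complex.exp_log (expQuot_ne_zero hx)

theorem logExpQuot_zero : logExpQuot 0 = 0 := by simp [logExpQuot, expQuot_zero]

theorem differentiableAt_logExpQuot {x : ℂ} (hx : ‖x‖ < 1) :
    DifferentiableAt ℂ logExpQuot x :=
  (differentiable_expQuot x).clog (expQuot_mem_slitPlane hx)

theorem differentiableOn_logExpQuot : DifferentiableOn ℂ logExpQuot (Metric.ball 0 1) :=
  fun _ hx => (differentiableAt_logExpQuot (by simpa using hx)).differentiableWithinAt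

theorem mul_deriv_logExpQuot {x : ℂ} (hx : ‖x‖ < 1) :
    x * deriv logExpQuot x = Complex.exp x / expQuot x - 1 := by
  have h1 : deriv logExpQuot x = deriv expQuot x / expQuot x :=
    ((differentiable_expQuot x).hasDerivAt.clog (expQuot_mem_slitPlane hx)).deriv
  have h2 : HasDerivAt (fun y => y * expQuot y) (1 * expQuot x + x * deriv expQuot x) x :=
    (hasDerivAt_id x).fun_mul (differentiable_expQuot x).hasDerivAt
  have h3 : HasDerivAt (fun y => Complex.exp y - 1) (Complex.exp x) x :=
    (Complex.hasDerivAt_exp x).sub_const 1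
  have h4 : (fun y => y * expQuot y) = fun y => Complex.exp y - 1 := funext mul_expQuot
  rw [h4] at h2
  have h5 := h2.unique h3
  have hne := expQuot_ne_zero hx
  rw [h1]
  field_simp
  linear_combination h5

theorem norm_mul_of_mem_Icc_lt {x : ℝ} (hx : x ∈ Set.Icc (0 : ℝ) 1) {w : ℂ} (hw : ‖w‖ < 1) :
    ‖(x : ℂ) * w‖ < 1 := by
  rw [norm_mul, Complex.norm_real, Real.norm_of_nonneg hx.1]
  nlinarith [norm_nonneg w, hx.2, hx.1]

theorem continuousOn_logExpQuot_segment {w : ℂ} (hw : ‖w‖ < 1) :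
    ContinuousOn (fun x : ℝ => logExpQuot (x * w)) (Set.Icc 0 1) := by
  intro x hx
  have h1 := (differentiableAt_logExpQuot (norm_mul_of_mem_Icc_lt hx hw)).continuousAt
  have h2 : ContinuousAt (fun x : ℝ => (x : ℂ) * w) x := by fun_prop
  exact (ContinuousAt.comp (f := fun x : ℝ => (x : ℂ) * w) h1 h2).continuousWithinAt

/-- `w * meanLog w` is the primitive of `logExpQuot` that vanishes at `0`. -/
theorem hasDerivAt_mul_meanLog {w : ℂ} (hw : ‖w‖ < 1) :
    HasDerivAt (fun w => w * meanLog w) (logExpQuot w) w := by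
  obtain ⟨g, hg⟩ := differentiableOn_logExpQuot.isExactOn_ball
  have hval : ∀ v ∈ Metric.ball (0 : ℂ) 1, v * meanLog v = g v - g 0 := by
    intro v hv
    have hv' : ‖v‖ < 1 := by simpa using hv
    have h1 : ∀ x ∈ Set.uIcc (0 : ℝ) 1, HasDerivAt (fun x : ℝ => g (x * v))
        (v * logExpQuot (x * v)) x := by
      intro x hx
      rw [Set.uIcc_of_le zero_le_one] at hx
      have hx' : (x : ℂ) * v ∈ Metric.ball (0 : ℂ) 1 := by
        simpa using norm_mul_of_mem_Icc_lt hx hv'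
      have h2 : HasDerivAt (fun z : ℂ => z * v) v (x : ℂ) := by
        simpa using (hasDerivAt_id (x : ℂ)).mul_const v
      have := HasDerivAt.comp (x : ℂ) (hg _ hx') h2
      rw [mul_comm]
      exact this.comp_ofReal
    have h3 := intervalIntegral.integral_eq_sub_of_hasDerivAt h1
      (ContinuousOn.intervalIntegrable (by
        rw [Set.uIcc_of_le zero_le_one]
        exact continuousOn_const.mul (continuousOn_logExpQuot_segment hv')))
    rw [intervalIntegral.integral_const_mul] at h3
    simpa [meanLog] using h3
  have hmem : Metric.ball (0 : ℂ) 1 ∈ nhds w := Metric.isOpen_ball.mem_nhds (by simpa using hw)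
  refine ((hg w (by simpa using hw)).sub_const (g 0)).congr_of_eventuallyEq ?_
  filter_upwards [hmem] with v hv using hval v hv

/-- Away from `0`, the derivative of `meanLog` follows from that of `w * meanLog w`. -/
theorem hasDerivAt_meanLog {w : ℂ} (hw : ‖w‖ < 1) (h0 : w ≠ 0) :
    HasDerivAt meanLog ((logExpQuot w - meanLog w) / w) w := by
  have h := (hasDerivAt_mul_meanLog hw).div (hasDerivAt_id w) h0
  have h1 : HasDerivAt meanLog ((logExpQuot w * id w - w * meanLog w * 1) / id w ^ 2) w := by
    refine h.congr_of_eventuallyEq ?_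
    filter_upwards [isOpen_ne.mem_nhds h0] with v hv
    simp only [Pi.div_apply, id]
    rw [mul_div_cancel_left₀ _ hv]
  refine h1.congr_deriv ?_
  simp only [id]
  field_simp

theorem norm_sinh_le (z : ℂ) : ‖Complex.sinh z‖ ≤ Real.sinh ‖z‖ := by
  refine (Complex.hasSum_sinh z).norm_le_of_bounded (Real.hasSum_sinh ‖z‖) fun n => ?_
  rw [norm_div, norm_pow, Complex.norm_natCast]

theorem mul_norm_expQuot (w : ℂ) :
    ‖w‖ * ‖expQuot w‖ = 2 * Real.exp (w.re / 2) * ‖Complex.sinh (w / 2)‖ := by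
  rw [← norm_mul, mul_expQuot]
  have : Complex.exp w - 1 = 2 * Complex.exp (w / 2) * Complex.sinh (w / 2) := by
    rw [Complex.sinh, Complex.exp_neg]
    have h : Complex.exp w = Complex.exp (w / 2) * Complex.exp (w / 2) := by
      rw [← Complex.exp_add]; congr 1; ring
    have := Complex.exp_ne_zero (w / 2)
    rw [h]; field_simp
  rw [this, norm_mul, norm_mul, Complex.norm_exp]
  simp

/-- On a circle about `0` the modulus of `(exp w - 1) / w` is largest at the positive real point,
because `sinh (w / 2) / (w / 2)` has nonnegative Taylor coefficients. -/
theorem norm_expQuot_le (w : ℂ) :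
    ‖expQuot w‖ ≤ ‖expQuot (‖w‖ : ℝ)‖ * Real.exp (-((‖w‖ - w.re) / 2)) := by
  rcases eq_or_ne w 0 with rfl | h0
  · simp
  have hw : 0 < ‖w‖ := norm_pos_iff.2 h0
  have h1 := mul_norm_expQuot w
  have h2 := mul_norm_expQuot (‖w‖ : ℝ)
  rw [Complex.norm_real, norm_norm, Complex.ofReal_re] at h2
  have h3 : ‖Complex.sinh (((‖w‖ : ℝ) : ℂ) / 2)‖ = Real.sinh (‖w‖ / 2) := by
    rw [show ((‖w‖ : ℝ) : ℂ) / 2 = ((‖w‖ / 2 : ℝ) : ℂ) by push_cast; ring, ← Complex.ofReal_sinh,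
      Complex.norm_real, Real.norm_of_nonneg (Real.sinh_nonneg_iff.2 (by positivity))]
  have h4 : ‖Complex.sinh (w / 2)‖ ≤ Real.sinh (‖w‖ / 2) := by
    refine (norm_sinh_le _).trans (le_of_eq ?_)
    simp
  refine le_of_mul_le_mul_left ?_ hw
  rw [h1, ← mul_assoc, h2, h3]
  have h5 : Real.exp (w.re / 2) = Real.exp (‖w‖ / 2) * Real.exp (-((‖w‖ - w.re) / 2)) := by
    rw [← Real.exp_add]; congr 1; ring
  rw [h5]
  calc _ ≤ 2 * (Real.exp (‖w‖ / 2) * Real.exp (-((‖w‖ - w.re) / 2))) * Real.sinh (‖w‖ / 2) := by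
        gcongr
    _ = _ := by ring

/-- A quantitative form of the maximality on the positive real axis. The summand `(‖w‖ - Re w) / 2`
is the source of the quadratic growth of `Re (rate θ)`. -/
theorem logExpQuot_re_le {w : ℂ} (hw : ‖w‖ < 1) :
    (logExpQuot w).re ≤ (logExpQuot (‖w‖ : ℝ)).re - (‖w‖ - w.re) / 2 := by
  have h1 : 0 < ‖expQuot w‖ := norm_pos_iff.2 (expQuot_ne_zero hw)
  have h2 : 0 < ‖expQuot (‖w‖ : ℝ)‖ := norm_pos_iff.2 (expQuot_ne_zero (by simpa using hw))
  simp only [logExpQuot, Complex.log_re]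
  have := Real.log_le_log h1 (norm_expQuot_le w)
  rwa [Real.log_mul h2.ne' (Real.exp_pos _).ne', Real.log_exp, ← sub_eq_add_neg] at this

theorem meanLog_re {w : ℂ} (hw : ‖w‖ < 1) :
    (meanLog w).re = ∫ x in (0 : ℝ)..1, (logExpQuot (x * w)).re := by
  have h : IntervalIntegrable (fun x : ℝ => logExpQuot (x * w)) MeasureTheory.volume 0 1 :=
    ContinuousOn.intervalIntegrable (by
      rw [Set.uIcc_of_le zero_le_one]; exact continuousOn_logExpQuot_segment hw)
  exact (Complex.reCLM.intervalIntegral_comp_comm h).symm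

theorem meanLog_re_le {w : ℂ} (hw : ‖w‖ < 1) :
    (meanLog w).re ≤ (meanLog (‖w‖ : ℝ)).re - (‖w‖ - w.re) / 4 := by
  have hw' : ‖((‖w‖ : ℝ) : ℂ)‖ < 1 := by simpa using hw
  have hc : ∀ v : ℂ, ‖v‖ < 1 →
      IntervalIntegrable (fun x : ℝ => (logExpQuot (x * v)).re) MeasureTheory.volume 0 1 := by
    intro v hv
    refine ContinuousOn.intervalIntegrable ?_
    rw [Set.uIcc_of_le zero_le_one]
    exact Complex.continuous_re.comp_continuousOn (continuousOn_logExpQuot_segment hv)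
  have hlin : IntervalIntegrable (fun x : ℝ => x * ((‖w‖ - w.re) / 2)) MeasureTheory.volume 0 1 :=
    Continuous.intervalIntegrable (by fun_prop) _ _
  have key := intervalIntegral.integral_mono_on zero_le_one (hc w hw) ((hc _ hw').sub hlin)
    (fun x hx => ?_)
  · rw [intervalIntegral.integral_sub (hc _ hw') hlin, ← meanLog_re hw, ← meanLog_re hw',
      intervalIntegral.integral_mul_const, integral_id] at key
    linarith
  · have h := logExpQuot_re_le (norm_mul_of_mem_Icc_lt hx hw)
    rw [norm_mul, Complex.norm_real, Real.norm_of_nonneg hx.1, Complex.re_ofReal_mul] at h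
    push_cast at h ⊢
    linarith

/-! ### The dilogarithm value `∫₀¹ log (1 + y) / y dy = π² / 12` -/

theorem hasSum_alternating_inv_sq :
    HasSum (fun m : ℕ => (-1 : ℝ) ^ m / ((m : ℝ) + 1) ^ 2) (Real.pi ^ 2 / 12) := by
  have h := hasSum_one_div_nat_pow_mul_cos (k := 1) one_ne_zero (x := 1 / 2) (by norm_num)
  have hB : Polynomial.eval (1 / 2 : ℝ) (Polynomial.map (algebraMap ℚ ℝ) (Polynomial.bernoulli 2)) =
      -1 / 12 := by
    simp [Polynomial.bernoulli, Finset.sum_range_succ, bernoulli, bernoulli'_two]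
    norm_num
  rw [mul_one, hB] at h
  have h2 := (hasSum_nat_add_iff' 1).2 h
  have h3 := h2.neg
  have hcos : ∀ m : ℕ, Real.cos (2 * Real.pi * ((m + 1 : ℕ) : ℝ) * (1 / 2)) = (-1) ^ (m + 1) := by
    intro m
    rw [← Real.cos_nat_mul_pi (m + 1)]
    congr 1; push_cast; ring
  simp only [hcos] at h3
  convert! h3 using 1
  · funext m
    push_cast; field_simp; ring
  · simp
    field_simp

/-- The integral `∫ log x / (x - 1)` over `[1, 2]`, expanded into the alternating series
`∑ (-1) ^ m / (m + 1) ^ 2`. -/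
theorem integral_dslope_log :
    ∫ x in (1 : ℝ)..2, dslope Real.log 1 x = Real.pi ^ 2 / 12 := by
  have h0 : ∫ x in (1 : ℝ)..2, dslope Real.log 1 x = ∫ y in (0 : ℝ)..1, dslope Real.log 1 (1 + y) := by
    rw [intervalIntegral.integral_comp_add_left (fun x => dslope Real.log 1 x)]
    norm_num
  have hval : ∀ m : ℕ, ∫ y in (0 : ℝ)..1, (-1 : ℝ) ^ m / ((m : ℝ) + 1) * y ^ m =
      (-1 : ℝ) ^ m / ((m : ℝ) + 1) ^ 2 := by
    intro m
    rw [intervalIntegral.integral_const_mul, integral_pow]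
    field_simp
    simp
  have key := MeasureTheory.hasSum_integral_of_summable_integral_norm
    (μ := MeasureTheory.volume.restrict (Set.Ioc (0 : ℝ) 1))
    (F := fun (m : ℕ) (y : ℝ) => (-1 : ℝ) ^ m / ((m : ℝ) + 1) * y ^ m)
    (fun m => by
      have : Continuous fun y : ℝ => (-1 : ℝ) ^ m / ((m : ℝ) + 1) * y ^ m := by fun_prop
      exact (this.integrableOn_Icc (a := 0) (b := 1)).mono_set Set.Ioc_subset_Icc_self) ?_
  · rw [h0, intervalIntegral.integral_of_le zero_le_one]
    simp only [← intervalIntegral.integral_of_le (zero_le_one' ℝ), hval] at key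
    rw [← key.unique hasSum_alternating_inv_sq, intervalIntegral.integral_of_le zero_le_one]
    rw [MeasureTheory.integral_Ioc_eq_integral_Ioo, MeasureTheory.integral_Ioc_eq_integral_Ioo]
    refine MeasureTheory.setIntegral_congr_fun measurableSet_Ioo fun y hy => ?_
    have hy0 : y ≠ 0 := hy.1.ne'
    have h := Real.hasSum_pow_div_log_of_abs_lt_one (x := -y) (by
      rw [abs_neg, abs_of_pos hy.1]; exact hy.2)
    have h2 := (h.mul_left (-y⁻¹)).tsum_eq
    have h1 : 1 + y ≠ 1 := by simpa using hy0
    rw [dslope_of_ne _ h1, slope_def_field, Real.log_one, sub_zero, add_sub_cancel_left]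
    rw [sub_neg_eq_add] at h2
    rw [div_eq_inv_mul, ← neg_mul_neg, ← h2]
    refine tsum_congr fun m => ?_
    rw [neg_pow, pow_succ, pow_succ]
    field_simp
  · refine Summable.congr ((summable_nat_add_iff 1).2 (Real.summable_one_div_nat_pow (p := 2).2
      one_lt_two)) fun m => ?_
    rw [← intervalIntegral.integral_of_le zero_le_one]
    have : ∫ y in (0 : ℝ)..1, ‖(-1 : ℝ) ^ m / ((m : ℝ) + 1) * y ^ m‖ =
        ∫ y in (0 : ℝ)..1, 1 / ((m : ℝ) + 1) * y ^ m := by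
      refine intervalIntegral.integral_congr fun y hy => ?_
      rw [Set.uIcc_of_le zero_le_one] at hy
      have : 0 ≤ (m : ℝ) + 1 := by positivity
      rw [norm_mul, norm_div, norm_pow, norm_pow, norm_neg, norm_one, one_pow,
        Real.norm_of_nonneg this, Real.norm_of_nonneg hy.1]
    rw [this, intervalIntegral.integral_const_mul, integral_pow]
    push_cast
    field_simp
    simp

/-- Here `(exp x - 1) / x = 1 / x`, since `exp (log 2) - 1 = 1`. -/
theorem logExpQuot_log_two : logExpQuot (Real.log 2 : ℝ) = -(Real.log (Real.log 2) : ℝ) := by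
  have hl : 0 < Real.log 2 := Real.log_pos one_lt_two
  have h := mul_expQuot (Real.log 2 : ℝ)
  rw [← Complex.ofReal_exp, Real.exp_log two_pos] at h
  have h2 : expQuot (Real.log 2 : ℝ) = ((Real.log 2)⁻¹ : ℝ) := by
    have : ((Real.log 2 : ℝ) : ℂ) ≠ 0 := by exact_mod_cast hl.ne'
    rw [Complex.ofReal_inv]
    field_simp
    push_cast at h
    linear_combination h
  rw [logExpQuot, h2, ← Complex.ofReal_log (by positivity), Real.log_inv]
  push_cast; ring

theorem log_two_lt_one : Real.log 2 < 1 := by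
  have := Real.log_two_lt_d9; linarith

/-- `log 2 * meanLog (log 2) = log 2 - log 2 * log (log 2) - π² / 12`; this is the evaluation of
`∫₀^(log 2) log (exp u - 1) du = -π² / 12`. -/
theorem meanLog_log_two : ((Real.log 2 : ℝ) : ℂ) * meanLog (Real.log 2 : ℝ) =
    ((Real.log 2 - Real.log 2 * Real.log (Real.log 2) - Real.pi ^ 2 / 12 : ℝ) : ℂ) := by
  set l := Real.log 2 with hl
  have hl0 : 0 < l := Real.log_pos one_lt_two
  have hnorm : ∀ u ∈ Set.uIcc (0 : ℝ) l, ‖(u : ℂ)‖ < 1 := by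
    intro u hu
    rw [Set.uIcc_of_le hl0.le] at hu
    rw [Complex.norm_real, Real.norm_of_nonneg hu.1]
    exact lt_of_le_of_lt hu.2 log_two_lt_one
  -- substitution `x = exp u`
  have hsub : ∫ u in (0 : ℝ)..l, dslope Real.log 1 (Real.exp u) * Real.exp u = Real.pi ^ 2 / 12 := by
    have := intervalIntegral.integral_comp_mul_deriv' (a := 0) (b := l) (f := Real.exp)
      (f' := Real.exp) (g := dslope Real.log 1) (fun x _ => Real.hasDerivAt_exp x)
      Real.continuous_exp.continuousOn (by
        refine ContinuousOn.mono ((continuousOn_dslope (Ioi_mem_nhds one_pos)).2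
          ⟨fun x hx => (Real.continuousAt_log (ne_of_gt hx)).continuousWithinAt,
            Real.differentiableAt_log one_ne_zero⟩) ?_
        rintro _ ⟨u, -, rfl⟩
        exact Real.exp_pos u)
    rw [Real.exp_zero, hl, Real.exp_log two_pos, integral_dslope_log] at this
    exact this
  have hderiv : ∀ u ∈ Set.uIcc (0 : ℝ) l, HasDerivAt
      (fun u : ℝ => (u : ℂ) * logExpQuot u - u * meanLog u + u)
      (Complex.exp u / expQuot u) u := by
    intro u hu
    have h1 := hnorm u hu
    have h2 := ((((hasDerivAt_id (u : ℂ)).fun_mul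
      (differentiableAt_logExpQuot h1).hasDerivAt)).fun_sub (hasDerivAt_mul_meanLog h1)).fun_add
      (hasDerivAt_id (u : ℂ))
    refine h2.comp_ofReal.congr_deriv ?_
    simp only [id]
    rw [mul_deriv_logExpQuot h1]; ring
  have hcongr : ∀ u ∈ Set.uIcc (0 : ℝ) l, Complex.exp u / expQuot u =
      ((dslope Real.log 1 (Real.exp u) * Real.exp u : ℝ) : ℂ) := by
    intro u hu
    rcases eq_or_ne u 0 with rfl | h0
    · simp [expQuot_zero]
    have h1 : Real.exp u ≠ 1 := by simpa using h0
    have h2 : expQuot u = (((Real.exp u - 1) / u : ℝ) : ℂ) := by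
      have := mul_expQuot u
      have h0' : (u : ℂ) ≠ 0 := by exact_mod_cast h0
      push_cast
      field_simp
      linear_combination this
    have h3 : Real.exp u - 1 ≠ 0 := sub_ne_zero.2 h1
    rw [dslope_of_ne _ h1, slope_def_field, Real.log_exp, Real.log_one, h2, ← Complex.ofReal_exp,
      ← Complex.ofReal_div]
    congr 1
    field_simp
    ring
  have hcont : ContinuousOn (fun u : ℝ => Complex.exp u / expQuot u) (Set.uIcc 0 l) := by
    refine ContinuousOn.div (by fun_prop) ?_ fun u hu => expQuot_ne_zero (hnorm u hu)
    exact (differentiable_expQuot.continuous.comp Complex.continuous_ofReal).continuousOn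
  have key := intervalIntegral.integral_eq_sub_of_hasDerivAt hderiv hcont.intervalIntegrable
  rw [intervalIntegral.integral_congr hcongr, intervalIntegral.integral_ofReal, hsub] at key
  rw [hl, logExpQuot_log_two, ← hl] at key
  push_cast at key ⊢
  simp only [zero_mul, add_zero, sub_zero] at key
  linear_combination key

/-! ### A one-dimensional saddle point integral -/

theorem exists_bound_of_isBigO_pow {f : ℝ → ℂ} {a : ℝ} (m : ℕ) (hf : Continuous f)
    (hO : f =O[nhds 0] fun θ : ℝ => θ ^ m) :
    ∃ C : ℝ, 0 ≤ C ∧ ∀ θ : ℝ, |θ| ≤ a → ‖f θ‖ ≤ C * |θ| ^ m := by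
  obtain ⟨C₁, hC₁⟩ := hO.bound
  obtain ⟨r, hr, hball⟩ := Metric.eventually_nhds_iff.1 hC₁
  obtain ⟨C₂, hC₂⟩ := (isCompact_Icc (a := -a) (b := a)).exists_bound_of_continuousOn hf.continuousOn
  refine ⟨max |C₁| (|C₂| / r ^ m), le_max_of_le_left (abs_nonneg _), fun θ hθ => ?_⟩
  rcases lt_or_ge |θ| r with h | h
  · have := hball (y := θ) (by simpa using h)
    rw [norm_pow, Real.norm_eq_abs] at this
    refine this.trans ?_
    gcongr
    exact (le_abs_self _).trans (le_max_left _ _)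
  · calc ‖f θ‖ ≤ |C₂| := (hC₂ θ (abs_le.1 hθ)).trans (le_abs_self _)
      _ = |C₂| / r ^ m * r ^ m := by field_simp
      _ ≤ max |C₁| (|C₂| / r ^ m) * |θ| ^ m := by
        gcongr
        exact le_max_right _ _

theorem AnalyticAt.isBigO_sub_taylor {f : ℂ → ℂ} (hf : AnalyticAt ℂ f 0) (m : ℕ) :
    (fun θ : ℝ => f θ - ∑ j ∈ Finset.range m, iteratedDeriv j f 0 / (j.factorial : ℂ) * (θ : ℂ) ^ j)
      =O[nhds 0] fun θ : ℝ => θ ^ m := by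
  have h := hf.hasFPowerSeriesAt.isBigO_sub_partialSum_pow m
  have hc : Tendsto (fun θ : ℝ => (θ : ℂ)) (nhds 0) (nhds 0) :=
    Complex.continuous_ofReal.tendsto' 0 0 Complex.ofReal_zero
  have h2 := h.comp_tendsto hc
  refine (h2.congr_left fun θ => ?_).trans (IsBigO.of_bound 1 (Eventually.of_forall fun θ => ?_))
  · simp only [Function.comp, zero_add, FormalMultilinearSeries.partialSum]
    congr 1
    refine Finset.sum_congr rfl fun j _ => ?_
    simp [FormalMultilinearSeries.ofScalars]
  · simp

theorem norm_exp_sub_one_sub_le (X : ℂ) :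
    ‖Complex.exp X - 1 - X‖ ≤ ‖X‖ ^ 2 * (Real.exp X.re + 2) := by
  rcases le_or_gt ‖X‖ 1 with h | h
  · refine (Complex.norm_exp_sub_one_sub_id_le h).trans ?_
    have := Real.exp_pos X.re
    nlinarith [sq_nonneg ‖X‖]
  · have h1 : ‖Complex.exp X - 1 - X‖ ≤ Real.exp X.re + 1 + ‖X‖ := by
      refine (norm_sub_le _ _).trans (add_le_add_left ((norm_sub_le _ _).trans ?_) _)
      rw [Complex.norm_exp, norm_one]
    have := Real.exp_pos X.re
    have h2 : 1 ≤ ‖X‖ ^ 2 := by nlinarith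
    have h3 : ‖X‖ ≤ ‖X‖ ^ 2 := by nlinarith
    nlinarith

theorem exists_poly_le_exp {c : ℝ} (hc : 0 < c) :
    ∃ C : ℝ, 0 < C ∧ ∀ x : ℝ, 0 ≤ x → x + x ^ 2 + x ^ 3 ≤ C * Real.exp (c * x) := by
  refine ⟨1 / c + 2 / c ^ 2 + 6 / c ^ 3, by positivity, fun x hx => ?_⟩
  have h (j : ℕ) : x ^ j ≤ j.factorial / c ^ j * Real.exp (c * x) := by
    have := Real.pow_div_factorial_le_exp (c * x) (by positivity) j
    rw [div_le_iff₀ (by positivity), mul_pow] at this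
    rw [div_mul_eq_mul_div, le_div_iff₀ (by positivity)]
    linarith
  have h1 := h 1
  have h2 := h 2
  have h3 := h 3
  simp only [Nat.factorial, pow_one] at h1 h2 h3
  norm_num at h1 h2 h3
  rw [add_mul, add_mul, one_div]
  linarith

theorem integral_exp_neg_sq_le {b : ℝ} (hb : 0 < b) (a : ℝ) (ha : 0 ≤ a) :
    ∫ θ in (-a)..a, Real.exp (-b * θ ^ 2) ≤ Real.sqrt (Real.pi / b) := by
  rw [← integral_gaussian b, intervalIntegral.integral_of_le (by linarith)]
  exact MeasureTheory.setIntegral_le_integral (integrable_exp_neg_mul_sq hb)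
    (Eventually.of_forall fun θ => (Real.exp_pos _).le)

theorem abs_integral_gaussian_sub_le {b : ℝ} (hb : 0 < b) {a : ℝ} (ha : 0 < a) :
    |(∫ θ in (-a)..a, Real.exp (-b * θ ^ 2)) - Real.sqrt (Real.pi / b)| ≤
      2 / (a ^ 2 * b) * Real.sqrt (Real.pi / (b / 2)) := by
  have hi := integrable_exp_neg_mul_sq hb
  have hi2 := (integrable_exp_neg_mul_sq (half_pos hb)).const_mul (2 / (a ^ 2 * b))
  have h := MeasureTheory.integral_add_compl (s := Set.Ioc (-a) a) measurableSet_Ioc hi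
  rw [← integral_gaussian b, intervalIntegral.integral_of_le (by linarith), ← h, sub_add_cancel_left,
    abs_neg, abs_of_nonneg (MeasureTheory.integral_nonneg fun θ => (Real.exp_pos _).le),
    ← integral_gaussian, ← MeasureTheory.integral_const_mul]
  refine (MeasureTheory.setIntegral_mono_on hi.integrableOn hi2.integrableOn
    measurableSet_Ioc.compl fun θ hθ => ?_).trans
    (MeasureTheory.setIntegral_le_integral hi2 (Eventually.of_forall fun θ => by positivity))
  -- outside the interval `1 ≤ θ² / a²`, and `b θ² / 2 ≤ exp (b θ² / 2)`
  have h1 : a ^ 2 ≤ θ ^ 2 := by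
    rw [Set.mem_compl_iff, Set.mem_Ioc, not_and_or, not_lt, not_le] at hθ
    rcases hθ with h | h <;> nlinarith
  have h2 : b / 2 * θ ^ 2 ≤ Real.exp (b / 2 * θ ^ 2) := by
    have := Real.add_one_le_exp (b / 2 * θ ^ 2); linarith
  have h3 : Real.exp (-b * θ ^ 2) = Real.exp (-(b / 2) * θ ^ 2) * Real.exp (-(b / 2) * θ ^ 2) := by
    rw [← Real.exp_add]; congr 1; ring
  have h4 : Real.exp (-(b / 2) * θ ^ 2) ≤ 2 / (a ^ 2 * b) := by
    rw [show -(b / 2) * θ ^ 2 = -(b / 2 * θ ^ 2) by ring, Real.exp_neg]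
    have h5 : a ^ 2 * b / 2 ≤ Real.exp (b / 2 * θ ^ 2) := by nlinarith
    calc (Real.exp (b / 2 * θ ^ 2))⁻¹ ≤ (a ^ 2 * b / 2)⁻¹ := by gcongr
      _ = _ := by rw [inv_div]
  rw [h3]
  gcongr

theorem norm_exp_sub_one_add_le {G g n x F H J : ℝ} {X x₁ : ℂ} (hn : 0 < n) (hx : 0 ≤ x)
    (hF : 0 ≤ F) (hH : 0 ≤ H) (hJ : 0 ≤ J) (hG : 0 ≤ G) (hGg : G ≤ g)
    (hGX : G * Real.exp X.re ≤ J * g) (h₁ : ‖X - x₁‖ ≤ F * (x + x ^ 2) / n)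
    (h₂ : ‖X‖ ^ 2 ≤ H * (x + x ^ 3) / n) :
    G * ‖Complex.exp X - (1 + x₁)‖ ≤ (F + H * (J + 2)) * (x + x ^ 2 + x ^ 3) / n * g := by
  have hg : 0 ≤ g := hG.trans hGg
  have hmain : ‖Complex.exp X - (1 + x₁)‖ ≤ ‖X - x₁‖ + ‖X‖ ^ 2 * (Real.exp X.re + 2) := by
    have : Complex.exp X - (1 + x₁) = (X - x₁) + (Complex.exp X - 1 - X) := by ring
    rw [this]
    exact (norm_add_le _ _).trans (add_le_add_right (norm_exp_sub_one_sub_le X) _)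
  calc G * ‖Complex.exp X - (1 + x₁)‖
      ≤ G * (‖X - x₁‖ + ‖X‖ ^ 2 * (Real.exp X.re + 2)) := by gcongr
    _ = G * ‖X - x₁‖ + ‖X‖ ^ 2 * (G * Real.exp X.re + 2 * G) := by ring
    _ ≤ g * (F * (x + x ^ 2) / n) + (H * (x + x ^ 3) / n) * (J * g + 2 * g) := by gcongr
    _ = (F * (x + x ^ 2) + H * (J + 2) * (x + x ^ 3)) / n * g := by ring
    _ ≤ ((F + H * (J + 2)) * (x + x ^ 2 + x ^ 3)) / n * g := by
        have h3 := pow_nonneg hx 3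
        have h4 := pow_nonneg hx 2
        rw [add_mul]
        have h5 : x + x ^ 2 ≤ x + x ^ 2 + x ^ 3 := by linarith
        have h6 : x + x ^ 3 ≤ x + x ^ 2 + x ^ 3 := by linarith
        exact mul_le_mul_of_nonneg_right (div_le_div_of_nonneg_right (add_le_add
          (mul_le_mul_of_nonneg_left h5 hF) (mul_le_mul_of_nonneg_left h6 (by positivity))) hn.le) hg

set_option maxHeartbeats 1000000 in
/-- The integrand of `saddle_integral_asymp`, with increments `q`, `A`, `B` at the point `θ`,
compared with a Gaussian times `1` plus odd terms. -/
theorem norm_saddle_integrand_sub_le {q A B q₃ A₁ B₁ β : ℂ} {a κ c θ Cq CA CB M : ℝ} {n : ℕ}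
    (hn0 : (0 : ℝ) < n) (ha : 0 < a) (hθ : |θ| ≤ a) (hCq : 0 ≤ Cq) (hCA : 0 ≤ CA) (hCB : 0 ≤ CB)
    (hM : 0 ≤ M) (hβ : ‖β‖ ≤ M)
    (hq : ‖q - (κ / 2) * (θ : ℂ) ^ 2 - q₃ * (θ : ℂ) ^ 3‖ ≤ Cq * |θ| ^ 4)
    (hA : ‖A - A₁ * θ‖ ≤ CA * |θ| ^ 2) (hB : ‖B - B₁ * θ‖ ≤ CB * |θ| ^ 2)
    (hre : c * θ ^ 2 ≤ q.re) {c' D E D' Q : ℝ} (hc' : c' = min c (κ / 2))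
    (hD : D = M * ‖A₁‖ + ‖B₁‖) (hE : E = M * CA + CB) (hD' : D' = D + E * a)
    (hQ : Q = ‖q₃‖ + Cq * a) :
    ‖Complex.exp (-n * q + β * A + B) - (Real.exp (-(κ / 2 * n) * θ ^ 2) : ℝ) *
        (1 + (-n * (q₃ * (θ : ℂ) ^ 3) + (β * A₁ + B₁) * θ))‖ ≤
      ((Cq + E) + (2 * Q ^ 2 + 2 * D' ^ 2) * (Real.exp (D' * a) + 2)) *
        (n * θ ^ 2 + (n * θ ^ 2) ^ 2 + (n * θ ^ 2) ^ 3) / n * Real.exp (-c' * (n * θ ^ 2)) := by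
  have hD0 : 0 ≤ D := by rw [hD]; positivity
  have hE0 : 0 ≤ E := by rw [hE]; positivity
  have hD'0 : 0 ≤ D' := by rw [hD']; positivity
  have hQ0 : 0 ≤ Q := by rw [hQ]; positivity
  set G : ℝ := Real.exp (-(κ / 2 * n) * θ ^ 2) with hG
  set x₁ : ℂ := -n * (q₃ * (θ : ℂ) ^ 3) + (β * A₁ + B₁) * θ with hx₁
  set I : ℂ := Complex.exp (-n * q + β * A + B) with hI
  have hθ0 := abs_nonneg θ
  set Y : ℂ := β * A + B with hY
  set X : ℂ := -n * (q - (κ / 2) * (θ : ℂ) ^ 2) + Y with hX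
  have hIG : I = (G : ℂ) * Complex.exp X := by
    rw [hI, hG, Complex.ofReal_exp, ← Complex.exp_add, hX, hY]
    congr 1
    push_cast
    ring
  have hYlin : ‖Y - (β * A₁ + B₁) * θ‖ ≤ E * |θ| ^ 2 := by
    have : Y - (β * A₁ + B₁) * θ = β * (A - A₁ * θ) + (B - B₁ * θ) := by
      rw [hY]; ring
    rw [this]
    refine (norm_add_le _ _).trans ?_
    rw [norm_mul, hE, add_mul, mul_assoc]
    gcongr
  have hYb : ‖Y‖ ≤ D' * |θ| := by
    have h1 : ‖(β * A₁ + B₁) * (θ : ℂ)‖ ≤ D * |θ| := by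
      rw [norm_mul, Complex.norm_real, Real.norm_eq_abs]
      gcongr
      refine (norm_add_le _ _).trans ?_
      rw [norm_mul, hD]
      gcongr
    calc ‖Y‖ = ‖(Y - (β * A₁ + B₁) * θ) + (β * A₁ + B₁) * θ‖ := by rw [sub_add_cancel]
      _ ≤ E * |θ| ^ 2 + D * |θ| := (norm_add_le _ _).trans (add_le_add hYlin h1)
      _ ≤ D' * |θ| := by
        rw [hD', sq, add_mul]
        nlinarith [mul_le_mul_of_nonneg_left hθ (mul_nonneg hE0 hθ0)]
  set Z : ℂ := q - (κ / 2) * (θ : ℂ) ^ 2 with hZ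
  have hZ1 : ‖Z - q₃ * (θ : ℂ) ^ 3‖ ≤ Cq * |θ| ^ 4 :=
    hq
  have hZ2 : ‖Z‖ ≤ Q * |θ| ^ 3 := by
    calc ‖Z‖ = ‖(Z - q₃ * (θ : ℂ) ^ 3) + q₃ * (θ : ℂ) ^ 3‖ := by rw [sub_add_cancel]
      _ ≤ Cq * |θ| ^ 4 + ‖q₃‖ * |θ| ^ 3 := by
        refine (norm_add_le _ _).trans (add_le_add hZ1 ?_)
        rw [norm_mul, norm_pow, Complex.norm_real, Real.norm_eq_abs]
      _ ≤ Q * |θ| ^ 3 := by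
        rw [hQ, add_mul, add_comm]
        have : Cq * |θ| ^ 4 = Cq * |θ| ^ 3 * |θ| := by ring
        rw [this]
        have h3 : 0 ≤ Cq * |θ| ^ 3 := by positivity
        nlinarith [mul_le_mul_of_nonneg_left hθ h3]
  set x := (n : ℝ) * θ ^ 2 with hx
  have hx0 : 0 ≤ x := by positivity
  have habs2 : |θ| ^ 2 = θ ^ 2 := sq_abs θ
  have hXx : ‖X - x₁‖ ≤ (Cq + E) * (x + x ^ 2) / n := by
    have : X - x₁ = -n * (Z - q₃ * (θ : ℂ) ^ 3) + (Y - (β * A₁ + B₁) * θ) := by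
      rw [hX, hx₁]; ring
    rw [this]
    refine (norm_add_le _ _).trans ?_
    rw [norm_mul, norm_neg, Complex.norm_natCast]
    calc _ ≤ n * (Cq * |θ| ^ 4) + E * |θ| ^ 2 := by gcongr
      _ = (Cq * x ^ 2 + E * x) / n := by
        rw [show |θ| ^ 4 = (θ ^ 2) ^ 2 by rw [← habs2]; ring, habs2, hx]
        field_simp
      _ ≤ _ := by
        gcongr
        nlinarith [hCq, mul_nonneg (hCq) hx0, mul_nonneg hE0 (sq_nonneg x)]
  have hXsq : ‖X‖ ^ 2 ≤ (2 * Q ^ 2 + 2 * D' ^ 2) * (x + x ^ 3) / n := by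
    have h1 : ‖X‖ ≤ n * (Q * |θ| ^ 3) + D' * |θ| := by
      rw [hX]
      refine (norm_add_le _ _).trans (add_le_add ?_ hYb)
      rw [norm_mul, norm_neg, Complex.norm_natCast]
      gcongr
    calc ‖X‖ ^ 2 ≤ (n * (Q * |θ| ^ 3) + D' * |θ|) ^ 2 := by gcongr
      _ ≤ 2 * (n * (Q * |θ| ^ 3)) ^ 2 + 2 * (D' * |θ|) ^ 2 := by
        nlinarith [sq_nonneg (n * (Q * |θ| ^ 3) - D' * |θ|)]
      _ = (2 * Q ^ 2 * x ^ 3 + 2 * D' ^ 2 * x) / n := by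
        rw [show (n * (Q * |θ| ^ 3)) ^ 2 = n ^ 2 * Q ^ 2 * (|θ| ^ 2) ^ 3 by ring,
          show (D' * |θ|) ^ 2 = D' ^ 2 * |θ| ^ 2 by ring, habs2, hx]
        field_simp
      _ ≤ _ := by
        gcongr
        nlinarith [mul_nonneg (sq_nonneg Q) hx0, mul_nonneg (sq_nonneg D') (pow_nonneg hx0 3)]
  have hGle : G ≤ Real.exp (-c' * x) := by
    rw [hG]
    apply Real.exp_le_exp.2
    have : c' ≤ κ / 2 := hc' ▸ min_le_right _ _
    rw [hx]
    nlinarith [mul_nonneg hn0.le (sq_nonneg θ)]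
  have hGX : G * Real.exp X.re ≤ Real.exp (D' * a) * Real.exp (-c' * x) := by
    have h1 : G * Real.exp X.re = ‖I‖ := by
      rw [hIG, norm_mul, Complex.norm_real, Complex.norm_exp, Real.norm_of_nonneg (Real.exp_pos _).le]
    rw [h1, ← Real.exp_add]
    rw [hI]
    rw [Complex.norm_exp]
    apply Real.exp_le_exp.2
    rw [add_assoc, Complex.add_re]
    have h2 : (-(n : ℂ) * q).re = -n * q.re := by
      rw [← Complex.ofReal_natCast, ← Complex.ofReal_neg, Complex.re_ofReal_mul]
    have h3 : (β * A + B).re ≤ D' * a :=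
      (Complex.re_le_norm _).trans (hYb.trans (by gcongr))
    rw [h2]
    have h4 : c' ≤ c := hc' ▸ min_le_left _ _
    have h5 := hre
    have h6 : c' * x ≤ n * q.re := by
      rw [hx]
      nlinarith [mul_le_mul_of_nonneg_left h5 hn0.le, mul_nonneg hn0.le (sq_nonneg θ)]
    linarith
  have key := norm_exp_sub_one_add_le hn0 hx0 (add_nonneg hCq hE0)
    (by positivity : 0 ≤ 2 * Q ^ 2 + 2 * D' ^ 2) (Real.exp_pos (D' * a)).le (Real.exp_pos _).le
    hGle hGX hXx hXsq
  rwa [hIG, ← mul_sub, norm_mul, Complex.norm_real, Real.norm_of_nonneg (Real.exp_pos _).le]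

/-- Laplace's method for `∫ exp (-n (q θ - q 0) + β (A θ - A 0) + (B θ - B 0))`, uniformly for
bounded `β`, with relative error `O(1/n)`: the terms of odd order in the expansion about `θ = 0`
integrate to `0`. -/
theorem saddle_integral_asymp {q A B : ℝ → ℂ} (hqc : Continuous q) (hAc : Continuous A)
    (hBc : Continuous B) {a κ c : ℝ} (ha : 0 < a) (hκ : 0 < κ) (hc : 0 < c) {q₃ A₁ B₁ : ℂ} {Cq CA CB : ℝ}
    (hq : ∀ θ : ℝ, |θ| ≤ a → ‖q θ - q 0 - (κ / 2) * (θ : ℂ) ^ 2 - q₃ * (θ : ℂ) ^ 3‖ ≤ Cq * |θ| ^ 4)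
    (hA : ∀ θ : ℝ, |θ| ≤ a → ‖A θ - A 0 - A₁ * θ‖ ≤ CA * |θ| ^ 2)
    (hB : ∀ θ : ℝ, |θ| ≤ a → ‖B θ - B 0 - B₁ * θ‖ ≤ CB * |θ| ^ 2)
    (hre : ∀ θ : ℝ, |θ| ≤ a → c * θ ^ 2 ≤ (q θ - q 0).re) (M : ℝ) :
    ∃ C : ℝ, 0 ≤ C ∧ ∀ n : ℕ, 1 ≤ n → ∀ β : ℂ, ‖β‖ ≤ M →
      ‖(∫ θ in (-a)..a, Complex.exp (-n * (q θ - q 0) + β * (A θ - A 0) + (B θ - B 0))) -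
        (Real.sqrt (2 * Real.pi / (κ * n)) : ℝ)‖ ≤ C / n * (1 / Real.sqrt n) := by
  rcases lt_or_ge M 0 with hM | hM
  · exact ⟨0, le_rfl, fun n _ β hβ => absurd ((norm_nonneg β).trans hβ) (not_le.2 hM)⟩
  set c' := min c (κ / 2) with hc'
  have hc'0 : 0 < c' := lt_min hc (by positivity)
  -- `D'` bounds the increment of `β A + B` and `D` its linear part, `Q` the terms of `q` of order
  -- three and more, each relative to the corresponding power of `|θ|`
  set D : ℝ := M * ‖A₁‖ + ‖B₁‖ with hD
  set E : ℝ := M * |CA| + |CB| with hE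
  set D' : ℝ := D + E * a with hD'
  set Q : ℝ := ‖q₃‖ + |Cq| * a with hQ
  have hD0 : 0 ≤ D := by positivity
  have hE0 : 0 ≤ E := by positivity
  have hD'0 : 0 ≤ D' := by positivity
  have hQ0 : 0 ≤ Q := by positivity
  set K : ℝ := (|Cq| + E) + (2 * Q ^ 2 + 2 * D' ^ 2) * (Real.exp (D' * a) + 2) with hK
  have hK0 : 0 ≤ K := by positivity
  obtain ⟨P, hP0, hP⟩ := exists_poly_le_exp (half_pos hc'0)
  refine ⟨K * P * Real.sqrt (Real.pi / (c' / 2)) + 2 / (a ^ 2 * (κ / 2)) *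
    Real.sqrt (Real.pi / (κ / 2 / 2)), by positivity, fun n hn β hβ => ?_⟩
  have hn0 : (0 : ℝ) < n := by exact_mod_cast hn
  set G : ℝ → ℝ := fun θ => Real.exp (-(κ / 2 * n) * θ ^ 2) with hG
  set x₁ : ℝ → ℂ := fun θ => -n * (q₃ * (θ : ℂ) ^ 3) + (β * A₁ + B₁) * θ with hx₁
  set I : ℝ → ℂ := fun θ => Complex.exp (-n * (q θ - q 0) + β * (A θ - A 0) + (B θ - B 0)) with hI
  have hIc : Continuous I := by simp only [hI]; fun_prop
  have hGc : Continuous G := by simp only [hG]; fun_prop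
  have hx₁c : Continuous x₁ := by simp only [hx₁]; fun_prop
  have hpt : ∀ θ : ℝ, |θ| ≤ a → ‖I θ - (G θ : ℂ) * (1 + x₁ θ)‖ ≤
      K * P / n * Real.exp (-(c' / 2 * n) * θ ^ 2) := by
    intro θ hθ
    have key := norm_saddle_integrand_sub_le (κ := κ) (q₃ := q₃) (A₁ := A₁) (B₁ := B₁) hn0 ha hθ
      (abs_nonneg Cq) (abs_nonneg CA) (abs_nonneg CB) hM hβ
      ((hq θ hθ).trans (by gcongr; exact le_abs_self _))
      ((hA θ hθ).trans (by gcongr; exact le_abs_self _))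
      ((hB θ hθ).trans (by gcongr; exact le_abs_self _)) (hre θ hθ) hc' hD hE hD' hQ
    rw [← hK] at key
    refine key.trans ?_
    calc _ ≤ (K * (P * Real.exp (c' / 2 * (n * θ ^ 2)))) / n * Real.exp (-c' * (n * θ ^ 2)) := by
          gcongr; exact hP _ (by positivity)
      _ = K * P / n * Real.exp (-(c' / 2 * n) * θ ^ 2) := by
          have : Real.exp (-(c' / 2 * n) * θ ^ 2) =
              Real.exp (c' / 2 * (n * θ ^ 2)) * Real.exp (-c' * (n * θ ^ 2)) := by
            rw [← Real.exp_add]; congr 1; ring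
          rw [this]; ring
  have hodd : ∫ θ in (-a)..a, (G θ : ℂ) * x₁ θ = 0 := by
    have h := intervalIntegral.integral_comp_neg (a := -a) (b := a) (fun θ => (G θ : ℂ) * x₁ θ)
    rw [neg_neg] at h
    have h2 : ∀ θ : ℝ, (G (-θ) : ℂ) * x₁ (-θ) = -((G θ : ℂ) * x₁ θ) := by
      intro θ
      simp only [hG, hx₁]
      rw [neg_sq]; push_cast; ring
    simp only [h2] at h
    rw [intervalIntegral.integral_neg] at h
    have h3 : (2 : ℂ) * ∫ θ in (-a)..a, (G θ : ℂ) * x₁ θ = 0 := by linear_combination -h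
    simpa using h3
  have hsplit : ∫ θ in (-a)..a, (G θ : ℂ) * (1 + x₁ θ) = ((∫ θ in (-a)..a, G θ : ℝ) : ℂ) := by
    simp only [mul_add, mul_one]
    rw [intervalIntegral.integral_add (Continuous.intervalIntegrable (by fun_prop) _ _)
      (Continuous.intervalIntegrable (by fun_prop) _ _), hodd, add_zero,
      intervalIntegral.integral_ofReal]
  have hle : -a ≤ a := by linarith
  have hdiff : ‖(∫ θ in (-a)..a, I θ) - ((∫ θ in (-a)..a, G θ : ℝ) : ℂ)‖ ≤
      K * P / n * Real.sqrt (Real.pi / (c' / 2 * n)) := by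
    rw [← hsplit, ← intervalIntegral.integral_sub (hIc.intervalIntegrable _ _)
      (Continuous.intervalIntegrable (by fun_prop) _ _)]
    refine (intervalIntegral.norm_integral_le_of_norm_le hle (Eventually.of_forall fun θ hθ =>
      hpt θ (abs_le.2 ⟨hθ.1.le, hθ.2⟩)) (Continuous.intervalIntegrable (by fun_prop) _ _)).trans ?_
    rw [intervalIntegral.integral_const_mul]
    gcongr
    exact integral_exp_neg_sq_le (by positivity) a ha.le
  have htail := abs_integral_gaussian_sub_le (b := κ / 2 * n) (by positivity) ha
  have hs1 : Real.sqrt (Real.pi / (c' / 2 * n)) = Real.sqrt (Real.pi / (c' / 2)) * (1 / Real.sqrt n) := by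
    rw [← div_div, Real.sqrt_div' _ hn0.le]; ring
  have hs2 : Real.sqrt (Real.pi / (κ / 2 * n / 2)) =
      Real.sqrt (Real.pi / (κ / 2 / 2)) * (1 / Real.sqrt n) := by
    rw [show κ / 2 * n / 2 = κ / 2 / 2 * n by ring, ← div_div, Real.sqrt_div' _ hn0.le]; ring
  have hs3 : Real.sqrt (2 * Real.pi / (κ * n)) = Real.sqrt (Real.pi / (κ / 2 * n)) := by
    congr 1; field_simp
  rw [hs1] at hdiff
  rw [hs2] at htail
  rw [hs3]
  calc _ ≤ ‖(∫ θ in (-a)..a, I θ) - ((∫ θ in (-a)..a, G θ : ℝ) : ℂ)‖ +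
        ‖((∫ θ in (-a)..a, G θ : ℝ) : ℂ) - (Real.sqrt (Real.pi / (κ / 2 * n)) : ℝ)‖ :=
        norm_sub_le_norm_sub_add_norm_sub _ _ _
    _ ≤ K * P / n * (Real.sqrt (Real.pi / (c' / 2)) * (1 / Real.sqrt n)) +
        2 / (a ^ 2 * (κ / 2 * n)) * (Real.sqrt (Real.pi / (κ / 2 / 2)) * (1 / Real.sqrt n)) := by
        refine add_le_add hdiff ?_
        rw [← Complex.ofReal_sub, Complex.norm_real]
        exact htail
    _ = _ := by field_simp

/-! ### The saddle point on the circle `‖w‖ = log 2` -/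

/-- The point `w = log 2 * exp (i ζ)`; for real `ζ` it runs through the circle of integration. -/
noncomputable def circlePt (ζ : ℂ) : ℂ := (Real.log 2 : ℝ) * Complex.exp (ζ * Complex.I)

/-- The decay rate in `∏_{j ≤ k} (exp (j w / k) - 1) ≈ exp (-k * rate ζ)` with `w = circlePt ζ`; it
is `1 - log w - meanLog w` with the branch `log w = log (log 2) + i ζ`. -/
noncomputable def rate (ζ : ℂ) : ℂ :=
  1 - (Real.log (Real.log 2) : ℝ) - ζ * Complex.I - meanLog (circlePt ζ)

/-- The logarithm of `circlePt ζ * rate ζ / log 2`, the function with the saddle point `ζ = 0`. -/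
noncomputable def phase (ζ : ℂ) : ℂ := ζ * Complex.I + Complex.log (rate ζ)

/-- The factor of `β` in the exponent of the saddle point integral. -/
noncomputable def expA (ζ : ℂ) : ℂ := logExpQuot (circlePt ζ) - Complex.log (rate ζ)

/-- The bounded part of the exponent that stems from the lower-order coefficients of the two
series. -/
noncomputable def corr (δ η ζ : ℂ) : ℂ :=
  δ * circlePt ζ + η * (circlePt ζ + circlePt ζ * logExpQuot (circlePt ζ) -
    circlePt ζ * meanLog (circlePt ζ))

/-- The part of the exponent of the saddle point integral that depends neither on `n` nor on
`β`. -/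
noncomputable def expB (δ η ζ : ℂ) : ℂ := corr δ η ζ - Complex.log (rate ζ)

theorem log_two_pos : 0 < Real.log 2 := Real.log_pos one_lt_two

theorem norm_circlePt (θ : ℝ) : ‖circlePt θ‖ = Real.log 2 := by
  rw [circlePt, norm_mul, Complex.norm_exp_ofReal_mul_I, mul_one, Complex.norm_real,
    Real.norm_of_nonneg log_two_pos.le]

theorem norm_circlePt_lt_one (θ : ℝ) : ‖circlePt θ‖ < 1 := by
  rw [norm_circlePt]; exact log_two_lt_one

theorem circlePt_ne_zero (ζ : ℂ) : circlePt ζ ≠ 0 :=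
  mul_ne_zero (by exact_mod_cast log_two_pos.ne') (Complex.exp_ne_zero _)

theorem circlePt_zero : circlePt 0 = (Real.log 2 : ℝ) := by simp [circlePt]

theorem hasDerivAt_circlePt (ζ : ℂ) : HasDerivAt circlePt (circlePt ζ * Complex.I) ζ := by
  have h : HasDerivAt (fun ζ : ℂ => ζ * Complex.I) Complex.I ζ := by
    simpa using (hasDerivAt_id ζ).mul_const Complex.I
  refine (h.cexp.const_mul ((Real.log 2 : ℝ) : ℂ)).congr_deriv ?_
  rw [circlePt]; ring

/-- The minimal decay rate, from the dilogarithm value. -/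
theorem rate_zero : rate 0 = (Real.pi ^ 2 / (12 * Real.log 2) : ℝ) := by
  have h := meanLog_log_two
  have h0 : ((Real.log 2 : ℝ) : ℂ) ≠ 0 := by exact_mod_cast log_two_pos.ne'
  rw [rate, circlePt_zero, zero_mul, sub_zero]
  push_cast at h ⊢
  have h1 : (Complex.log 2) ≠ 0 := by
    rw [← Complex.ofReal_ofNat, ← Complex.ofReal_log two_pos.le]; exact h0
  field_simp
  field_simp at h
  linear_combination -h

theorem rate_re_ge_cos (θ : ℝ) :
    Real.pi ^ 2 / (12 * Real.log 2) + Real.log 2 * (1 - Real.cos θ) / 4 ≤ (rate θ).re := by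
  have h0 : (rate 0).re = Real.pi ^ 2 / (12 * Real.log 2) := by rw [rate_zero, Complex.ofReal_re]
  rw [← h0]
  have h := meanLog_re_le (norm_circlePt_lt_one θ)
  have h2 : (circlePt θ).re = Real.log 2 * Real.cos θ := by
    rw [circlePt, Complex.re_ofReal_mul, Complex.exp_ofReal_mul_I_re]
  rw [norm_circlePt, h2] at h
  rw [rate, rate, circlePt_zero]
  simp only [Complex.sub_re, Complex.mul_re, Complex.I_re, Complex.I_im, Complex.ofReal_im,
    mul_zero, mul_one, Complex.zero_re, Complex.zero_im]
  linarith

theorem rate_re_ge (θ : ℝ) : Real.pi ^ 2 / (12 * Real.log 2) ≤ (rate θ).re := by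
  have := rate_re_ge_cos θ
  have h := Real.cos_le_one θ
  have : 0 ≤ Real.log 2 * (1 - Real.cos θ) / 4 := by
    have := log_two_pos
    have : 0 ≤ 1 - Real.cos θ := by linarith
    positivity
  linarith

/-- The decay rate has its minimal real part at `θ = 0`, with quadratic growth on the circle. -/
theorem rate_re_ge_quadratic {θ : ℝ} (hθ : |θ| ≤ Real.pi) :
    Real.pi ^ 2 / (12 * Real.log 2) + Real.log 2 / (2 * Real.pi ^ 2) * θ ^ 2 ≤ (rate θ).re := by
  refine le_trans ?_ (rate_re_ge_cos θ)
  have h := Real.cos_le_one_sub_mul_cos_sq hθ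
  have h2 : Real.log 2 * (2 / Real.pi ^ 2 * θ ^ 2) ≤ Real.log 2 * (1 - Real.cos θ) :=
    mul_le_mul_of_nonneg_left (by linarith) log_two_pos.le
  have h3 : Real.log 2 / (2 * Real.pi ^ 2) * θ ^ 2 = Real.log 2 * (2 / Real.pi ^ 2 * θ ^ 2) / 4 := by
    field_simp; ring
  rw [h3]
  linarith

theorem rateZero_pos : 0 < Real.pi ^ 2 / (12 * Real.log 2) := by
  have := log_two_pos
  positivity

theorem rate_re_pos (θ : ℝ) : 0 < (rate θ).re := rateZero_pos.trans_le (rate_re_ge θ)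

theorem hasDerivAt_rate {ζ : ℂ} (hζ : ‖circlePt ζ‖ < 1) :
    HasDerivAt rate (-Complex.I * (1 + logExpQuot (circlePt ζ) - meanLog (circlePt ζ))) ζ := by
  have h1 : HasDerivAt (fun ζ : ℂ => ζ * Complex.I) Complex.I ζ := by
    simpa using (hasDerivAt_id ζ).mul_const Complex.I
  have h2 := (hasDerivAt_meanLog hζ (circlePt_ne_zero ζ)).comp ζ (hasDerivAt_circlePt ζ)
  have h3 := ((h1.const_sub (1 - ((Real.log (Real.log 2) : ℝ) : ℂ)))).fun_sub h2
  refine h3.congr_deriv ?_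
  have := circlePt_ne_zero ζ
  field_simp
  ring

/-- The phase and its derivatives are controlled where the circle point lies in the unit disk and
the rate has positive real part; this is a neighbourhood of the real axis. -/
theorem eventually_good (θ : ℝ) :
    ∀ᶠ ζ : ℂ in nhds (θ : ℂ), ‖circlePt ζ‖ < 1 ∧ 0 < (rate ζ).re := by
  refine Filter.Eventually.and ?_ ?_
  · have h : ContinuousAt (fun ζ => ‖circlePt ζ‖) (θ : ℂ) :=
      (hasDerivAt_circlePt _).continuousAt.norm
    exact h.eventually_lt continuousAt_const (norm_circlePt_lt_one θ)
  · have h : ContinuousAt (fun ζ => (rate ζ).re) (θ : ℂ) :=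
      Complex.continuous_re.continuousAt.comp (hasDerivAt_rate (norm_circlePt_lt_one θ)).continuousAt
    exact continuousAt_const.eventually_lt h (rate_re_pos θ)

theorem analyticAt_circlePt (θ : ℝ) : AnalyticAt ℂ circlePt θ :=
  Complex.analyticAt_iff_eventually_differentiableAt.2
    (Eventually.of_forall fun ζ => (hasDerivAt_circlePt ζ).differentiableAt)

theorem analyticAt_rate (θ : ℝ) : AnalyticAt ℂ rate θ :=
  Complex.analyticAt_iff_eventually_differentiableAt.2
    ((eventually_good θ).mono fun _ h => (hasDerivAt_rate h.1).differentiableAt)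

theorem analyticAt_log_rate (θ : ℝ) : AnalyticAt ℂ (fun ζ => Complex.log (rate ζ)) θ :=
  (analyticAt_rate θ).clog (Or.inl (rate_re_pos θ))

theorem analyticAt_logExpQuot_circlePt (θ : ℝ) :
    AnalyticAt ℂ (fun ζ => logExpQuot (circlePt ζ)) θ :=
  Complex.analyticAt_iff_eventually_differentiableAt.2
    ((eventually_good θ).mono fun _ h => (differentiableAt_logExpQuot h.1).comp _
      (hasDerivAt_circlePt _).differentiableAt)

theorem analyticAt_meanLog_circlePt (θ : ℝ) :
    AnalyticAt ℂ (fun ζ => meanLog (circlePt ζ)) θ :=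
  Complex.analyticAt_iff_eventually_differentiableAt.2
    ((eventually_good θ).mono fun _ h => ((hasDerivAt_meanLog h.1
      (circlePt_ne_zero _)).differentiableAt).comp _ (hasDerivAt_circlePt _).differentiableAt)

theorem analyticAt_phase (θ : ℝ) : AnalyticAt ℂ phase θ :=
  (analyticAt_id.mul analyticAt_const).add (analyticAt_log_rate θ)

theorem analyticAt_expA (θ : ℝ) : AnalyticAt ℂ expA θ :=
  (analyticAt_logExpQuot_circlePt θ).sub (analyticAt_log_rate θ)

theorem analyticAt_corr (δ η : ℂ) (θ : ℝ) : AnalyticAt ℂ (corr δ η) θ :=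
  (analyticAt_const.mul (analyticAt_circlePt θ)).add (analyticAt_const.mul
    (((analyticAt_circlePt θ).add ((analyticAt_circlePt θ).mul
      (analyticAt_logExpQuot_circlePt θ))).sub
      ((analyticAt_circlePt θ).mul (analyticAt_meanLog_circlePt θ))))

theorem analyticAt_expB (δ η : ℂ) (θ : ℝ) : AnalyticAt ℂ (expB δ η) θ :=
  (analyticAt_corr δ η θ).sub (analyticAt_log_rate θ)

theorem continuous_ofReal_of_analyticAt {f : ℂ → ℂ} (hf : ∀ θ : ℝ, AnalyticAt ℂ f θ) :
    Continuous fun θ : ℝ => f θ :=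
  continuous_iff_continuousAt.2 fun θ =>
    (hf θ).continuousAt.comp (f := fun θ : ℝ => (θ : ℂ)) Complex.continuous_ofReal.continuousAt

theorem hasDerivAt_phase {ζ : ℂ} (hζ : ‖circlePt ζ‖ < 1) (hr : 0 < (rate ζ).re) :
    HasDerivAt phase (-Complex.I * ((Real.log (Real.log 2) : ℝ) + ζ * Complex.I +
      logExpQuot (circlePt ζ)) / rate ζ) ζ := by
  have h1 : HasDerivAt (fun ζ : ℂ => ζ * Complex.I) Complex.I ζ := by
    simpa using (hasDerivAt_id ζ).mul_const Complex.I
  have h2 := h1.fun_add ((hasDerivAt_rate hζ).clog (Or.inl hr))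
  refine h2.congr_deriv ?_
  have hne : rate ζ ≠ 0 := by
    intro h; rw [h] at hr; simp at hr
  rw [eq_div_iff hne, add_mul, div_mul_cancel₀ _ hne]
  conv_lhs => rw [rate]
  ring

/-- The point `θ = 0` is stationary because `log w + logExpQuot w = log (exp w - 1)` vanishes at
`w = log 2`; this is the reason for integrating over the circle of radius `log 2`. -/
theorem deriv_phase_zero : deriv phase 0 = 0 := by
  have h := eventually_good 0
  rw [Complex.ofReal_zero] at h
  rw [(hasDerivAt_phase h.self_of_nhds.1 h.self_of_nhds.2).deriv, circlePt_zero,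
    logExpQuot_log_two]
  ring

theorem deriv_deriv_phase_zero :
    deriv (deriv phase) 0 = (24 * Real.log 2 ^ 2 / Real.pi ^ 2 : ℝ) := by
  have h := eventually_good 0
  rw [Complex.ofReal_zero] at h
  obtain ⟨h1, h2⟩ := h.self_of_nhds
  have heq : deriv phase =ᶠ[nhds 0] fun ζ => -Complex.I * ((Real.log (Real.log 2) : ℝ) +
      ζ * Complex.I + logExpQuot (circlePt ζ)) / rate ζ :=
    h.mono fun ζ hζ => (hasDerivAt_phase hζ.1 hζ.2).deriv
  rw [heq.deriv_eq]
  have hI : HasDerivAt (fun ζ : ℂ => ζ * Complex.I) Complex.I 0 := by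
    simpa using (hasDerivAt_id (0 : ℂ)).mul_const Complex.I
  have hL := ((differentiableAt_logExpQuot h1).hasDerivAt).comp 0 (hasDerivAt_circlePt 0)
  have hN := ((hI.const_add ((Real.log (Real.log 2) : ℝ) : ℂ)).fun_add hL).const_mul (-Complex.I)
  have hne : rate 0 ≠ 0 := by intro h; rw [h] at h2; simp at h2
  have hD := (hN.fun_div (hasDerivAt_rate h1) hne).deriv
  simp only [Function.comp] at hD
  rw [hD]
  have hm := mul_deriv_logExpQuot h1
  have hl2 : ((Real.log 2 : ℝ) : ℂ) ≠ 0 := by exact_mod_cast log_two_pos.ne'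
  have hE : expQuot (circlePt 0) = 1 / ((Real.log 2 : ℝ) : ℂ) := by
    have := mul_expQuot (circlePt 0)
    rw [circlePt_zero, ← Complex.ofReal_exp, Real.exp_log two_pos] at this
    rw [circlePt_zero, eq_div_iff hl2, mul_comm, this]
    norm_num
  have hexp : Complex.exp (circlePt 0) = 2 := by
    rw [circlePt_zero, ← Complex.ofReal_exp, Real.exp_log two_pos]; norm_num
  rw [hE, hexp] at hm
  have hnum : ((Real.log (Real.log 2) : ℝ) : ℂ) + 0 * Complex.I + logExpQuot (circlePt 0) = 0 := by
    rw [circlePt_zero, logExpQuot_log_two]; ring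
  rw [hnum, mul_zero, zero_mul, sub_zero, sq, mul_div_mul_right _ _ hne]
  have hnum2 : -Complex.I * (Complex.I + deriv logExpQuot (circlePt 0) * (circlePt 0 * Complex.I)) =
      2 * ((Real.log 2 : ℝ) : ℂ) := by
    have : -Complex.I * (Complex.I + deriv logExpQuot (circlePt 0) * (circlePt 0 * Complex.I)) =
      -(Complex.I * Complex.I) * (1 + circlePt 0 * deriv logExpQuot (circlePt 0)) := by ring
    rw [this, Complex.I_mul_I, hm]
    field_simp
    ring
  rw [hnum2, rate_zero]
  rw [← Complex.ofReal_ofNat, ← Complex.ofReal_mul, ← Complex.ofReal_div]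
  congr 1
  have := log_two_pos
  field_simp
  ring

/-- Logarithmic form of the quadratic growth of the decay rate, which turns the power
`(Re (rate θ)) ^ (-n)` into a Gaussian in `θ`. -/
theorem exists_log_rate_re_ge :
    ∃ c : ℝ, 0 < c ∧ ∀ θ : ℝ, |θ| ≤ Real.pi →
      Real.log (Real.pi ^ 2 / (12 * Real.log 2)) + c * θ ^ 2 ≤ Real.log (rate θ).re := by
  set m := Real.pi ^ 2 / (12 * Real.log 2) with hm
  have hm0 : 0 < m := rateZero_pos
  -- `b` is the relative rate of growth, and `log (1 + x) ≥ x / (1 + x)`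
  set b := Real.log 2 / (2 * Real.pi ^ 2) / m with hb
  have hb0 : 0 < b := by have := log_two_pos; positivity
  refine ⟨b / (1 + b * Real.pi ^ 2), by positivity, fun θ hθ => ?_⟩
  have h3 : m * (1 + b * θ ^ 2) ≤ (rate θ).re := by
    refine le_trans (le_of_eq ?_) (rate_re_ge_quadratic hθ)
    have hbm : m * b = Real.log 2 / (2 * Real.pi ^ 2) := by rw [hb]; field_simp
    rw [mul_add, mul_one, ← mul_assoc, hbm]
  have hx : 0 < 1 + b * θ ^ 2 := by positivity
  have h4 := Real.log_le_log (by positivity) h3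
  rw [Real.log_mul hm0.ne' hx.ne'] at h4
  have h5 := Real.one_sub_inv_le_log_of_pos hx
  have h6 : b / (1 + b * Real.pi ^ 2) * θ ^ 2 ≤ 1 - (1 + b * θ ^ 2)⁻¹ := by
    have hsq : θ ^ 2 ≤ Real.pi ^ 2 := sq_le_sq' (neg_le_of_abs_le hθ) (le_of_abs_le hθ)
    have : 1 - (1 + b * θ ^ 2)⁻¹ = b / (1 + b * θ ^ 2) * θ ^ 2 := by field_simp; ring
    rw [this]
    gcongr
  linarith

/-- Since `‖rate θ‖ ≥ Re (rate θ)`, the phase inherits the quadratic growth of the rate. -/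
theorem exists_phase_re_ge :
    ∃ c : ℝ, 0 < c ∧ ∀ θ : ℝ, |θ| ≤ Real.pi → c * θ ^ 2 ≤ (phase θ - phase 0).re := by
  obtain ⟨c, hc, h⟩ := exists_log_rate_re_ge
  refine ⟨c, hc, fun θ hθ => ?_⟩
  have h2 : (phase θ - phase 0).re =
      Real.log ‖rate θ‖ - Real.log (Real.pi ^ 2 / (12 * Real.log 2)) := by
    have : ‖rate 0‖ = Real.pi ^ 2 / (12 * Real.log 2) := by
      rw [rate_zero, Complex.norm_real, Real.norm_of_nonneg rateZero_pos.le]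
    simp only [phase, Complex.sub_re, Complex.add_re, Complex.log_re, this]
    simp
  have h3 := Real.log_le_log (rate_re_pos θ) (Complex.re_le_norm (rate θ))
  linarith [h θ hθ]

/-- The saddle point integral that governs the coefficients. -/
theorem saddle_integral_phase (δ η : ℂ) (M : ℝ) :
    ∃ C : ℝ, 0 ≤ C ∧ ∀ n : ℕ, 1 ≤ n → ∀ β : ℂ, ‖β‖ ≤ M →
      ‖(∫ θ in (-Real.pi)..Real.pi, Complex.exp (-n * (phase θ - phase 0) +
          β * (expA θ - expA 0) + (expB δ η θ - expB δ η 0))) -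
        (Real.sqrt (2 * Real.pi / (24 * Real.log 2 ^ 2 / Real.pi ^ 2 * n)) : ℝ)‖ ≤
      C / n * (1 / Real.sqrt n) := by
  have hl := log_two_pos
  have hq := analyticAt_phase 0
  have hA := analyticAt_expA 0
  have hB := analyticAt_expB δ η 0
  rw [Complex.ofReal_zero] at hq hA hB
  have cq := continuous_ofReal_of_analyticAt analyticAt_phase
  have cA := continuous_ofReal_of_analyticAt analyticAt_expA
  have cB := continuous_ofReal_of_analyticAt (analyticAt_expB δ η)
  obtain ⟨Cq, -, hCq⟩ := exists_bound_of_isBigO_pow (a := Real.pi) 4 (by fun_prop)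
    (hq.isBigO_sub_taylor 4)
  obtain ⟨CA, -, hCA⟩ := exists_bound_of_isBigO_pow (a := Real.pi) 2 (by fun_prop)
    (hA.isBigO_sub_taylor 2)
  obtain ⟨CB, -, hCB⟩ := exists_bound_of_isBigO_pow (a := Real.pi) 2 (by fun_prop)
    (hB.isBigO_sub_taylor 2)
  obtain ⟨c, hc, hre⟩ := exists_phase_re_ge
  have h2 : iteratedDeriv 2 phase 0 = (24 * Real.log 2 ^ 2 / Real.pi ^ 2 : ℝ) := by
    rw [iteratedDeriv_succ, iteratedDeriv_one, deriv_deriv_phase_zero]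
  have h1 : iteratedDeriv 1 phase 0 = 0 := by rw [iteratedDeriv_one, deriv_phase_zero]
  have key := saddle_integral_asymp (q := fun θ : ℝ => phase θ) (A := fun θ : ℝ => expA θ)
    (B := fun θ : ℝ => expB δ η θ) cq cA cB (κ := 24 * Real.log 2 ^ 2 / Real.pi ^ 2)
    Real.pi_pos (by positivity) hc (q₃ := iteratedDeriv 3 phase 0 / (Nat.factorial 3 : ℂ))
    (A₁ := iteratedDeriv 1 expA 0) (B₁ := iteratedDeriv 1 (expB δ η) 0) (Cq := Cq) (CA := CA)
    (CB := CB) (fun θ hθ => ?_) (fun θ hθ => ?_) (fun θ hθ => ?_)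
    (fun θ hθ => by simpa using hre θ hθ) M
  · simpa using key
  · refine le_of_eq_of_le (congrArg norm ?_) (hCq θ hθ)
    simp only [Finset.sum_range_succ, Finset.sum_range_zero, iteratedDeriv_zero, h1, h2,
      Complex.ofReal_zero]
    norm_num
    ring
  · refine le_of_eq_of_le (congrArg norm ?_) (hCA θ hθ)
    simp only [Finset.sum_range_succ, Finset.sum_range_zero, iteratedDeriv_zero,
      Complex.ofReal_zero]
    norm_num
    ring
  · refine le_of_eq_of_le (congrArg norm ?_) (hCB θ hθ)
    simp only [Finset.sum_range_succ, Finset.sum_range_zero, iteratedDeriv_zero,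
      Complex.ofReal_zero]
    norm_num
    ring

/-! ### Taylor jets and Cauchy's formula -/

/-- The function `F` agrees with the formal power series `p` at `0` up to an error `O(z ^ (n + 1))`.
The witness is a polynomial because `p` need not converge. -/
def IsJet (n : ℕ) (p : PowerSeries ℂ) (F : ℂ → ℂ) : Prop :=
  ∃ Q : Polynomial ℂ, (∀ i, i ≤ n → Q.coeff i = PowerSeries.coeff i p) ∧
    (fun z => F z - Q.eval z) =O[nhds 0] fun z => z ^ (n + 1)

/-- The truncation of a power series after the term of degree `n`, as a function. -/
noncomputable def truncEval (n : ℕ) (p : PowerSeries ℂ) (z : ℂ) : ℂ :=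
  ∑ i ∈ Finset.range (n + 1), PowerSeries.coeff i p * z ^ i

theorem isJet_truncEval (n : ℕ) (p : PowerSeries ℂ) : IsJet n p (truncEval n p) := by
  refine ⟨∑ i ∈ Finset.range (n + 1), Polynomial.C (PowerSeries.coeff i p) * Polynomial.X ^ i,
    fun i hi => ?_, ?_⟩
  · simp [Polynomial.finsetSum_coeff, Polynomial.coeff_C_mul, Polynomial.coeff_X_pow, hi]
  · simp [truncEval, Polynomial.eval_finsetSum, isBigO_zero]

theorem isJet_one (n : ℕ) : IsJet n 1 fun _ => 1 :=
  ⟨1, fun i _ => by simp [Polynomial.coeff_one, PowerSeries.coeff_one], by simp [isBigO_zero]⟩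

theorem IsJet.bounded {n : ℕ} {p : PowerSeries ℂ} {F : ℂ → ℂ} (h : IsJet n p F) :
    F =O[nhds 0] fun _ => (1 : ℂ) := by
  obtain ⟨Q, -, hQ⟩ := h
  have h1 : (fun z : ℂ => z ^ (n + 1)) =O[nhds 0] fun _ => (1 : ℂ) :=
    ((continuous_pow (n + 1)).continuousAt (x := (0 : ℂ))).norm.isBoundedUnder_le.isBigO_one ℂ
  have h2 : (fun z : ℂ => Q.eval z) =O[nhds 0] fun _ => (1 : ℂ) :=
    (Q.continuous.continuousAt (x := (0 : ℂ))).norm.isBoundedUnder_le.isBigO_one ℂ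
  have := (hQ.trans h1).add h2
  simpa using this

theorem IsJet.mul {n : ℕ} {p q : PowerSeries ℂ} {F G : ℂ → ℂ} (hF : IsJet n p F)
    (hG : IsJet n q G) : IsJet n (p * q) fun z => F z * G z := by
  have hGb := hG.bounded
  obtain ⟨P, hP, hFP⟩ := hF
  obtain ⟨Q, hQ, hGQ⟩ := hG
  refine ⟨P * Q, fun i hi => ?_, ?_⟩
  · rw [Polynomial.coeff_mul, PowerSeries.coeff_mul]
    refine Finset.sum_congr rfl fun x hx => ?_
    have := Finset.HasAntidiagonal.mem_antidiagonal.1 hx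
    rw [hP _ (by omega), hQ _ (by omega)]
  · have h2 : (fun z : ℂ => P.eval z) =O[nhds 0] fun _ => (1 : ℂ) :=
      (P.continuous.continuousAt (x := (0 : ℂ))).norm.isBoundedUnder_le.isBigO_one ℂ
    have h3 := hFP.mul hGb
    have h4 := h2.mul hGQ
    simp only [mul_one, one_mul] at h3 h4
    refine (h3.add h4).congr_left fun z => ?_
    rw [Polynomial.eval_mul]; ring

theorem IsJet.sub {n : ℕ} {p q : PowerSeries ℂ} {F G : ℂ → ℂ} (hF : IsJet n p F)
    (hG : IsJet n q G) : IsJet n (p - q) fun z => F z - G z := by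
  obtain ⟨P, hP, hFP⟩ := hF
  obtain ⟨Q, hQ, hGQ⟩ := hG
  refine ⟨P - Q, fun i hi => ?_, ?_⟩
  · rw [Polynomial.coeff_sub, map_sub, hP i hi, hQ i hi]
  · refine (hFP.sub hGQ).congr_left fun z => ?_
    rw [Polynomial.eval_sub]; ring

theorem IsJet.pow {n : ℕ} {p : PowerSeries ℂ} {F : ℂ → ℂ} (hF : IsJet n p F) (m : ℕ) :
    IsJet n (p ^ m) fun z => F z ^ m := by
  induction m with
  | zero => simpa using isJet_one n
  | succ m ih => simpa only [pow_succ] using ih.mul hF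

theorem IsJet.prod {n : ℕ} {ι : Type*} (s : Finset ι) {p : ι → PowerSeries ℂ} {F : ι → ℂ → ℂ}
    (h : ∀ i ∈ s, IsJet n (p i) (F i)) : IsJet n (∏ i ∈ s, p i) fun z => ∏ i ∈ s, F i z := by
  classical
  induction s using Finset.induction_on with
  | empty => simpa using isJet_one n
  | insert a s ha ih =>
    simp only [Finset.prod_insert ha]
    exact (h a (Finset.mem_insert_self _ _)).mul
      (ih fun i hi => h i (Finset.mem_insert_of_mem hi))

theorem IsJet.sum_const_mul {n : ℕ} {ι : Type*} (s : Finset ι) (c : ι → ℂ) {p : ι → PowerSeries ℂ}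
    {F : ι → ℂ → ℂ} (h : ∀ i ∈ s, IsJet n (p i) (F i)) :
    IsJet n (∑ i ∈ s, PowerSeries.C (c i) * p i) fun z => ∑ i ∈ s, c i * F i z := by
  choose! Q hQ hF using h
  refine ⟨∑ i ∈ s, Polynomial.C (c i) * Q i, fun j hj => ?_, ?_⟩
  · rw [Polynomial.finsetSum_coeff, map_sum]
    refine Finset.sum_congr rfl fun i hi => ?_
    rw [Polynomial.coeff_C_mul, PowerSeries.coeff_C_mul, hQ i hi j hj]
  · have h : (fun z => ∑ i ∈ s, c i * (F i z - (Q i).eval z)) =O[nhds 0] fun z => z ^ (n + 1) :=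
      IsBigO.fun_sum fun i hi => (hF i hi).const_mul_left (c i)
    refine h.congr_left fun z => ?_
    rw [Polynomial.eval_finsetSum, ← Finset.sum_sub_distrib]
    refine Finset.sum_congr rfl fun i _ => ?_
    rw [Polynomial.eval_mul, Polynomial.eval_C]; ring

theorem IsJet.congr_coeff {n : ℕ} {p q : PowerSeries ℂ} {F : ℂ → ℂ} (hF : IsJet n p F)
    (h : ∀ i, i ≤ n → PowerSeries.coeff i p = PowerSeries.coeff i q) : IsJet n q F := by
  obtain ⟨Q, hQ, hF⟩ := hF
  exact ⟨Q, fun i hi => (hQ i hi).trans (h i hi), hF⟩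

theorem IsJet.add_isBigO {n : ℕ} {p : PowerSeries ℂ} {F G : ℂ → ℂ} (hF : IsJet n p F)
    (h : (fun z => G z - F z) =O[nhds 0] fun z => z ^ (n + 1)) : IsJet n p G := by
  obtain ⟨Q, hQ, hF⟩ := hF
  refine ⟨Q, hQ, (h.add hF).congr_left fun z => ?_⟩
  ring

theorem IsJet.sub_constantCoeff {n : ℕ} {p : PowerSeries ℂ} {F : ℂ → ℂ} (hF : IsJet n p F)
    (h1 : PowerSeries.constantCoeff p = 1) : (fun z => F z - 1) =O[nhds 0] fun z => z := by
  obtain ⟨Q, hQ, hF⟩ := hF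
  have h0 : Q.eval 0 = 1 := by
    rw [← Polynomial.coeff_zero_eq_eval_zero, hQ 0 (Nat.zero_le _),
      PowerSeries.coeff_zero_eq_constantCoeff_apply, h1]
  have h2 : (fun z : ℂ => Q.eval z - 1) =O[nhds 0] fun z => z := by
    have := (Q.hasDerivAt (0 : ℂ)).isBigO_sub
    simpa [h0] using this
  have h3 : (fun z : ℂ => z ^ (n + 1)) =O[nhds 0] fun z => z := by
    have h4 : (fun z : ℂ => z ^ n) =O[nhds 0] fun _ => (1 : ℂ) :=
      ((continuous_pow n).continuousAt (x := (0 : ℂ))).norm.isBoundedUnder_le.isBigO_one ℂ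
    simpa [pow_succ] using h4.mul (isBigO_refl (fun z : ℂ => z) (nhds 0))
  have := (hF.trans h3).add h2
  simpa using this

theorem one_add_cpow_sub_isBigO (s : ℂ) (n : ℕ) :
    (fun u : ℂ => (1 + u) ^ s - ∑ j ∈ Finset.range (n + 1), Ring.choose s j * u ^ j)
      =O[nhds 0] fun u => u ^ (n + 1) := by
  have h := (Complex.one_add_cpow_hasFPowerSeriesAt_zero (a := s)).isBigO_sub_partialSum_pow (n + 1)
  refine (h.congr_left fun u => ?_).trans (IsBigO.of_bound 1 (Eventually.of_forall fun u => ?_))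
  · simp only [zero_add, FormalMultilinearSeries.partialSum]
    congr 1
    refine Finset.sum_congr rfl fun j _ => ?_
    simp [binomialSeries, FormalMultilinearSeries.ofScalars]
  · simp

/-- The formal binomial power corresponds to the power defined by the principal logarithm. -/
theorem IsJet.seriesCpow {n : ℕ} {p : PowerSeries ℂ} {F : ℂ → ℂ} (hF : IsJet n p F)
    (h1 : PowerSeries.constantCoeff p = 1) (s : ℂ) :
    IsJet n (seriesCpow p s) fun z => Complex.exp (s * Complex.log (F z)) := by
  have hO := hF.sub_constantCoeff h1
  have ht : Tendsto (fun z => F z - 1) (nhds 0) (nhds 0) := hO.trans_tendsto tendsto_id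
  have hjet : IsJet n (_root_.seriesCpow p s)
      fun z => ∑ j ∈ Finset.range (n + 1), Ring.choose s j * (F z - 1) ^ j := by
    refine (IsJet.sum_const_mul (Finset.range (n + 1)) (fun j => Ring.choose s j)
      (p := fun j => (p - 1) ^ j) fun j _ => (hF.sub (isJet_one n)).pow j).congr_coeff
      fun i hi => ?_
    rw [_root_.seriesCpow, PowerSeries.coeff_mk, map_sum]
    simp only [PowerSeries.coeff_C_mul]
    symm
    refine Finset.sum_subset (Finset.range_mono (by omega)) fun j _ hj => ?_
    have hX : (PowerSeries.X : PowerSeries ℂ) ^ j ∣ (p - 1) ^ j :=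
      pow_dvd_pow_of_dvd (PowerSeries.X_dvd_iff.2 (by simp [h1])) j
    rw [PowerSeries.X_pow_dvd_iff.1 hX i (by simpa using hj), mul_zero]
  refine hjet.add_isBigO ?_
  have h2 := (one_add_cpow_sub_isBigO s n).comp_tendsto ht
  have h3 := h2.trans (hO.pow (n + 1))
  refine h3.congr' ?_ EventuallyEq.rfl
  have hne : ∀ᶠ z in nhds (0 : ℂ), F z ≠ 0 := by
    have : ∀ᶠ z in nhds (0 : ℂ), F z - 1 ≠ -1 := ht.eventually_ne (by norm_num)
    filter_upwards [this] with z hz h0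
    exact hz (by rw [h0]; ring)
  filter_upwards [hne] with z hz
  simp only [Function.comp, add_sub_cancel]
  rw [Complex.cpow_def_of_ne_zero hz, mul_comm s]

theorem circleIntegral_polynomial_mul_zpow (Q : Polynomial ℂ) (n : ℕ) {r : ℝ} (hr : 0 < r) :
    ∮ z in C(0, r), Q.eval z * z ^ (-(n + 1 : ℤ)) = 2 * Real.pi * Complex.I * Q.coeff n := by
  have hz0 : ∀ z ∈ Metric.sphere (0 : ℂ) r, z ≠ 0 := by
    rintro z hz rfl
    simp at hz; linarith
  have hcongr : Set.EqOn (fun z : ℂ => Q.eval z * z ^ (-(n + 1 : ℤ)))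
      (fun z => ∑ i ∈ Finset.range (Q.natDegree + 1), Q.coeff i * (z - 0) ^ ((i : ℤ) - (n + 1)))
      (Metric.sphere 0 r) := by
    intro z hz
    simp only
    rw [Polynomial.eval_eq_sum_range, Finset.sum_mul]
    refine Finset.sum_congr rfl fun i _ => ?_
    rw [sub_zero, sub_eq_add_neg, zpow_add₀ (hz0 z hz), zpow_natCast]; ring
  rw [circleIntegral.integral_congr hr.le hcongr, circleIntegral.integral_fun_sum]
  · have hterm : ∀ i : ℕ, (∮ z in C(0, r), Q.coeff i * (z - 0) ^ ((i : ℤ) - (n + 1))) =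
        if i = n then 2 * Real.pi * Complex.I * Q.coeff n else 0 := by
      intro i
      rw [circleIntegral.integral_const_mul]
      split_ifs with h
      · subst h
        have : ((i : ℤ) - (i + 1)) = -1 := by ring
        simp only [this, zpow_neg_one]
        rw [circleIntegral.integral_sub_center_inv 0 hr.ne']; ring
      · rw [circleIntegral.integral_sub_zpow_of_ne (by omega), mul_zero]
    simp only [hterm]
    rw [Finset.sum_ite_eq' (Finset.range (Q.natDegree + 1)) n]
    split_ifs with h
    · rfl
    · rw [Polynomial.coeff_eq_zero_of_natDegree_lt (by simpa using h), mul_zero]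
  · intro i _
    refine ContinuousOn.circleIntegrable hr.le (ContinuousOn.mul continuousOn_const ?_)
    refine ContinuousOn.zpow₀ (by fun_prop) _ fun z hz => Or.inl ?_
    rw [sub_zero]; exact hz0 z hz

/-- The quotient `R z / z ^ (n + 1)` has a removable singularity at `0`. -/
theorem circleIntegral_eq_zero_of_isBigO {R : ℂ → ℂ} {r : ℝ} (hr : 0 < r) (n : ℕ)
    (hd : ∀ z, ‖z‖ ≤ r → DifferentiableAt ℂ R z)
    (hO : R =O[nhds 0] fun z => z ^ (n + 1)) :
    ∮ z in C(0, r), R z * z ^ (-(n + 1 : ℤ)) = 0 := by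
  set g : ℂ → ℂ := fun z => R z * z ^ (-(n + 1 : ℤ)) with hg
  have hs : Metric.closedBall (0 : ℂ) r ∈ nhds 0 := Metric.closedBall_mem_nhds _ hr
  have hgd : DifferentiableOn ℂ g (Metric.closedBall 0 r \ {0}) := by
    intro z hz
    have hz0 : z ≠ 0 := hz.2
    exact ((hd z (by simpa using hz.1)).mul
      (differentiableAt_id.zpow (Or.inl hz0))).differentiableWithinAt
  have hb : (fun z => g z - g 0) =o[nhdsWithin 0 {0}ᶜ] fun z : ℂ => (z - 0)⁻¹ := by
    have h1 : g =O[nhdsWithin 0 {0}ᶜ] fun _ => (1 : ℂ) := by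
      have h2 := (hO.mono nhdsWithin_le_nhds).mul
        (isBigO_refl (fun z : ℂ => z ^ (-(n + 1 : ℤ))) (nhdsWithin 0 {0}ᶜ))
      refine h2.congr' EventuallyEq.rfl ?_
      filter_upwards [self_mem_nhdsWithin] with z hz
      have hz0 : z ≠ 0 := hz
      rw [← zpow_natCast, ← zpow_add₀ hz0]
      push_cast
      simp
    have h3 : (fun z => g z - g 0) =O[nhdsWithin 0 {0}ᶜ] fun _ => (1 : ℂ) :=
      h1.sub (isBigO_const_const _ one_ne_zero _)
    refine h3.trans_isLittleO ?_
    rw [isLittleO_one_left_iff]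
    simp only [sub_zero, norm_inv]
    exact (tendsto_norm_nhdsNE_zero).inv_tendsto_nhdsGT_zero
  have hu := Complex.differentiableOn_update_limUnder_of_isLittleO hs hgd hb
  have h0 := Complex.circleIntegral_eq_zero_of_differentiable_on_off_countable hr.le
    Set.countable_empty hu.continuousOn (fun z hz => by
      have hz' : z ∈ Metric.ball (0 : ℂ) r := hz.1
      exact hu.differentiableAt (mem_of_superset (Metric.isOpen_ball.mem_nhds hz')
        Metric.ball_subset_closedBall))
  refine Eq.trans ?_ h0
  refine circleIntegral.integral_congr (E := ℂ) hr.le fun z hz => ?_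
  have hz0 : z ≠ 0 := by
    rintro rfl
    simp at hz; linarith
  rw [Function.update_of_ne hz0]

/-- Cauchy's formula for the coefficient of a formal power series with a given jet, on the circle
of radius `r` in the variable `z / a`. -/
theorem IsJet.coeff_mul_pow_eq_integral {n : ℕ} {p : PowerSeries ℂ} {F : ℂ → ℂ} (hF : IsJet n p F)
    (a : ℂ) {r : ℝ} (hr : 0 < r) (hd : ∀ z, ‖z‖ ≤ r → DifferentiableAt ℂ F (a * z)) :
    2 * Real.pi * (PowerSeries.coeff n p * a ^ n) =
      ∫ θ in (-Real.pi)..Real.pi, F (a * (r * Complex.exp (θ * Complex.I))) *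
        ((r : ℂ) * Complex.exp (θ * Complex.I)) ^ (-(n : ℤ)) := by
  obtain ⟨Q, hQ, hO⟩ := hF
  have hta : Tendsto (fun z : ℂ => a * z) (nhds 0) (nhds 0) :=
    (continuous_const_mul a).tendsto' 0 0 (mul_zero a)
  have hO' : (fun z => F (a * z) - (Q.comp (Polynomial.C a * Polynomial.X)).eval z)
      =O[nhds 0] fun z => z ^ (n + 1) := by
    have h1 := hO.comp_tendsto hta
    refine (h1.congr_left fun z => ?_).trans ?_
    · simp [Polynomial.eval_comp]
    · simp only [Function.comp_def, mul_pow]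
      exact (isBigO_refl _ _).const_mul_left _
  have hdF : ∀ z, ‖z‖ ≤ r → DifferentiableAt ℂ (fun z => F (a * z)) z := fun z hz =>
    (hd z hz).comp z (differentiableAt_id.const_mul a)
  have hzero : ∮ z in C(0, r), (F (a * z) * z ^ (-(n + 1 : ℤ)) -
      (Q.comp (Polynomial.C a * Polynomial.X)).eval z * z ^ (-(n + 1 : ℤ))) = 0 := by
    have := circleIntegral_eq_zero_of_isBigO hr n (fun z hz =>
      (hdF z hz).fun_sub (Polynomial.differentiableAt _)) hO'
    simpa only [sub_mul] using this
  have hpoly := circleIntegral_polynomial_mul_zpow (Q.comp (Polynomial.C a * Polynomial.X)) n hr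
  rw [Polynomial.comp_C_mul_X_coeff, hQ n le_rfl] at hpoly
  have hz0 : ∀ z ∈ Metric.sphere (0 : ℂ) r, z ≠ 0 := by
    rintro z hz rfl
    simp at hz; linarith
  have hzc : ContinuousOn (fun z : ℂ => z ^ (-(n + 1 : ℤ))) (Metric.sphere 0 r) :=
    continuousOn_id.zpow₀ _ fun z hz => Or.inl (hz0 z hz)
  have hFc : ContinuousOn (fun z : ℂ => F (a * z)) (Metric.sphere 0 r) := fun z hz =>
    (hdF z (by simpa using (mem_sphere_iff_norm.1 hz).le)).continuousAt.continuousWithinAt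
  rw [circleIntegral.integral_sub ((hFc.fun_mul hzc).circleIntegrable hr.le)
    (((Polynomial.continuous _).continuousOn.fun_mul hzc).circleIntegrable hr.le), hpoly] at hzero
  have h2 := sub_eq_zero.1 hzero
  rw [circleIntegral] at h2
  have h3 : ∀ θ : ℝ, deriv (circleMap 0 r) θ • (F (a * circleMap 0 r θ) *
      circleMap 0 r θ ^ (-(n + 1 : ℤ))) =
      Complex.I * (F (a * circleMap 0 r θ) * circleMap 0 r θ ^ (-(n : ℤ))) := by
    intro θ
    have hne : circleMap 0 r θ ≠ 0 := circleMap_ne_center hr.ne'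
    rw [deriv_circleMap, smul_eq_mul]
    have : circleMap 0 r θ ^ (-(n : ℤ)) = circleMap 0 r θ ^ (-(n + 1 : ℤ)) * circleMap 0 r θ := by
      rw [← zpow_add_one₀ hne]; congr 1; ring
    rw [this]; ring
  simp only [h3] at h2
  rw [intervalIntegral.integral_const_mul] at h2
  have hper : Function.Periodic (fun θ : ℝ => F (a * circleMap 0 r θ) *
      circleMap 0 r θ ^ (-(n : ℤ))) (2 * Real.pi) := fun θ => by
    simp only [periodic_circleMap 0 r θ]
  have h4 := hper.intervalIntegral_add_eq (-Real.pi) 0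
  rw [show -Real.pi + 2 * Real.pi = Real.pi by ring, zero_add] at h4
  rw [← h4] at h2
  have h5 : Complex.I * (∫ θ in (-Real.pi)..Real.pi, F (a * circleMap 0 r θ) *
      circleMap 0 r θ ^ (-(n : ℤ))) =
      Complex.I * (2 * Real.pi * (PowerSeries.coeff n p * a ^ n)) := by
    rw [h2]; ring
  have h6 := mul_left_cancel₀ Complex.I_ne_zero h5
  rw [← h6]
  simp [circleMap]

/-! ### Truncations of subfactorial series -/

theorem IsSubfactorial.exists_bound {f : PowerSeries ℂ} (hf : IsSubfactorial f) {ε : ℝ}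
    (hε : 0 < ε) :
    ∃ A : ℝ, 0 ≤ A ∧ ∀ i : ℕ, ‖PowerSeries.coeff i f‖ ≤ A * (ε ^ i * i.factorial) := by
  obtain ⟨A, hA⟩ := (isBigO_nat_atTop_iff fun i h => absurd h (by positivity)).1 (hf ε hε)
  refine ⟨|A|, abs_nonneg _, fun i => (hA i).trans ?_⟩
  rw [Real.norm_of_nonneg (by positivity)]
  gcongr
  exact le_abs_self _

theorem factorial_le_factorial_mul_pow {m i n : ℕ} (hmi : m ≤ i) (hin : i ≤ n) :
    i.factorial ≤ m.factorial * n ^ (i - m) := by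
  induction i, hmi using Nat.le_induction with
  | base => simp
  | succ i hi ih =>
    rw [Nat.factorial_succ, Nat.succ_sub hi, pow_succ]
    calc (i + 1) * i.factorial ≤ n * (m.factorial * n ^ (i - m)) :=
          Nat.mul_le_mul hin (ih (by omega))
      _ = _ := by ring

/-- On the disk `‖z‖ ≤ c / n` the degree-`n` truncation of a subfactorial series is as close to
its first terms as for a convergent series, with constants that do not depend on `n`: there
`i! ‖z‖ ^ i` decays geometrically up to `i = n` once `ε` is small. -/
theorem IsSubfactorial.truncEval_sub_le {f : PowerSeries ℂ} (hf : IsSubfactorial f) {c : ℝ}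
    (hc : 0 < c) (m : ℕ) :
    ∃ C : ℝ, 0 ≤ C ∧ ∀ n : ℕ, 1 ≤ n → m ≤ n + 1 → ∀ z : ℂ, ‖z‖ ≤ c / n →
      ‖truncEval n f z - ∑ i ∈ Finset.range m, PowerSeries.coeff i f * z ^ i‖ ≤ C * ‖z‖ ^ m := by
  set ε := 1 / (2 * c) with hε
  have hε0 : 0 < ε := by positivity
  obtain ⟨A, hA0, hA⟩ := hf.exists_bound hε0
  refine ⟨A * ε ^ m * m.factorial * 2, by positivity, fun n hn hmn z hz => ?_⟩
  have hn0 : (0 : ℝ) < n := by exact_mod_cast hn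
  rw [truncEval, Finset.sum_range_sub_sum_range hmn]
  refine (norm_sum_le _ _).trans ?_
  have hterm : ∀ i ∈ (Finset.range (n + 1)).filter (m ≤ ·),
      ‖PowerSeries.coeff i f * z ^ i‖ ≤ A * ε ^ m * m.factorial * ‖z‖ ^ m * (1 / 2) ^ (i - m) := by
    intro i hi
    obtain ⟨hi1, hi2⟩ := Finset.mem_filter.1 hi
    have hi1' : i ≤ n := by simpa [Nat.lt_succ_iff] using hi1
    obtain ⟨t, rfl⟩ := Nat.exists_eq_add_of_le hi2
    have hfac : ((m + t).factorial : ℝ) ≤ m.factorial * (n : ℝ) ^ t := by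
      have := factorial_le_factorial_mul_pow hi2 hi1'
      rw [Nat.add_sub_cancel_left] at this
      exact_mod_cast this
    have hzt : ‖z‖ ^ t ≤ (c / n) ^ t := by gcongr
    rw [norm_mul, norm_pow, Nat.add_sub_cancel_left]
    calc ‖PowerSeries.coeff (m + t) f‖ * ‖z‖ ^ (m + t)
        ≤ A * (ε ^ (m + t) * (m.factorial * (n : ℝ) ^ t)) * (‖z‖ ^ m * (c / n) ^ t) := by
          rw [pow_add ‖z‖]
          gcongr
          refine (hA _).trans ?_
          gcongr
      _ = A * ε ^ m * m.factorial * ‖z‖ ^ m * (ε * c) ^ t := by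
          have : (n : ℝ) ^ t * (c / n) ^ t = c ^ t := by
            rw [← mul_pow, mul_div_cancel₀ _ hn0.ne']
          rw [pow_add, mul_pow, ← this]; ring
      _ = _ := by
          congr 2
          rw [hε]; field_simp
  refine (Finset.sum_le_sum hterm).trans ?_
  rw [← Finset.mul_sum]
  have hgeo : ∑ i ∈ (Finset.range (n + 1)).filter (m ≤ ·), (1 / 2 : ℝ) ^ (i - m) ≤ 2 := by
    have : (Finset.range (n + 1)).filter (m ≤ ·) = Finset.Ico m (n + 1) := by
      ext i; simp; omega
    rw [this, Finset.sum_Ico_eq_sum_range]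
    simp only [Nat.add_sub_cancel_left]
    exact (Summable.sum_le_tsum _ (fun i _ => by positivity) summable_geometric_two).trans
      (le_of_eq tsum_geometric_two)
  calc _ ≤ A * ε ^ m * m.factorial * ‖z‖ ^ m * 2 := by gcongr
    _ = _ := by ring

/-! ### Uniform Taylor estimates on a disk -/

theorem exists_lipschitz_of_differentiableOn {g : ℂ → ℂ}
    (hg : DifferentiableOn ℂ g (Metric.ball 0 1)) {r : ℝ} (hr : r < 1) :
    ∃ C : ℝ, 0 ≤ C ∧ ∀ x y : ℂ, ‖x‖ ≤ r → ‖y‖ ≤ r → ‖g y - g x‖ ≤ C * ‖y - x‖ := by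
  have hsub : Metric.closedBall (0 : ℂ) r ⊆ Metric.ball 0 1 := Metric.closedBall_subset_ball hr
  obtain ⟨C, hC⟩ := (isCompact_closedBall (0 : ℂ) r).exists_bound_of_continuousOn
    ((hg.deriv Metric.isOpen_ball).continuousOn.mono hsub)
  refine ⟨|C|, abs_nonneg _, fun x y hx hy => ?_⟩
  refine (convex_closedBall (0 : ℂ) r).norm_image_sub_le_of_norm_deriv_le (𝕜 := ℂ)
    (fun z hz => hg.differentiableAt (Metric.isOpen_ball.mem_nhds (hsub hz)))
    (fun z hz => (hC z hz).trans (le_abs_self _)) (by simpa using hx) (by simpa using hy)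

theorem norm_image_sub_le_of_segment {G G' : ℂ → ℂ} {x y : ℂ} {r B : ℝ} (hx : ‖x‖ ≤ r)
    (hy : ‖y‖ ≤ r) (hG : ∀ z, ‖z‖ ≤ r → HasDerivAt G (G' z) z)
    (hB : ∀ z, ‖z‖ ≤ r → ‖z - x‖ ≤ ‖y - x‖ → ‖G' z‖ ≤ B) : ‖G y - G x‖ ≤ B * ‖y - x‖ := by
  have hseg : ∀ z ∈ segment ℝ x y, ‖z‖ ≤ r := fun z hz => by
    have := (convex_closedBall (0 : ℂ) r).segment_subset (x := x) (y := y) (by simpa using hx)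
      (by simpa using hy) hz
    simpa using this
  refine (convex_segment x y).norm_image_sub_le_of_norm_hasDerivWithin_le (𝕜 := ℂ)
    (fun z hz => (hG z (hseg z hz)).hasDerivWithinAt)
    (fun z hz => hB z (hseg z hz) (norm_sub_le_of_mem_segment hz))
    (left_mem_segment ℝ x y) (right_mem_segment ℝ x y)

theorem exists_taylor_two {g : ℂ → ℂ} (hg : DifferentiableOn ℂ g (Metric.ball 0 1)) {r : ℝ}
    (hr : r < 1) :
    ∃ C : ℝ, 0 ≤ C ∧ ∀ x y : ℂ, ‖x‖ ≤ r → ‖y‖ ≤ r →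
      ‖g y - g x - (y - x) * deriv g x‖ ≤ C * ‖y - x‖ ^ 2 := by
  obtain ⟨C, hC0, hC⟩ := exists_lipschitz_of_differentiableOn (hg.deriv Metric.isOpen_ball) hr
  refine ⟨C, hC0, fun x y hx hy => ?_⟩
  have h := norm_image_sub_le_of_segment (G := fun z => g z - g x - (z - x) * deriv g x)
    (G' := fun z => deriv g z - deriv g x) (B := C * ‖y - x‖) hx hy (fun z hz => ?_)
    (fun z hz hzx => (hC x z hx hz).trans (by gcongr))
  · simpa [sq, mul_assoc] using h
  · have hd : HasDerivAt g (deriv g z) z := (hg.differentiableAt (Metric.isOpen_ball.mem_nhds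
      (by simpa using lt_of_le_of_lt hz hr))).hasDerivAt
    have h2 := (hd.sub_const (g x)).fun_sub (((hasDerivAt_id z).sub_const x).mul_const (deriv g x))
    refine h2.congr_deriv ?_
    ring

theorem exists_taylor_three {g : ℂ → ℂ} (hg : DifferentiableOn ℂ g (Metric.ball 0 1)) {r : ℝ}
    (hr : r < 1) :
    ∃ C : ℝ, 0 ≤ C ∧ ∀ x y : ℂ, ‖x‖ ≤ r → ‖y‖ ≤ r →
      ‖g y - g x - (y - x) * deriv g x - (y - x) ^ 2 / 2 * deriv (deriv g) x‖ ≤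
        C * ‖y - x‖ ^ 3 := by
  obtain ⟨C, hC0, hC⟩ := exists_taylor_two (hg.deriv Metric.isOpen_ball) hr
  refine ⟨C, hC0, fun x y hx hy => ?_⟩
  have h := norm_image_sub_le_of_segment
    (G := fun z => g z - g x - (z - x) * deriv g x - (z - x) ^ 2 / 2 * deriv (deriv g) x)
    (G' := fun z => deriv g z - deriv g x - (z - x) * deriv (deriv g) x)
    (B := C * ‖y - x‖ ^ 2) hx hy (fun z hz => ?_)
    (fun z hz hzx => (hC x z hx hz).trans (by gcongr))
  · have h3 : C * ‖y - x‖ ^ 3 = C * ‖y - x‖ ^ 2 * ‖y - x‖ := by ring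
    rw [h3]
    simpa using h
  · have hd : HasDerivAt g (deriv g z) z := (hg.differentiableAt (Metric.isOpen_ball.mem_nhds
      (by simpa using lt_of_le_of_lt hz hr))).hasDerivAt
    have hx1 := (hasDerivAt_id z).sub_const x
    have h2 := ((hd.sub_const (g x)).fun_sub (hx1.mul_const (deriv g x))).fun_sub
      (((hx1.fun_pow 2).div_const 2).mul_const (deriv (deriv g) x))
    refine h2.congr_deriv ?_
    simp only [id]
    push_cast
    ring

/-! ### Midpoint summation of `logExpQuot` -/

theorem deriv_mul_meanLog {w : ℂ} (hw : ‖w‖ < 1) :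
    deriv (fun w => w * meanLog w) w = logExpQuot w := (hasDerivAt_mul_meanLog hw).deriv

theorem differentiableOn_mul_meanLog :
    DifferentiableOn ℂ (fun w => w * meanLog w) (Metric.ball 0 1) := fun _ hw =>
  (hasDerivAt_mul_meanLog (by simpa using hw)).differentiableAt.differentiableWithinAt

theorem differentiableOn_meanLog : DifferentiableOn ℂ meanLog (Metric.ball 0 1) := by
  have h : meanLog = dslope (fun w => w * meanLog w) 0 := by
    funext w
    rcases eq_or_ne w 0 with rfl | hw
    · rw [dslope_same, deriv_mul_meanLog (by simp), logExpQuot_zero]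
      simp [meanLog, logExpQuot_zero]
    · rw [dslope_of_ne _ hw, slope_def_field]
      simp [hw]
  rw [h]
  exact (Complex.differentiableOn_dslope (Metric.ball_mem_nhds _ one_pos)).2
    differentiableOn_mul_meanLog

/-- The midpoint rule for `∑ logExpQuot ((j + ω) v / k)`, telescoped through the primitive
`w * meanLog w`. -/
theorem sum_logExpQuot_asymp (R : ℝ) :
    ∃ C : ℝ, 0 ≤ C ∧ ∃ K : ℕ, 1 ≤ K ∧ ∀ k : ℕ, K ≤ k → ∀ τ : ℂ, τ ≠ 0 → ‖(k : ℂ) * τ‖ ≤ 3 / 4 →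
      ∀ ω : ℂ, ‖ω‖ ≤ R →
        (∀ j ∈ Finset.Icc 1 k, ‖((j : ℂ) + ω) * τ‖ ≤ 7 / 8) ∧
        ‖∑ j ∈ Finset.Icc 1 k, logExpQuot (((j : ℂ) + ω) * τ) -
          (k * meanLog (k * τ) + (ω + 1 / 2) * logExpQuot (k * τ))‖ ≤ C / k := by
  set F : ℂ → ℂ := fun w => w * meanLog w with hF
  have hr : (7 / 8 : ℝ) < 1 := by norm_num
  obtain ⟨C₂, hC₂0, hC₂⟩ := exists_taylor_two differentiableOn_mul_meanLog hr
  obtain ⟨C₃, hC₃0, hC₃⟩ := exists_taylor_three differentiableOn_mul_meanLog hr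
  obtain ⟨K, hK⟩ := exists_nat_ge (6 * (|R| + 1 / 2) + 1)
  have hK1 : (1 : ℝ) ≤ K := by linarith [abs_nonneg R]
  refine ⟨C₃ + 2 * C₂ * (|R| + 1 / 2) ^ 2, by positivity, K, by exact_mod_cast hK1,
    fun k hk τ hτ hkτ ω hω => ?_⟩
  have hk' : (K : ℝ) ≤ k := by exact_mod_cast hk
  have hk0 : (0 : ℝ) < k := by linarith
  have hkc : (k : ℂ) ≠ 0 := by exact_mod_cast hk0.ne'
  have hRω : ‖ω‖ ≤ |R| := hω.trans (le_abs_self R)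
  have hτn : ‖τ‖ ≤ 3 / 4 / k := by
    rw [norm_mul, Complex.norm_natCast] at hkτ
    rw [le_div_iff₀ hk0]; linarith
  have hτpos : 0 < ‖τ‖ := norm_pos_iff.2 hτ
  have hτ1 : ‖τ‖ ≤ 1 / k := hτn.trans (by gcongr; norm_num)
  -- every point that occurs lies in the disk of radius `7 / 8`
  have hpt : ∀ u : ℂ, ‖u‖ ≤ k + (|R| + 1 / 2) → ‖u * τ‖ ≤ 7 / 8 := by
    intro u hu
    rw [norm_mul]
    calc ‖u‖ * ‖τ‖ ≤ (k + (|R| + 1 / 2)) * (3 / 4 / k) := by gcongr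
      _ ≤ 7 / 8 := by
        rw [mul_div_assoc', div_le_iff₀ hk0]; linarith
  have hjn : ∀ j ∈ Finset.Icc 1 k, (j : ℝ) ≤ k := fun j hj => by
    exact_mod_cast (Finset.mem_Icc.1 hj).2
  have hj1 : ∀ j ∈ Finset.Icc 1 k, ∀ t : ℂ, ‖t‖ ≤ 1 / 2 → ‖((j : ℂ) + ω + t) * τ‖ ≤ 7 / 8 := by
    intro j hj t ht
    refine hpt _ ((norm_add_le _ _).trans ?_)
    have := norm_add_le (j : ℂ) ω
    rw [Complex.norm_natCast] at this
    linarith [hjn j hj]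
  have hj0 : ∀ j ∈ Finset.Icc 1 k, ‖((j : ℂ) + ω) * τ‖ ≤ 7 / 8 := fun j hj => by
    simpa using hj1 j hj 0 (by simp)
  refine ⟨hj0, ?_⟩
  have hstep : ∀ j ∈ Finset.Icc 1 k, ‖τ * logExpQuot (((j : ℂ) + ω) * τ) -
      (F (((j : ℂ) + ω + 1 / 2) * τ) - F (((j : ℂ) + ω + (-1 / 2)) * τ))‖ ≤ C₃ * ‖τ‖ ^ 3 := by
    intro j hj
    have hhalf : ‖(1 / 2 : ℂ)‖ ≤ 1 / 2 := by norm_num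
    have hhalf' : ‖(-1 / 2 : ℂ)‖ ≤ 1 / 2 := by norm_num
    have a1 := hC₃ _ _ (hj0 j hj) (hj1 j hj (1 / 2) hhalf)
    have a2 := hC₃ _ _ (hj0 j hj) (hj1 j hj (-1 / 2) hhalf')
    have e1 : ((j : ℂ) + ω + 1 / 2) * τ - ((j : ℂ) + ω) * τ = τ / 2 := by ring
    have e2 : ((j : ℂ) + ω + (-1 / 2)) * τ - ((j : ℂ) + ω) * τ = -(τ / 2) := by ring
    rw [e1, deriv_mul_meanLog (lt_of_le_of_lt (hj0 j hj) hr)] at a1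
    rw [e2, deriv_mul_meanLog (lt_of_le_of_lt (hj0 j hj) hr), norm_neg] at a2
    have hn : ‖τ / 2‖ = ‖τ‖ / 2 := by simp
    rw [hn] at a1 a2
    rw [← norm_neg]
    refine (le_of_eq_of_le (congrArg norm ?_) (norm_sub_le _ _)).trans
      ((add_le_add a1 a2).trans ?_)
    · simp only [hF]; ring
    · nlinarith [pow_pos hτpos 3, mul_nonneg hC₃0 (pow_pos hτpos 3).le]
  have htel : ∑ j ∈ Finset.Icc 1 k, (F (((j : ℂ) + ω + 1 / 2) * τ) -
      F (((j : ℂ) + ω + (-1 / 2)) * τ)) = F (((k : ℂ) + (ω + 1 / 2)) * τ) - F ((ω + 1 / 2) * τ) := by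
    have : ∀ m : ℕ, ∑ j ∈ Finset.Icc 1 m, (F (((j : ℂ) + ω + 1 / 2) * τ) -
      F (((j : ℂ) + ω + (-1 / 2)) * τ)) = F (((m : ℂ) + (ω + 1 / 2)) * τ) - F ((ω + 1 / 2) * τ) := by
      intro m
      induction m with
      | zero => simp
      | succ m ih =>
        rw [Finset.sum_Icc_succ_top (by omega), ih]
        push_cast
        have h1 : ((m : ℂ) + 1 + ω + (-1 / 2)) * τ = ((m : ℂ) + (ω + 1 / 2)) * τ := by ring
        have h2 : ((m : ℂ) + 1 + ω + 1 / 2) * τ = ((m : ℂ) + 1 + (ω + 1 / 2)) * τ := by ring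
        rw [h1, h2]; ring
    exact this k
  have hsum : ‖τ * ∑ j ∈ Finset.Icc 1 k, logExpQuot (((j : ℂ) + ω) * τ) -
      (F (((k : ℂ) + (ω + 1 / 2)) * τ) - F ((ω + 1 / 2) * τ))‖ ≤ k * (C₃ * ‖τ‖ ^ 3) := by
    rw [← htel, Finset.mul_sum, ← Finset.sum_sub_distrib]
    refine (norm_sum_le_of_le _ hstep).trans (le_of_eq ?_)
    simp
  have hω2 : ‖ω + 1 / 2‖ ≤ |R| + 1 / 2 := by
    refine (norm_add_le _ _).trans (add_le_add hRω ?_)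
    norm_num
  have hs1 : ‖F ((ω + 1 / 2) * τ)‖ ≤ C₂ * ((|R| + 1 / 2) * ‖τ‖) ^ 2 := by
    have a := hC₂ 0 ((ω + 1 / 2) * τ) (by norm_num) (hpt _ (by linarith))
    rw [deriv_mul_meanLog (by simp), logExpQuot_zero] at a
    simp only [zero_mul, sub_zero, mul_zero, norm_mul] at a
    simp only [hF, norm_mul]
    refine a.trans ?_
    gcongr
  have hs2 : ‖F (((k : ℂ) + (ω + 1 / 2)) * τ) - F (k * τ) - (ω + 1 / 2) * τ * logExpQuot (k * τ)‖ ≤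
      C₂ * ((|R| + 1 / 2) * ‖τ‖) ^ 2 := by
    have hkk : ‖(k : ℂ) * τ‖ ≤ 7 / 8 := hkτ.trans (by norm_num)
    have a := hC₂ (k * τ) (((k : ℂ) + (ω + 1 / 2)) * τ) hkk (hpt _ (by
      refine (norm_add_le _ _).trans ?_
      rw [Complex.norm_natCast]; linarith))
    rw [deriv_mul_meanLog (lt_of_le_of_lt hkk hr)] at a
    have e : ((k : ℂ) + (ω + 1 / 2)) * τ - k * τ = (ω + 1 / 2) * τ := by ring
    rw [e, norm_mul (ω + 1 / 2)] at a
    refine a.trans ?_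
    gcongr
  have htot : ‖τ * (∑ j ∈ Finset.Icc 1 k, logExpQuot (((j : ℂ) + ω) * τ) -
      (k * meanLog (k * τ) + (ω + 1 / 2) * logExpQuot (k * τ)))‖ ≤
      ‖τ‖ * ((C₃ + 2 * C₂ * (|R| + 1 / 2) ^ 2) / k) := by
    have e : τ * (∑ j ∈ Finset.Icc 1 k, logExpQuot (((j : ℂ) + ω) * τ) -
      (k * meanLog (k * τ) + (ω + 1 / 2) * logExpQuot (k * τ))) =
      (τ * ∑ j ∈ Finset.Icc 1 k, logExpQuot (((j : ℂ) + ω) * τ) -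
        (F (((k : ℂ) + (ω + 1 / 2)) * τ) - F ((ω + 1 / 2) * τ))) +
      (F (((k : ℂ) + (ω + 1 / 2)) * τ) - F (k * τ) - (ω + 1 / 2) * τ * logExpQuot (k * τ)) -
      F ((ω + 1 / 2) * τ) := by
      simp only [hF]; ring
    rw [e]
    refine (norm_sub_le _ _).trans ((add_le_add ((norm_add_le _ _).trans (add_le_add hsum hs2))
      hs1).trans ?_)
    have h1 : k * ‖τ‖ ≤ 1 := by
      calc k * ‖τ‖ ≤ k * (1 / k) := by gcongr
        _ = 1 := by field_simp
    have h2 : k * (C₃ * ‖τ‖ ^ 3) ≤ ‖τ‖ * (C₃ / k) := by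
      calc k * (C₃ * ‖τ‖ ^ 3) = C₃ * ‖τ‖ * (k * ‖τ‖) * ‖τ‖ := by ring
        _ ≤ C₃ * ‖τ‖ * 1 * (1 / k) := by gcongr
        _ = _ := by ring
    have h3 : C₂ * ((|R| + 1 / 2) * ‖τ‖) ^ 2 ≤ ‖τ‖ * (C₂ * (|R| + 1 / 2) ^ 2 / k) := by
      calc C₂ * ((|R| + 1 / 2) * ‖τ‖) ^ 2 = C₂ * (|R| + 1 / 2) ^ 2 * ‖τ‖ * ‖τ‖ := by ring
        _ ≤ C₂ * (|R| + 1 / 2) ^ 2 * ‖τ‖ * (1 / k) := by gcongr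
        _ = _ := by ring
    calc _ ≤ ‖τ‖ * (C₃ / k) + ‖τ‖ * (C₂ * (|R| + 1 / 2) ^ 2 / k) +
          ‖τ‖ * (C₂ * (|R| + 1 / 2) ^ 2 / k) := add_le_add (add_le_add h2 h3) h3
      _ = _ := by ring
  rw [norm_mul] at htot
  exact le_of_mul_le_mul_left htot hτpos

/-! ### Relative errors -/

theorem norm_mul_sub_mul_le {x y x' y' : ℂ} {a b : ℝ} (ha : 0 ≤ a) (h : ‖x - y‖ ≤ a * ‖y‖)
    (h' : ‖x' - y'‖ ≤ b * ‖y'‖) : ‖x * x' - y * y'‖ ≤ (a + b + a * b) * ‖y * y'‖ := by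
  have e : x * x' - y * y' = (x - y) * y' + y * (x' - y') + (x - y) * (x' - y') := by ring
  rw [e, norm_mul y y']
  refine (norm_add_le _ _).trans ((add_le_add (norm_add_le _ _) le_rfl).trans ?_)
  rw [norm_mul, norm_mul, norm_mul]
  have h0 := norm_nonneg y
  have h1 := norm_nonneg y'
  calc _ ≤ a * ‖y‖ * ‖y'‖ + ‖y‖ * (b * ‖y'‖) + (a * ‖y‖) * (b * ‖y'‖) := by gcongr
    _ = _ := by ring

/-- Products of quantities with relative errors `a / k`, `b / k` have relative error `O(1/k)`. -/
theorem norm_mul_sub_mul_le_div {x y x' y' : ℂ} {a b k : ℝ} (ha : 0 ≤ a) (hb : 0 ≤ b) (hk : 1 ≤ k)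
    (h : ‖x - y‖ ≤ a / k * ‖y‖) (h' : ‖x' - y'‖ ≤ b / k * ‖y'‖) :
    ‖x * x' - y * y'‖ ≤ (a + b + a * b) / k * ‖y * y'‖ := by
  have hk0 : 0 < k := by linarith
  refine (norm_mul_sub_mul_le (by positivity) h h').trans ?_
  have : a / k * (b / k) ≤ a * b / k := by
    rw [div_mul_div_comm]
    exact div_le_div_of_nonneg_left (by positivity) hk0 (by nlinarith)
  have h2 : a / k + b / k + a / k * (b / k) ≤ (a + b + a * b) / k := by
    rw [add_div, add_div]; linarith
  gcongr

theorem norm_pow_sub_pow_le_div {a : ℝ} (ha : 0 ≤ a) (m : ℕ) :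
    ∃ b : ℝ, 0 ≤ b ∧ ∀ (x y : ℂ) (k : ℝ), 1 ≤ k → ‖x - y‖ ≤ a / k * ‖y‖ →
      ‖x ^ m - y ^ m‖ ≤ b / k * ‖y ^ m‖ := by
  induction m with
  | zero => exact ⟨0, le_rfl, fun x y k _ _ => by simp⟩
  | succ m ih =>
    obtain ⟨b, hb, h⟩ := ih
    refine ⟨b + a + b * a, by positivity, fun x y k hk hxy => ?_⟩
    rw [pow_succ, pow_succ]
    exact norm_mul_sub_mul_le_div hb ha hk (h x y k hk hxy) hxy

/-- An absolute error in the exponent becomes a relative error of the exponential. -/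
theorem norm_exp_sub_exp_le {X Y : ℂ} {t : ℝ} (ht : t ≤ 1) (h : ‖X - Y‖ ≤ t) :
    ‖Complex.exp X - Complex.exp Y‖ ≤ 2 * t * ‖Complex.exp Y‖ := by
  have e : Complex.exp X - Complex.exp Y = (Complex.exp (X - Y) - 1) * Complex.exp Y := by
    rw [sub_mul, ← Complex.exp_add]; simp
  rw [e, norm_mul]
  gcongr
  refine (Complex.norm_exp_sub_one_le (h.trans ht)).trans ?_
  gcongr

/-! ### The product `∏ (exp ((j + ω) τ) - 1)` -/

/-- The exponent of the product approximation: `v = w + γ w² / k + O(1/k²)` may be replaced by `w`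
at the cost of the terms with `γ`. -/
theorem product_exponent_asymp (γ : ℂ) (R T : ℝ) :
    ∃ C : ℝ, 0 ≤ C ∧ ∃ K : ℕ, 1 ≤ K ∧ ∀ k : ℕ, K ≤ k → ∀ w v : ℂ, ‖w‖ = Real.log 2 →
      ‖v - w - γ * w ^ 2 / k‖ ≤ T / k ^ 2 →
      v ≠ 0 ∧ ‖v‖ ≤ 3 / 4 ∧ ∀ ω : ℂ, ‖ω‖ ≤ R →
        ‖k * Complex.log (v / w) + (k * meanLog v + (ω + 1 / 2) * logExpQuot v) -
          (k * meanLog w + γ * (w + w * logExpQuot w - w * meanLog w) +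
            (ω + 1 / 2) * logExpQuot w)‖ ≤ C / k := by
  have hr : (3 / 4 : ℝ) < 1 := by norm_num
  obtain ⟨C₂, hC₂0, hC₂⟩ := exists_taylor_two differentiableOn_meanLog hr
  obtain ⟨C₁, hC₁0, hC₁⟩ := exists_lipschitz_of_differentiableOn differentiableOn_logExpQuot hr
  obtain ⟨B, hB⟩ := (isCompact_closedBall (0 : ℂ) (3 / 4)).exists_bound_of_continuousOn
    ((differentiableOn_meanLog.deriv Metric.isOpen_ball).continuousOn.mono
      (Metric.closedBall_subset_ball hr))
  have hB0 : 0 ≤ B := (norm_nonneg _).trans (hB 0 (by simp; norm_num))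
  set D : ℝ := ‖γ‖ + |T| with hD
  have hD0 : 0 ≤ D := by positivity
  obtain ⟨K, hK⟩ := exists_nat_ge (20 * D + 1)
  refine ⟨4 * D ^ 2 + 2 * |T| + C₂ * D ^ 2 + |T| * B + (|R| + 1 / 2) * (C₁ * D), by positivity, K,
    by exact_mod_cast (by linarith : (1 : ℝ) ≤ K), fun k hk w v hw hv => ?_⟩
  have hkK : (K : ℝ) ≤ k := by exact_mod_cast hk
  have hk1 : (1 : ℝ) ≤ k := by linarith
  have hk0 : (0 : ℝ) < k := by linarith
  have hkC : (k : ℂ) ≠ 0 := by exact_mod_cast hk0.ne'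
  have hl1 := Real.log_two_lt_d9
  have hl2 := Real.log_two_gt_d9
  have hw1 : ‖w‖ ≤ 0.7 := by rw [hw]; linarith
  have hw2 : 1 / 2 ≤ ‖w‖ := by rw [hw]; linarith
  have hw0 : w ≠ 0 := norm_pos_iff.1 (by linarith)
  have hv' : ‖v - w - γ * w ^ 2 / k‖ ≤ |T| / k ^ 2 :=
    hv.trans (by gcongr; exact le_abs_self T)
  have hvw : ‖v - w‖ ≤ D / k := by
    have e : v - w = (v - w - γ * w ^ 2 / k) + γ * w ^ 2 / k := by ring
    rw [e, hD, add_comm ‖γ‖, add_div]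
    refine (norm_add_le _ _).trans (add_le_add (hv'.trans ?_) ?_)
    · gcongr
      nlinarith
    · rw [norm_div, norm_mul, norm_pow, Complex.norm_natCast]
      gcongr
      have : ‖w‖ ^ 2 ≤ 1 := by nlinarith
      nlinarith [norm_nonneg γ]
  have hDk : D / k ≤ 1 / 20 := by
    rw [div_le_iff₀ hk0]; linarith
  have hvn : ‖v‖ ≤ 3 / 4 := by
    have e : v = w + (v - w) := by ring
    rw [e]
    refine (norm_add_le _ _).trans ?_
    linarith
  have hwn : ‖w‖ ≤ 3 / 4 := by linarith
  refine ⟨?_, hvn, fun ω hω => ?_⟩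
  · rintro rfl
    rw [zero_sub, norm_neg] at hvw
    linarith
  have hRω : ‖ω + 1 / 2‖ ≤ |R| + 1 / 2 := by
    refine (norm_add_le _ _).trans (add_le_add (hω.trans (le_abs_self _)) ?_)
    norm_num
  -- `k log (v / w) ≈ k y ≈ γ w`
  set y : ℂ := (v - w) / w with hy
  have hy2 : ‖y‖ ≤ 2 * D / k := by
    rw [hy, norm_div, div_le_iff₀ (by linarith)]
    refine hvw.trans ?_
    have : 0 ≤ D / k := by positivity
    rw [mul_div_assoc]
    nlinarith
  have hy1 : ‖y‖ ≤ 1 / 2 := by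
    refine hy2.trans ?_
    rw [mul_div_assoc]; linarith
  have hvy : v / w = 1 + y := by rw [hy]; field_simp; ring
  have t1 : ‖(k : ℂ) * (Complex.log (1 + y) - y)‖ ≤ 4 * D ^ 2 / k := by
    have h := Complex.norm_log_one_add_sub_self_le (z := y) (by linarith)
    have h2 : (1 - ‖y‖)⁻¹ ≤ 2 := by
      rw [inv_le_comm₀ (by linarith) (by norm_num)]; linarith
    rw [norm_mul, Complex.norm_natCast]
    calc (k : ℝ) * ‖Complex.log (1 + y) - y‖ ≤ k * (‖y‖ ^ 2 * 2 / 2) := by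
          refine mul_le_mul_of_nonneg_left (h.trans ?_) hk0.le
          gcongr
      _ ≤ k * (2 * D / k) ^ 2 := by
          rw [mul_div_assoc, div_self two_ne_zero, mul_one]
          gcongr
      _ = 4 * D ^ 2 / k := by field_simp; ring
  have t2 : ‖(k : ℂ) * y - γ * w‖ ≤ 2 * |T| / k := by
    have e : (k : ℂ) * y - γ * w = k * ((v - w - γ * w ^ 2 / k) / w) := by
      rw [hy]; field_simp
    rw [e, norm_mul, Complex.norm_natCast, norm_div]
    calc (k : ℝ) * (‖v - w - γ * w ^ 2 / k‖ / ‖w‖) ≤ k * (|T| / k ^ 2 / (1 / 2)) := by gcongr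
      _ = 2 * |T| / k := by field_simp
  -- `k (meanLog v - meanLog w) ≈ k (v - w) meanLog' w ≈ γ w² meanLog' w`
  have hder : w * deriv meanLog w = logExpQuot w - meanLog w := by
    rw [(hasDerivAt_meanLog (by linarith) hw0).deriv]; field_simp
  have t3 : ‖(k : ℂ) * (meanLog v - meanLog w - (v - w) * deriv meanLog w)‖ ≤ C₂ * D ^ 2 / k := by
    rw [norm_mul, Complex.norm_natCast]
    calc (k : ℝ) * ‖meanLog v - meanLog w - (v - w) * deriv meanLog w‖
        ≤ k * (C₂ * (D / k) ^ 2) := by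
          refine mul_le_mul_of_nonneg_left ((hC₂ w v hwn hvn).trans ?_) hk0.le
          gcongr
      _ = C₂ * D ^ 2 / k := by field_simp
  have t4 : ‖(k : ℂ) * ((v - w - γ * w ^ 2 / k) * deriv meanLog w)‖ ≤ |T| * B / k := by
    rw [norm_mul, Complex.norm_natCast, norm_mul]
    calc (k : ℝ) * (‖v - w - γ * w ^ 2 / k‖ * ‖deriv meanLog w‖) ≤ k * (|T| / k ^ 2 * B) := by
          have := hB w (by simpa using hwn)
          gcongr
      _ = |T| * B / k := by field_simp
  have t5 : ‖(ω + 1 / 2) * (logExpQuot v - logExpQuot w)‖ ≤ (|R| + 1 / 2) * (C₁ * D) / k := by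
    rw [norm_mul, mul_div_assoc, mul_div_assoc]
    refine mul_le_mul hRω ((hC₁ w v hwn hvn).trans ?_) (norm_nonneg _) (by positivity)
    gcongr
  have e : k * Complex.log (v / w) + (k * meanLog v + (ω + 1 / 2) * logExpQuot v) -
      (k * meanLog w + γ * (w + w * logExpQuot w - w * meanLog w) +
        (ω + 1 / 2) * logExpQuot w) =
      k * (Complex.log (1 + y) - y) + (k * y - γ * w) +
      k * (meanLog v - meanLog w - (v - w) * deriv meanLog w) +
      k * ((v - w - γ * w ^ 2 / k) * deriv meanLog w) +
      (ω + 1 / 2) * (logExpQuot v - logExpQuot w) := by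
    have h : (k : ℂ) * (γ * w ^ 2 / k) = γ * w ^ 2 := by field_simp
    rw [hvy]
    linear_combination (γ * w) * hder + deriv meanLog w * h
  rw [e, add_div, add_div, add_div, add_div]
  exact (norm_add_le _ _).trans (add_le_add ((norm_add_le _ _).trans (add_le_add
    ((norm_add_le _ _).trans (add_le_add ((norm_add_le _ _).trans (add_le_add t1 t2)) t3)) t4)) t5)

theorem prod_exp_sub_one_eq {k : ℕ} {τ ω : ℂ}
    (h : ∀ j ∈ Finset.Icc 1 k, ‖((j : ℂ) + ω) * τ‖ < 1) :
    ∏ j ∈ Finset.Icc 1 k, (Complex.exp (((j : ℂ) + ω) * τ) - 1) =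
      k.factorial * (∏ j ∈ Finset.Icc 1 k, (1 + ω / (j : ℂ))) *
        (τ ^ k * Complex.exp (∑ j ∈ Finset.Icc 1 k, logExpQuot (((j : ℂ) + ω) * τ))) := by
  have h1 : ∀ j ∈ Finset.Icc 1 k, Complex.exp (((j : ℂ) + ω) * τ) - 1 =
      (j : ℂ) * (1 + ω / (j : ℂ)) * (τ * Complex.exp (logExpQuot (((j : ℂ) + ω) * τ))) := by
    intro j hj
    have hj0 : (j : ℂ) ≠ 0 := by
      have := (Finset.mem_Icc.1 hj).1
      exact_mod_cast (by omega : j ≠ 0)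
    rw [exp_logExpQuot (h j hj), ← mul_expQuot]
    field_simp
  have h2 : ∏ j ∈ Finset.Icc 1 k, (j : ℂ) = k.factorial := by
    clear h h1
    induction k with
    | zero => simp
    | succ k ih => rw [Finset.prod_Icc_succ_top (by omega), ih, Nat.factorial_succ]; push_cast; ring
  rw [Finset.prod_congr rfl h1, Finset.prod_mul_distrib, Finset.prod_mul_distrib,
    Finset.prod_mul_distrib, Finset.prod_const, Complex.exp_sum, h2]
  simp

/-- The product `∏ (exp ((j + ω) τ) - 1)` for `τ ≈ w / k` with `w` on the circle
`‖w‖ = log 2`. -/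
theorem prod_exp_sub_one_asymp (γ : ℂ) (R T : ℝ) :
    ∃ C : ℝ, 0 ≤ C ∧ ∃ K : ℕ, 1 ≤ K ∧ ∀ k : ℕ, K ≤ k → ∀ (θ : ℝ) (τ : ℂ),
      ‖k * τ - circlePt θ - γ * circlePt θ ^ 2 / k‖ ≤ T / k ^ 2 → ∀ ω : ℂ, ‖ω‖ ≤ R →
        ‖∏ j ∈ Finset.Icc 1 k, (Complex.exp (((j : ℂ) + ω) * τ) - 1) -
          (Real.sqrt (2 * Real.pi) : ℝ) * (Complex.Gamma (1 + ω))⁻¹ * (k : ℂ) ^ (1 / 2 + ω) *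
            Complex.exp (-k * rate θ + corr 0 γ θ + (1 / 2 + ω) * logExpQuot (circlePt θ))‖ ≤
        C / k * ‖(Real.sqrt (2 * Real.pi) : ℝ) * (Complex.Gamma (1 + ω))⁻¹ *
            (k : ℂ) ^ (1 / 2 + ω) *
            Complex.exp (-k * rate θ + corr 0 γ θ + (1 / 2 + ω) * logExpQuot (circlePt θ))‖ := by
  obtain ⟨C₁, hC₁, K₁, hK₁, h₁⟩ := product_exponent_asymp γ R T
  obtain ⟨C₂, hC₂, K₂, hK₂, h₂⟩ := sum_logExpQuot_asymp R
  obtain ⟨C₃, hC₃, K₃, hK₃, h₃⟩ := prod_one_add_div_asymp R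
  obtain ⟨C₄, hC₄, K₄, hK₄, h₄⟩ := factorial_asymp
  obtain ⟨K₅, hK₅⟩ := exists_nat_ge (C₁ + C₂)
  set a := C₄ + C₃ + C₄ * C₃ with ha
  have ha0 : 0 ≤ a := by positivity
  refine ⟨a + 2 * (C₁ + C₂) + a * (2 * (C₁ + C₂)), by positivity, K₁ + K₂ + K₃ + K₄ + K₅, by omega,
    fun k hk θ τ hτ ω hω => ?_⟩
  have hkn : 1 ≤ k := by omega
  have hk1 : (1 : ℝ) ≤ k := by exact_mod_cast hkn
  have hk0 : (0 : ℝ) < k := by linarith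
  have hkC : (k : ℂ) ≠ 0 := by exact_mod_cast hk0.ne'
  set w := circlePt θ with hw
  have hw0 : w ≠ 0 := circlePt_ne_zero _
  obtain ⟨hv0, hv34, hv⟩ := h₁ k (by omega) w (k * τ) (norm_circlePt θ) hτ
  have hτ0 : τ ≠ 0 := right_ne_zero_of_mul hv0
  obtain ⟨hj, hS⟩ := h₂ k (by omega) τ hτ0 hv34 ω hω
  rw [prod_exp_sub_one_eq fun j hjm => (hj j hjm).trans_lt (by norm_num)]
  set S := ∑ j ∈ Finset.Icc 1 k, logExpQuot (((j : ℂ) + ω) * τ) with hSdef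
  set Y : ℂ := k * meanLog w + γ * (w + w * logExpQuot w - w * meanLog w) +
            (ω + 1 / 2) * logExpQuot w with hY
  have hX : ‖(k * Complex.log (k * τ / w) + S) - Y‖ ≤ (C₁ + C₂) / k := by
    rw [add_comm C₁, add_div]
    have e : (k * Complex.log (k * τ / w) + S) - Y = (S - (k * meanLog (k * τ) +
        (ω + 1 / 2) * logExpQuot (k * τ))) + (k * Complex.log (k * τ / w) +
        (k * meanLog (k * τ) + (ω + 1 / 2) * logExpQuot (k * τ)) - Y) := by ring
    rw [e]
    exact (norm_add_le _ _).trans (add_le_add hS (hv ω hω))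
  have hCk : (C₁ + C₂) / k ≤ 1 := by
    rw [div_le_one hk0]
    refine hK₅.trans ?_
    exact_mod_cast (by omega : K₅ ≤ k)
  have hexp := norm_exp_sub_exp_le hCk hX
  have hτk : τ ^ k = (w / k) ^ k * Complex.exp (k * Complex.log (k * τ / w)) := by
    rw [Complex.exp_nat_mul, Complex.exp_log (div_ne_zero hv0 hw0), ← mul_pow]
    congr 1
    field_simp
  have hC : ‖τ ^ k * Complex.exp S - (w / k) ^ k * Complex.exp Y‖ ≤
      (2 * (C₁ + C₂)) / k * ‖(w / k) ^ k * Complex.exp Y‖ := by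
    rw [hτk, mul_assoc, ← Complex.exp_add, ← mul_sub, norm_mul, norm_mul]
    calc _ ≤ ‖(w / (k : ℂ)) ^ k‖ * (2 * ((C₁ + C₂) / k) * ‖Complex.exp Y‖) := by gcongr
      _ = _ := by ring
  have hfac : ‖(k.factorial : ℂ) - ((Real.sqrt (2 * Real.pi * k) * (k / Real.exp 1) ^ k : ℝ) : ℂ)‖ ≤
      C₄ / k * ‖((Real.sqrt (2 * Real.pi * k) * (k / Real.exp 1) ^ k : ℝ) : ℂ)‖ := by
    rw [← Complex.ofReal_natCast, ← Complex.ofReal_sub, Complex.norm_real, Complex.norm_real,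
      Real.norm_eq_abs, Real.norm_of_nonneg (by positivity)]
    exact h₄ k (by omega)
  have hall := norm_mul_sub_mul_le_div ha0 (by positivity) hk1
    (norm_mul_sub_mul_le_div hC₄ hC₃ hk1 hfac (h₃ k (by omega) ω hω)) hC
  have e : (Real.sqrt (2 * Real.pi) : ℝ) * (Complex.Gamma (1 + ω))⁻¹ * (k : ℂ) ^ (1 / 2 + ω) *
      Complex.exp (-k * rate θ + corr 0 γ θ + (1 / 2 + ω) * logExpQuot w) =
      ((Real.sqrt (2 * Real.pi * k) * (k / Real.exp 1) ^ k : ℝ) : ℂ) *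
      ((k : ℂ) ^ ω * (Complex.Gamma (1 + ω))⁻¹) * ((w / k) ^ k * Complex.exp Y) := by
    have e1 : Complex.exp (-k * rate θ + corr 0 γ θ + (1 / 2 + ω) * logExpQuot w) =
        Complex.exp (-(k : ℂ)) * w ^ k * Complex.exp Y := by
      have hwk : w ^ k = Complex.exp (k * ((Real.log (Real.log 2) : ℝ) + θ * Complex.I)) := by
        rw [Complex.exp_nat_mul, Complex.exp_add, ← Complex.ofReal_exp, Real.exp_log log_two_pos]
        rfl
      rw [hwk, ← Complex.exp_add, ← Complex.exp_add]
      congr 1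
      rw [hY, rate, corr, ← hw]
      ring
    have e2 : (k : ℂ) ^ (1 / 2 + ω) = (Real.sqrt k : ℝ) * (k : ℂ) ^ ω := by
      rw [Complex.cpow_add _ _ hkC, Real.sqrt_eq_rpow, Complex.ofReal_cpow hk0.le]
      norm_num
    rw [e1, e2, Real.sqrt_mul (x := 2 * Real.pi) (by positivity) (k : ℝ)]
    push_cast
    rw [div_pow, div_pow, ← Complex.exp_nat_mul, mul_one, Complex.exp_neg]
    field_simp
  rw [e]
  exact hall

/-! ### The summands as functions -/

/-- The logarithm of the truncations on disks of radius `O(1/n)`, where these are uniformly close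
to the second Taylor polynomial. -/
theorem IsSubfactorial.log_truncEval_sub_le {f : PowerSeries ℂ} (hf : IsSubfactorial f)
    (hf0 : PowerSeries.constantCoeff f = 1) {c : ℝ} (hc : 0 < c) :
    ∃ C : ℝ, 0 ≤ C ∧ ∃ N : ℕ, 2 ≤ N ∧ ∀ n : ℕ, N ≤ n → ∀ z : ℂ, ‖z‖ ≤ c / n →
      ‖truncEval n f z - 1‖ ≤ 1 / 2 ∧
      ‖Complex.log (truncEval n f z) - (PowerSeries.coeff 1 f * z +
        (PowerSeries.coeff 2 f - PowerSeries.coeff 1 f ^ 2 / 2) * z ^ 2)‖ ≤ C * ‖z‖ ^ 3 := by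
  obtain ⟨C₃, hC₃, h₃⟩ := hf.truncEval_sub_le hc 3
  set a := PowerSeries.coeff 1 f with ha
  set b := PowerSeries.coeff 2 f with hb
  set D₂ := ‖b‖ + C₃ * c with hD₂
  set D := ‖a‖ + D₂ * c with hD
  have hD₂0 : 0 ≤ D₂ := by positivity
  have hD0 : 0 ≤ D := by positivity
  obtain ⟨N, hN⟩ := exists_nat_ge (2 * D * c)
  refine ⟨C₃ + D₂ * (D + ‖a‖) / 2 + 2 * D ^ 3, by positivity, N + 2, by omega, fun n hn z hz => ?_⟩
  have hn1 : (1 : ℝ) ≤ n := by exact_mod_cast (by omega : 1 ≤ n)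
  have hn0 : (0 : ℝ) < n := by linarith
  have hzc : ‖z‖ ≤ c := hz.trans (div_le_self hc.le hn1)
  have hz0 := norm_nonneg z
  set u := truncEval n f z - 1 with hu
  have h3 : ‖u - (a * z + b * z ^ 2)‖ ≤ C₃ * ‖z‖ ^ 3 := by
    have h := h₃ n (by omega) (by omega) z hz
    simp only [Finset.sum_range_succ, Finset.sum_range_zero, PowerSeries.coeff_zero_eq_constantCoeff,
      hf0, pow_zero, pow_one, zero_add, mul_one] at h
    convert h using 2
    rw [hu]; ring
  have h2 : ‖u - a * z‖ ≤ D₂ * ‖z‖ ^ 2 := by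
    have e : u - a * z = (u - (a * z + b * z ^ 2)) + b * z ^ 2 := by ring
    rw [e, hD₂]
    refine (norm_add_le _ _).trans ((add_le_add h3 (norm_mul_le _ _)).trans ?_)
    rw [norm_pow]
    nlinarith [mul_le_mul_of_nonneg_left hzc (mul_nonneg hC₃ (sq_nonneg ‖z‖))]
  have h1 : ‖u‖ ≤ D * ‖z‖ := by
    have e : u = (u - a * z) + a * z := by ring
    rw [e, hD]
    refine (norm_add_le _ _).trans ((add_le_add h2 (norm_mul_le _ _)).trans ?_)
    nlinarith [mul_le_mul_of_nonneg_left hzc (mul_nonneg hD₂0 hz0)]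
  have hu2 : ‖u‖ ≤ 1 / 2 := by
    refine h1.trans ((mul_le_mul_of_nonneg_left hz hD0).trans ?_)
    rw [← mul_div_assoc, div_le_iff₀ hn0]
    have : (N : ℝ) ≤ n := by exact_mod_cast (by omega : N ≤ n)
    linarith
  refine ⟨hu2, ?_⟩
  have hlog : ‖Complex.log (1 + u) - (u - u ^ 2 / 2)‖ ≤ 2 * D ^ 3 * ‖z‖ ^ 3 := by
    have h := Complex.norm_log_sub_logTaylor_le 2 (z := u) (by linarith)
    have e : Complex.logTaylor (2 + 1) u = u - u ^ 2 / 2 := by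
      simp [Complex.logTaylor, Finset.sum_range_succ]
      ring
    rw [e] at h
    have hinv : (1 - ‖u‖)⁻¹ ≤ 2 := by
      rw [inv_le_comm₀ (by linarith) (by norm_num)]; linarith
    have hinv0 : 0 ≤ (1 - ‖u‖)⁻¹ := inv_nonneg.2 (by linarith)
    calc _ ≤ ‖u‖ ^ (2 + 1) * (1 - ‖u‖)⁻¹ / ((2 : ℕ) + 1) := h
      _ ≤ ‖u‖ ^ (2 + 1) * (1 - ‖u‖)⁻¹ / 1 := by gcongr; norm_num
      _ ≤ (D * ‖z‖) ^ 3 * 2 := by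
        rw [div_one]
        gcongr
      _ = _ := by ring
  have hsq : ‖(u - a * z) * (u + a * z) / 2‖ ≤ D₂ * (D + ‖a‖) / 2 * ‖z‖ ^ 3 := by
    rw [norm_div, norm_mul]
    have : ‖u + a * z‖ ≤ (D + ‖a‖) * ‖z‖ := by
      refine (norm_add_le _ _).trans ((add_le_add h1 (norm_mul_le _ _)).trans ?_)
      linarith
    calc _ ≤ (D₂ * ‖z‖ ^ 2) * ((D + ‖a‖) * ‖z‖) / 2 := by
          rw [Complex.norm_ofNat]
          gcongr
      _ = _ := by ring
  have e : Complex.log (truncEval n f z) - (a * z + (b - a ^ 2 / 2) * z ^ 2) =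
      (u - (a * z + b * z ^ 2)) - (u - a * z) * (u + a * z) / 2 +
        (Complex.log (1 + u) - (u - u ^ 2 / 2)) := by
    have : 1 + u = truncEval n f z := by rw [hu]; ring
    rw [this]; ring
  rw [e, add_mul, add_mul]
  exact (norm_add_le _ _).trans (add_le_add ((norm_sub_le _ _).trans (add_le_add h3 hsq)) hlog)

/-- The `k`-th summand with `d` and `e` replaced by their truncations at order `n`. This is a
function of `z` near `0` whose Taylor coefficient of order `n` is that of the summand. -/
noncomputable def summandFun (α : ℕ) (d e : PowerSeries ℂ) (ω₀ ω : ℂ) (n k : ℕ) (z : ℂ) : ℂ :=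
  Complex.exp ((k + ω₀) * Complex.log (truncEval n d z)) *
    ∏ j ∈ Finset.Icc 1 k, (Complex.exp ((j + ω) * Complex.log (truncEval n e z)) - 1) ^ α

theorem isJet_summandFun (α : ℕ) {d e : PowerSeries ℂ} (ω₀ ω : ℂ) (n k : ℕ)
    (hd0 : PowerSeries.constantCoeff d = 1) (he0 : PowerSeries.constantCoeff e = 1) :
    IsJet n (summand α d e ω₀ ω k) (summandFun α d e ω₀ ω n k) :=
  ((isJet_truncEval n d).seriesCpow hd0 _).mul (IsJet.prod _ fun _ _ =>
    (((isJet_truncEval n e).seriesCpow he0 _).sub (isJet_one n)).pow α)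

theorem differentiable_truncEval (n : ℕ) (p : PowerSeries ℂ) : Differentiable ℂ (truncEval n p) := by
  unfold truncEval
  fun_prop

theorem mem_slitPlane_of_norm_sub_one_le {x : ℂ} (h : ‖x - 1‖ ≤ 1 / 2) : x ∈ Complex.slitPlane := by
  have := Complex.mem_slitPlane_of_norm_lt_one (z := x - 1) (by linarith)
  simpa using this

theorem differentiableAt_summandFun {α : ℕ} {d e : PowerSeries ℂ} {ω₀ ω : ℂ} {n k : ℕ} {z : ℂ}
    (hd : ‖truncEval n d z - 1‖ ≤ 1 / 2) (he : ‖truncEval n e z - 1‖ ≤ 1 / 2) :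
    DifferentiableAt ℂ (summandFun α d e ω₀ ω n k) z := by
  have h : ∀ {p : PowerSeries ℂ}, ‖truncEval n p z - 1‖ ≤ 1 / 2 →
      DifferentiableAt ℂ (fun z => Complex.log (truncEval n p z)) z := fun hp =>
    (differentiable_truncEval n _ z).clog (mem_slitPlane_of_norm_sub_one_le hp)
  unfold summandFun
  refine DifferentiableAt.fun_mul ((h hd).const_mul _).cexp ?_
  exact DifferentiableAt.fun_finsetProd fun j _ => ((((h he).const_mul _).cexp).sub_const 1).pow α

/-- The approximation of the `k`-th summand at `z = circlePt θ / (k * e₁)`, without the factor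
`(√(2π) / Γ(1 + ω)) ^ α`. The parameters stand for `δ = d₁ / e₁`, `η = α (e₂ / e₁² - 1 / 2)` and
`β = α (1 / 2 + ω)`. -/
noncomputable def approxFun (α : ℕ) (δ η β : ℂ) (k : ℕ) (θ : ℝ) : ℂ :=
  (k : ℂ) ^ β * Complex.exp (-(α * rate θ * k) + corr δ η θ + β * logExpQuot (circlePt θ))

/-- For `k ≥ η n` the circle through `circlePt θ / (k * e₁)` has radius `O(1/n)`, so that the
truncations may be replaced by their Taylor polynomials: `log (e z)` meets the hypothesis of
`prod_exp_sub_one_asymp`, and the factor with `d` tends to `exp (d₁ w / e₁)`. -/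
theorem summandFun_asymp (α : ℕ) {d e : PowerSeries ℂ} (hd : IsSubfactorial d)
    (he : IsSubfactorial e) (hd0 : PowerSeries.constantCoeff d = 1)
    (he0 : PowerSeries.constantCoeff e = 1) (he1 : PowerSeries.coeff 1 e ≠ 0) (R : ℝ) {η : ℝ}
    (hη : 0 < η) :
    ∃ C : ℝ, 0 ≤ C ∧ ∃ N : ℕ, 1 ≤ N ∧ ∀ n : ℕ, N ≤ n → ∀ k : ℕ, η * n ≤ k →
      ∀ ω₀ ω : ℂ, ‖ω₀‖ ≤ R → ‖ω‖ ≤ R →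
      (∀ z : ℂ, ‖z‖ ≤ Real.log 2 →
        DifferentiableAt ℂ (summandFun α d e ω₀ ω n k) (1 / (k * PowerSeries.coeff 1 e) * z)) ∧
      ∀ θ : ℝ, ‖summandFun α d e ω₀ ω n k (1 / (k * PowerSeries.coeff 1 e) * circlePt θ) -
        ((Real.sqrt (2 * Real.pi) : ℝ) * (Complex.Gamma (1 + ω))⁻¹) ^ α *
          approxFun α (PowerSeries.coeff 1 d / PowerSeries.coeff 1 e)
            (α * (PowerSeries.coeff 2 e / PowerSeries.coeff 1 e ^ 2 - 1 / 2))
            (α * (1 / 2 + ω)) k θ‖ ≤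
        C / k * ‖((Real.sqrt (2 * Real.pi) : ℝ) * (Complex.Gamma (1 + ω))⁻¹) ^ α *
          approxFun α (PowerSeries.coeff 1 d / PowerSeries.coeff 1 e)
            (α * (PowerSeries.coeff 2 e / PowerSeries.coeff 1 e ^ 2 - 1 / 2))
            (α * (1 / 2 + ω)) k θ‖ := by
  set e₁ := PowerSeries.coeff 1 e with hee1
  set e₂ := PowerSeries.coeff 2 e with hee2
  set d₁ := PowerSeries.coeff 1 d with hdd1
  set γ := e₂ / e₁ ^ 2 - 1 / 2 with hγ
  have he1n : 0 < ‖e₁‖ := norm_pos_iff.2 he1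
  set b := 1 / ‖e₁‖ with hb
  have hb0 : 0 < b := by positivity
  have hc0 : 0 < b / η := by positivity
  obtain ⟨Cd, hCd, Nd, hNd, hd'⟩ := hd.log_truncEval_sub_le hd0 hc0
  obtain ⟨Ce, hCe, Ne, hNe, he'⟩ := he.log_truncEval_sub_le he0 hc0
  obtain ⟨C₁, hC₁, K₁, hK₁, h₁⟩ := prod_exp_sub_one_asymp γ R (Ce * b ^ 3)
  obtain ⟨C₂, hC₂, h₂⟩ := norm_pow_sub_pow_le_div hC₁ α
  -- `Q / k²` bounds the error of `log d ≈ d₁ z`, and `P / k` that of `(k + ω₀) log d ≈ d₁ w / e₁`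
  set Q := ‖PowerSeries.coeff 2 d - d₁ ^ 2 / 2‖ * b ^ 2 + Cd * b ^ 3 with hQ
  have hQ0 : 0 ≤ Q := by positivity
  set P := Q + |R| * (‖d₁‖ * b + Q) with hP
  have hP0 : 0 ≤ P := by positivity
  obtain ⟨N₁, hN₁⟩ := exists_nat_ge ((K₁ + P) / η)
  refine ⟨2 * P + C₂ + 2 * P * C₂, by positivity, Nd + Ne + N₁, by omega,
    fun n hn k hk ω₀ ω hω₀ hω => ?_⟩
  have hn1 : (1 : ℝ) ≤ n := by exact_mod_cast (by omega : 1 ≤ n)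
  have hn0 : (0 : ℝ) < n := by linarith
  have hkP : K₁ + P ≤ k := by
    refine le_trans ?_ hk
    rw [div_le_iff₀ hη] at hN₁
    have : (N₁ : ℝ) ≤ n := by exact_mod_cast (by omega : N₁ ≤ n)
    nlinarith
  have hkK : K₁ ≤ k := by exact_mod_cast (by linarith : (K₁ : ℝ) ≤ k)
  have hk1 : (1 : ℝ) ≤ k := by exact_mod_cast hK₁.trans hkK
  have hk0 : (0 : ℝ) < k := by linarith
  have hkC : (k : ℂ) ≠ 0 := by exact_mod_cast hk0.ne'
  have hz : ∀ w : ℂ, ‖w‖ ≤ Real.log 2 → ‖1 / (k * e₁) * w‖ ≤ b / k := fun w hw => by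
    rw [norm_mul, norm_div, norm_one, norm_mul, Complex.norm_natCast]
    calc 1 / (k * ‖e₁‖) * ‖w‖ ≤ 1 / (k * ‖e₁‖) * 1 := by
          gcongr
          exact hw.trans log_two_lt_one.le
      _ = b / k := by rw [hb]; field_simp
  have hzn : b / k ≤ b / η / n := by
    rw [div_div b η]
    exact div_le_div_of_nonneg_left hb0.le (by positivity) hk
  refine ⟨fun w hw => ?_, fun θ => ?_⟩
  · exact differentiableAt_summandFun (hd' n (by omega) _ ((hz w hw).trans hzn)).1
      (he' n (by omega) _ ((hz w hw).trans hzn)).1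
  set w := circlePt θ with hw
  set z := 1 / (k * e₁) * w with hzdef
  have hzb : ‖z‖ ≤ b / k := hz w (norm_circlePt θ).le
  have hld := (hd' n (by omega) z (hzb.trans hzn)).2
  have hle := (he' n (by omega) z (hzb.trans hzn)).2
  set τ := Complex.log (truncEval n e z) with hτ
  set σ := Complex.log (truncEval n d z) with hσ
  -- the factor with `e`
  have hkτ : ‖k * τ - w - γ * w ^ 2 / k‖ ≤ Ce * b ^ 3 / k ^ 2 := by
    have e : k * τ - w - γ * w ^ 2 / k = k * (τ - (e₁ * z + (e₂ - e₁ ^ 2 / 2) * z ^ 2)) := by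
      rw [hzdef, hγ]
      field_simp
      ring
    rw [e, norm_mul, Complex.norm_natCast]
    calc k * ‖τ - (e₁ * z + (e₂ - e₁ ^ 2 / 2) * z ^ 2)‖ ≤ k * (Ce * (b / k) ^ 3) := by
          refine mul_le_mul_of_nonneg_left (hle.trans ?_) hk0.le
          gcongr
      _ = _ := by field_simp
  have hprod := h₂ _ _ k hk1 (h₁ k hkK θ τ hkτ ω hω)
  -- the factor with `d`
  have hσ2 : ‖σ - d₁ * z‖ ≤ Q / k ^ 2 := by
    have e : σ - d₁ * z = (σ - (d₁ * z + (PowerSeries.coeff 2 d - d₁ ^ 2 / 2) * z ^ 2)) +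
      (PowerSeries.coeff 2 d - d₁ ^ 2 / 2) * z ^ 2 := by ring
    rw [e]
    refine (norm_add_le _ _).trans ((add_le_add hld (norm_mul_le _ _)).trans ?_)
    rw [norm_pow]
    calc Cd * ‖z‖ ^ 3 + ‖PowerSeries.coeff 2 d - d₁ ^ 2 / 2‖ * ‖z‖ ^ 2
        ≤ Cd * (b / k) ^ 3 + ‖PowerSeries.coeff 2 d - d₁ ^ 2 / 2‖ * (b / k) ^ 2 := by gcongr
      _ = Cd * b ^ 3 / k ^ 3 + ‖PowerSeries.coeff 2 d - d₁ ^ 2 / 2‖ * b ^ 2 / k ^ 2 := by ring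
      _ ≤ Cd * b ^ 3 / k ^ 2 + ‖PowerSeries.coeff 2 d - d₁ ^ 2 / 2‖ * b ^ 2 / k ^ 2 := by
          gcongr
          · norm_num
      _ = Q / k ^ 2 := by rw [hQ]; ring
  have hσ1 : ‖σ‖ ≤ (‖d₁‖ * b + Q) / k := by
    have e : σ = d₁ * z + (σ - d₁ * z) := by ring
    rw [e, add_div]
    refine (norm_add_le _ _).trans (add_le_add ?_ (hσ2.trans ?_))
    · rw [norm_mul, mul_div_assoc]; gcongr
    · gcongr
      nlinarith
  have hexpd : ‖(k + ω₀) * σ - d₁ / e₁ * w‖ ≤ P / k := by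
    have e : (k + ω₀) * σ - d₁ / e₁ * w = k * (σ - d₁ * z) + ω₀ * σ := by
      rw [hzdef]; field_simp; ring
    rw [e, hP, add_div, mul_div_assoc]
    refine (norm_add_le _ _).trans (add_le_add ?_ ?_)
    · rw [norm_mul, Complex.norm_natCast]
      calc k * ‖σ - d₁ * z‖ ≤ k * (Q / k ^ 2) := by gcongr
        _ = Q / k := by field_simp
    · rw [norm_mul]
      exact mul_le_mul (hω₀.trans (le_abs_self _)) hσ1 (norm_nonneg _) (abs_nonneg _)
  have hfd : ‖Complex.exp ((k + ω₀) * σ) - Complex.exp (d₁ / e₁ * w)‖ ≤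
      2 * P / k * ‖Complex.exp (d₁ / e₁ * w)‖ := by
    rw [mul_div_assoc]
    refine norm_exp_sub_exp_le ?_ hexpd
    rw [div_le_one hk0]
    have : (0 : ℝ) ≤ K₁ := by positivity
    linarith
  have hall := norm_mul_sub_mul_le_div (by positivity) hC₂ hk1 hfd hprod
  have hf : summandFun α d e ω₀ ω n k z = Complex.exp ((k + ω₀) * σ) *
      (∏ j ∈ Finset.Icc 1 k, (Complex.exp (((j : ℂ) + ω) * τ) - 1)) ^ α := by
    rw [summandFun, Finset.prod_pow]
  have hg : ((Real.sqrt (2 * Real.pi) : ℝ) * (Complex.Gamma (1 + ω))⁻¹) ^ α *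
      approxFun α (d₁ / e₁) (α * γ) (α * (1 / 2 + ω)) k θ = Complex.exp (d₁ / e₁ * w) *
      ((Real.sqrt (2 * Real.pi) : ℝ) * (Complex.Gamma (1 + ω))⁻¹ * (k : ℂ) ^ (1 / 2 + ω) *
        Complex.exp (-k * rate θ + corr 0 γ θ + (1 / 2 + ω) * logExpQuot (circlePt θ))) ^ α := by
    have hE : Complex.exp (-(α * rate θ * k) + corr (d₁ / e₁) (α * γ) θ +
        α * (1 / 2 + ω) * logExpQuot (circlePt θ)) = Complex.exp (d₁ / e₁ * w) *
        Complex.exp (-k * rate θ + corr 0 γ θ + (1 / 2 + ω) * logExpQuot (circlePt θ)) ^ α := by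
      rw [← Complex.exp_nat_mul, ← Complex.exp_add, corr, corr, ← hw]
      congr 1
      ring
    rw [approxFun, hE, Complex.cpow_nat_mul]
    ring
  rw [hf, hg]
  exact hall

/-! ### Scales -/

theorem realGamma_nat_add_le (M : ℝ) :
    ∃ C : ℝ, 0 ≤ C ∧ ∃ N : ℕ, 1 ≤ N ∧ ∀ n : ℕ, N ≤ n → ∀ a : ℝ, |a| ≤ M →
      Real.Gamma (n + 1 + a) ≤ C * (n.factorial * (n : ℝ) ^ a) := by
  obtain ⟨C, hC, N, hN, h⟩ := gamma_nat_add_asymp M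
  refine ⟨C + 1, by positivity, N, hN, fun n hn a ha => ?_⟩
  have hn1 : (1 : ℝ) ≤ n := by exact_mod_cast hN.trans hn
  have h1 := h n hn (a : ℂ) (by rwa [Complex.norm_real])
  have e1 : Complex.Gamma (n + 1 + (a : ℂ)) = ((Real.Gamma (n + 1 + a) : ℝ) : ℂ) := by
    rw [← Complex.Gamma_ofReal]; push_cast; rfl
  have e2 : (n.factorial : ℂ) * (n : ℂ) ^ (a : ℂ) = ((n.factorial * (n : ℝ) ^ a : ℝ) : ℂ) := by
    rw [Complex.ofReal_mul, Complex.ofReal_cpow (by linarith)]; push_cast; rfl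
  rw [e1, e2, ← Complex.ofReal_sub, Complex.norm_real, Complex.norm_real, Real.norm_eq_abs,
    Real.norm_of_nonneg (by positivity)] at h1
  have h2 := (le_abs_self _).trans h1
  have h3 : C / n ≤ C := div_le_self hC hn1
  have h4 : 0 ≤ n.factorial * (n : ℝ) ^ a := by positivity
  nlinarith

/-- The sum is of the order of the Gamma integral `Γ(n + a + 1) μ ^ (-(n + a + 1))`. -/
theorem tsum_rpow_mul_exp_le {μ : ℝ} (hμ : 0 < μ) (M : ℝ) :
    ∃ C : ℝ, 0 ≤ C ∧ ∃ N : ℕ, 1 ≤ N ∧ ∀ n : ℕ, N ≤ n → ∀ a : ℝ, |a| ≤ M →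
      (Summable fun k : ℕ => (k : ℝ) ^ (n + a) * Real.exp (-(μ * k))) ∧
      ∑' k : ℕ, (k : ℝ) ^ (n + a) * Real.exp (-(μ * k)) ≤
        C * (n.factorial * (n : ℝ) ^ a * (μ⁻¹) ^ n) := by
  obtain ⟨C, hC, N, hN, h⟩ := realGamma_nat_add_le M
  obtain ⟨N', hN'⟩ := exists_nat_ge (M + 3)
  -- `B` bounds `μ ^ (-(1 + a))` whether `μ` is larger or smaller than `1`
  set B := max (μ ^ (-(1 + M))) (μ ^ (-(1 - M))) with hB
  refine ⟨(1 + μ ^ 2) * B * C, by positivity, N + N', by omega, fun n hn a ha => ?_⟩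
  have ha' := abs_le.1 ha
  have hn3 : 3 ≤ n + a := by
    have : (N' : ℝ) ≤ n := by exact_mod_cast (by omega : N' ≤ n)
    linarith
  have hterm : ∀ k : ℕ, (((k : ℝ) ^ (n + a) * Real.exp (-(μ * k)) : ℝ) : ℂ) =
      (k : ℂ) ^ ((n + a : ℝ) : ℂ) * Complex.exp (-((μ : ℂ) * k)) := fun k => by
    rw [Complex.ofReal_mul, Complex.ofReal_cpow (by positivity)]
    push_cast
    rfl
  have hs := summable_cpow_mul_exp (s := ((n + a : ℝ) : ℂ)) (lam := (μ : ℂ)) (by simpa using hμ)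
  have hsum : Summable fun k : ℕ => (k : ℝ) ^ (n + a) * Real.exp (-(μ * k)) := by
    rw [← Complex.summable_ofReal]
    simpa only [hterm] using hs
  refine ⟨hsum, ?_⟩
  have hb := norm_tsum_cpow_mul_exp_sub_le (s := ((n + a : ℝ) : ℂ)) (lam := (μ : ℂ)) (M := 0)
    (by simpa using hn3) (by simp) (by simpa using hμ)
  simp only [← hterm] at hb
  rw [← Complex.ofReal_tsum] at hb
  have e : (μ : ℂ) ^ (-(((n + a : ℝ) : ℂ) + 1)) * Complex.Gamma (((n + a : ℝ) : ℂ) + 1) =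
      ((μ ^ (-(n + a + 1)) * Real.Gamma (n + a + 1) : ℝ) : ℂ) := by
    rw [Complex.ofReal_mul, Complex.ofReal_cpow hμ.le, ← Complex.Gamma_ofReal]
    push_cast
    rfl
  rw [e, ← Complex.ofReal_sub, Complex.norm_real, Real.norm_eq_abs] at hb
  simp only [Complex.ofReal_re, Complex.ofReal_im] at hb
  set G := μ ^ (-(n + a + 1)) * Real.Gamma (n + a + 1) with hG
  have hG0 : 0 ≤ G := mul_nonneg (by positivity) (Real.Gamma_pos_of_pos (by linarith)).le
  have h1 : (μ ^ 2 * (3 + 4 * 0 ^ 2 + 0) / (n + a) + 0 ^ 2) ≤ μ ^ 2 := by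
    have : μ ^ 2 * (3 + 4 * 0 ^ 2 + 0) / (n + a) ≤ μ ^ 2 := by
      rw [div_le_iff₀ (by linarith)]
      nlinarith [sq_nonneg μ]
    linarith
  have h2 := (le_abs_self _).trans (hb.trans (mul_le_mul_of_nonneg_right h1 hG0))
  have h3 : G ≤ B * (μ⁻¹) ^ n * (C * (n.factorial * (n : ℝ) ^ a)) := by
    rw [hG]
    have e3 : μ ^ (-(n + a + 1)) = μ ^ (-(1 + a)) * (μ⁻¹) ^ n := by
      rw [← Real.rpow_natCast, Real.inv_rpow hμ.le, ← Real.rpow_neg hμ.le, ← Real.rpow_add hμ]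
      congr 1; ring
    have e4 : Real.Gamma (n + a + 1) = Real.Gamma (n + 1 + a) := by congr 1; ring
    rw [e3, e4]
    have h5 := h n (by omega) a ha
    have h6 : μ ^ (-(1 + a)) ≤ B := by
      rcases le_total 1 μ with h1 | h1
      · exact (Real.rpow_le_rpow_of_exponent_le h1 (by linarith)).trans (le_max_right _ _)
      · exact (Real.rpow_le_rpow_of_exponent_ge hμ h1 (by linarith)).trans (le_max_left _ _)
    have h7 : 0 ≤ Real.Gamma (n + 1 + a) := (Real.Gamma_pos_of_pos (by linarith)).le
    gcongr
  calc _ ≤ (1 + μ ^ 2) * G := by linarith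
    _ ≤ (1 + μ ^ 2) * (B * (μ⁻¹) ^ n * (C * (n.factorial * (n : ℝ) ^ a))) := by gcongr
    _ = _ := by ring

theorem norm_growthScale (α : ℕ) (e : PowerSeries ℂ) (ω : ℂ) {n : ℕ} (hn : 1 ≤ n) :
    ‖growthScale α e ω n‖ = (‖PowerSeries.coeff 1 e‖ * (12 / (α * Real.pi ^ 2))) ^ n *
      (n / Real.exp 1) ^ n * (n : ℝ) ^ (α * (1 / 2 + ω)).re := by
  have hn0 : (0 : ℝ) < n := by exact_mod_cast hn
  rw [growthScale, norm_mul, norm_pow, rhoConst, norm_div, norm_mul, norm_mul, norm_mul, norm_pow,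
    Complex.norm_natCast, Complex.norm_real, Complex.norm_ofNat, Complex.norm_exp,
    Complex.norm_natCast_cpow_of_pos hn, Complex.add_re, Complex.natCast_re, Real.rpow_add hn0,
    Real.rpow_natCast, Real.norm_of_nonneg Real.pi_pos.le, ← mul_assoc, ← mul_pow, ← mul_pow]
  congr 2
  rw [Complex.one_re]
  field_simp

theorem factorial_le_stirling :
    ∃ C : ℝ, 0 ≤ C ∧ ∃ N : ℕ, 1 ≤ N ∧ ∀ n : ℕ, N ≤ n →
      (n.factorial : ℝ) ≤ C * (Real.sqrt n * (n / Real.exp 1) ^ n) := by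
  obtain ⟨C, hC, N, hN, h⟩ := factorial_asymp
  refine ⟨(1 + C) * Real.sqrt (2 * Real.pi), by positivity, N, hN, fun n hn => ?_⟩
  have hn1 : (1 : ℝ) ≤ n := by exact_mod_cast hN.trans hn
  have h1 := (le_abs_self _).trans (h n hn)
  have h3 : C / n ≤ C := div_le_self hC hn1
  rw [Real.sqrt_mul (x := 2 * Real.pi) (by positivity) (n : ℝ)] at h1
  have h4 : 0 ≤ Real.sqrt (2 * Real.pi) * Real.sqrt n * (n / Real.exp 1) ^ n := by positivity
  nlinarith

/-- The minimum `α * rate 0` over the circle of the real part of `α * rate θ`; the `k`-th summand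
decays like `exp (-k * decay α)`. -/
noncomputable def decay (α : ℕ) : ℝ := α * (Real.pi ^ 2 / (12 * Real.log 2))

theorem decay_pos {α : ℕ} (hα : 1 ≤ α) : 0 < decay α :=
  mul_pos (by exact_mod_cast hα) rateZero_pos

/-- The size of the accumulated errors compared with the growth scale: the product of `log 2` and
`decay α` is `α π² / 12`, and `n!` exceeds `(n / exp 1) ^ n` by a factor of order `√n`. -/
theorem errorScale_le {α : ℕ} (hα : 1 ≤ α) (e : PowerSeries ℂ) :
    ∃ C : ℝ, 0 ≤ C ∧ ∃ N : ℕ, 1 ≤ N ∧ ∀ n : ℕ, N ≤ n → ∀ ω : ℂ,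
      (‖PowerSeries.coeff 1 e‖ / Real.log 2) ^ n * (n.factorial *
        (n : ℝ) ^ ((α * (1 / 2 + ω)).re - 3 / 2) * ((decay α)⁻¹) ^ n) ≤
      C / n * ‖growthScale α e ω n‖ := by
  obtain ⟨C, hC, N, hN, h⟩ := factorial_le_stirling
  refine ⟨C, hC, N, hN, fun n hn ω => ?_⟩
  have hn1 : 1 ≤ n := hN.trans hn
  have hn0 : (0 : ℝ) < n := by exact_mod_cast hn1
  have hα0 : (0 : ℝ) < α := by exact_mod_cast hα
  have hl := log_two_pos
  rw [norm_growthScale α e ω hn1]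
  set σ := (α * (1 / 2 + ω)).re
  have e1 : (‖PowerSeries.coeff 1 e‖ / Real.log 2) ^ n * ((decay α)⁻¹) ^ n =
      (‖PowerSeries.coeff 1 e‖ * (12 / (α * Real.pi ^ 2))) ^ n := by
    rw [← mul_pow, decay]
    congr 1
    field_simp
  have e2 : Real.sqrt n * (n : ℝ) ^ (σ - 3 / 2) = (n : ℝ) ^ σ / n := by
    rw [Real.sqrt_eq_rpow, ← Real.rpow_add hn0]
    nth_rewrite 3 [← Real.rpow_one (n : ℝ)]
    rw [← Real.rpow_sub hn0]
    congr 1; ring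
  calc _ = (‖PowerSeries.coeff 1 e‖ / Real.log 2) ^ n * ((decay α)⁻¹) ^ n *
        (n : ℝ) ^ (σ - 3 / 2) * n.factorial := by ring
    _ ≤ (‖PowerSeries.coeff 1 e‖ / Real.log 2) ^ n * ((decay α)⁻¹) ^ n *
        (n : ℝ) ^ (σ - 3 / 2) * (C * (Real.sqrt n * (n / Real.exp 1) ^ n)) := by
        have := decay_pos hα
        gcongr
        exact h n hn
    _ = (‖PowerSeries.coeff 1 e‖ / Real.log 2) ^ n * ((decay α)⁻¹) ^ n *
        (Real.sqrt n * (n : ℝ) ^ (σ - 3 / 2)) * (C * (n / Real.exp 1) ^ n) := by ring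
    _ = _ := by rw [e1, e2]; ring

/-! ### The approximation of the coefficients -/

theorem continuous_rate : Continuous fun θ : ℝ => rate θ :=
  continuous_ofReal_of_analyticAt analyticAt_rate

theorem continuous_corr (δ η : ℂ) : Continuous fun θ : ℝ => corr δ η θ :=
  continuous_ofReal_of_analyticAt (analyticAt_corr δ η)

theorem continuous_logExpQuot_circlePt : Continuous fun θ : ℝ => logExpQuot (circlePt θ) :=
  continuous_ofReal_of_analyticAt analyticAt_logExpQuot_circlePt

theorem continuous_circlePt : Continuous fun θ : ℝ => circlePt θ :=
  continuous_ofReal_of_analyticAt analyticAt_circlePt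

theorem continuous_approxFun (α : ℕ) (δ η β : ℂ) (k : ℕ) :
    Continuous (approxFun α δ η β k) := by
  unfold approxFun
  have := continuous_rate
  have := continuous_corr δ η
  have := continuous_logExpQuot_circlePt
  fun_prop

/-- A bound for the factor of the integrand that does not depend on `k`, uniformly in `β`. -/
theorem norm_exp_corr_le (δ η : ℂ) (M : ℝ) :
    ∃ B : ℝ, 0 < B ∧ ∀ θ : ℝ, |θ| ≤ Real.pi → ∀ β : ℂ, ‖β‖ ≤ M →
      ‖Complex.exp (corr δ η θ + β * logExpQuot (circlePt θ))‖ ≤ B := by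
  obtain ⟨B₁, hB₁⟩ := (isCompact_Icc (a := -Real.pi) (b := Real.pi)).exists_bound_of_continuousOn
    (continuous_corr δ η).continuousOn
  obtain ⟨B₂, hB₂⟩ := (isCompact_Icc (a := -Real.pi) (b := Real.pi)).exists_bound_of_continuousOn
    continuous_logExpQuot_circlePt.continuousOn
  refine ⟨Real.exp (B₁ + M * B₂), Real.exp_pos _, fun θ hθ β hβ => ?_⟩
  have hm : θ ∈ Set.Icc (-Real.pi) Real.pi := abs_le.1 hθ
  rw [Complex.norm_exp]
  refine Real.exp_le_exp.2 ((Complex.re_le_norm _).trans ((norm_add_le _ _).trans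
    (add_le_add (hB₁ θ hm) ?_)))
  rw [norm_mul]
  exact mul_le_mul hβ (hB₂ θ hm) (norm_nonneg _) ((norm_nonneg _).trans hβ)

theorem norm_approxFun_le {α : ℕ} (hα : 1 ≤ α) (δ η : ℂ) (M : ℝ) :
    ∃ B : ℝ, 0 < B ∧ ∃ c : ℝ, 0 < c ∧ ∀ k : ℕ, 1 ≤ k → ∀ β : ℂ, ‖β‖ ≤ M → ∀ θ : ℝ,
      |θ| ≤ Real.pi → ‖approxFun α δ η β k θ‖ ≤
        B * ((k : ℝ) ^ β.re * Real.exp (-(decay α * k))) * Real.exp (-(c * k) * θ ^ 2) := by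
  obtain ⟨B, hB, h⟩ := norm_exp_corr_le δ η M
  have hα0 : (0 : ℝ) < α := by exact_mod_cast hα
  have hl := log_two_pos
  refine ⟨B, hB, α * (Real.log 2 / (2 * Real.pi ^ 2)), by positivity,
    fun k hk β hβ θ hθ => ?_⟩
  have hk0 : (0 : ℝ) < k := by exact_mod_cast hk
  rw [approxFun, add_assoc, Complex.exp_add, norm_mul, norm_mul,
    Complex.norm_natCast_cpow_of_pos hk, Complex.norm_exp (-(_ * _ * _))]
  have h1 := h θ hθ β hβ
  have h2 : Real.exp (-(α * rate θ * k) : ℂ).re ≤ Real.exp (-(decay α * k)) *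
      Real.exp (-(α * (Real.log 2 / (2 * Real.pi ^ 2)) * k) * θ ^ 2) := by
    rw [← Real.exp_add, Real.exp_le_exp]
    have e : (-(α * rate θ * k) : ℂ).re = -(α * (rate θ).re * k) := by simp
    rw [e, decay]
    have := mul_le_mul_of_nonneg_left (rate_re_ge_quadratic hθ) (mul_nonneg hα0.le hk0.le)
    linarith
  calc _ ≤ (k : ℝ) ^ β.re * ((Real.exp (-(decay α * k)) *
      Real.exp (-(α * (Real.log 2 / (2 * Real.pi ^ 2)) * k) * θ ^ 2)) * B) := by gcongr
    _ = _ := by ring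

/-- The Gaussian decay in `θ` gains a factor `k ^ (-1/2)`. -/
theorem integral_norm_approxFun_le {α : ℕ} (hα : 1 ≤ α) (δ η : ℂ) (M : ℝ) :
    ∃ B : ℝ, 0 ≤ B ∧ ∀ k : ℕ, 1 ≤ k → ∀ β : ℂ, ‖β‖ ≤ M →
      ∫ θ in (-Real.pi)..Real.pi, ‖approxFun α δ η β k θ‖ ≤
        B * ((k : ℝ) ^ (β.re - 1 / 2) * Real.exp (-(decay α * k))) := by
  obtain ⟨B, hB, c, hc, h⟩ := norm_approxFun_le hα δ η M
  refine ⟨B * Real.sqrt (Real.pi / c), by positivity, fun k hk β hβ => ?_⟩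
  have hk0 : (0 : ℝ) < k := by exact_mod_cast hk
  have hpi := Real.pi_pos
  have h1 : ∫ θ in (-Real.pi)..Real.pi, ‖approxFun α δ η β k θ‖ ≤
      ∫ θ in (-Real.pi)..Real.pi, B * ((k : ℝ) ^ β.re * Real.exp (-(decay α * k))) *
        Real.exp (-(c * k) * θ ^ 2) := by
    refine intervalIntegral.integral_mono_on (by linarith)
      ((continuous_approxFun α δ η β k).norm.intervalIntegrable _ _) ?_ fun θ hθ =>
      h k hk β hβ θ (abs_le.2 hθ)
    exact (by fun_prop : Continuous fun θ : ℝ => B * ((k : ℝ) ^ β.re * Real.exp (-(decay α * k))) *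
        Real.exp (-(c * k) * θ ^ 2)).intervalIntegrable _ _
  rw [intervalIntegral.integral_const_mul] at h1
  refine h1.trans ?_
  have h2 := integral_exp_neg_sq_le (b := c * k) (by positivity) Real.pi hpi.le
  have e : Real.sqrt (Real.pi / (c * k)) = Real.sqrt (Real.pi / c) * (k : ℝ) ^ (-(1 / 2) : ℝ) := by
    rw [← div_div, Real.sqrt_div (by positivity), Real.rpow_neg hk0.le, ← Real.sqrt_eq_rpow,
      div_eq_mul_inv]
  have e2 : (k : ℝ) ^ (β.re - 1 / 2) = (k : ℝ) ^ β.re * (k : ℝ) ^ (-(1 / 2) : ℝ) := by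
    rw [← Real.rpow_add hk0]; rfl
  calc _ ≤ B * ((k : ℝ) ^ β.re * Real.exp (-(decay α * k))) * Real.sqrt (Real.pi / (c * k)) := by
        gcongr
    _ = _ := by rw [e, e2]; ring

/-- The approximation of `2 π` times the coefficient of the `k`-th summand, up to the factor
`e₁ ^ n (√(2π) / Γ(1 + ω)) ^ α`. -/
noncomputable def approxCoeff (α : ℕ) (δ η β : ℂ) (n k : ℕ) : ℂ :=
  ∫ θ in (-Real.pi)..Real.pi, (k : ℂ) ^ n * approxFun α δ η β k θ * circlePt θ ^ (-(n : ℤ))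

/-- A crude bound that suffices for small `k`. -/
theorem norm_approxCoeff_le {α : ℕ} (hα : 1 ≤ α) (δ η : ℂ) (M : ℝ) :
    ∃ B : ℝ, 0 ≤ B ∧ ∀ n k : ℕ, 1 ≤ k → ∀ β : ℂ, ‖β‖ ≤ M →
      ‖approxCoeff α δ η β n k‖ ≤ B * ((k : ℝ) ^ n * (k : ℝ) ^ β.re) * (Real.log 2)⁻¹ ^ n := by
  obtain ⟨B, hB, h⟩ := integral_norm_approxFun_le hα δ η M
  refine ⟨B, hB, fun n k hk β hβ => ?_⟩
  have hk0 : (0 : ℝ) < k := by exact_mod_cast hk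
  have hk1 : (1 : ℝ) ≤ k := by exact_mod_cast hk
  have hpi := Real.pi_pos
  have hl := log_two_pos
  rw [approxCoeff]
  refine (intervalIntegral.norm_integral_le_integral_norm (by linarith)).trans ?_
  have e : ∀ θ : ℝ, ‖(k : ℂ) ^ n * approxFun α δ η β k θ * circlePt θ ^ (-(n : ℤ))‖ =
      (k : ℝ) ^ n * (Real.log 2)⁻¹ ^ n * ‖approxFun α δ η β k θ‖ := fun θ => by
    rw [norm_mul, norm_mul, norm_zpow, norm_circlePt, norm_pow, Complex.norm_natCast, zpow_neg,
      zpow_natCast, inv_pow]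
    ring
  simp only [e]
  rw [intervalIntegral.integral_const_mul]
  have h1 : (k : ℝ) ^ (β.re - 1 / 2) ≤ (k : ℝ) ^ β.re :=
    Real.rpow_le_rpow_of_exponent_le hk1 (by linarith)
  have h2 : Real.exp (-(decay α * k)) ≤ 1 := by
    rw [Real.exp_le_one_iff]
    have := mul_pos (decay_pos hα) hk0
    linarith
  calc _ ≤ (k : ℝ) ^ n * (Real.log 2)⁻¹ ^ n * (B * ((k : ℝ) ^ β.re * 1)) := by
        refine mul_le_mul_of_nonneg_left ((h k hk β hβ).trans ?_) (by positivity)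
        gcongr
    _ = _ := by ring

/-- The factor `(√(2π) / Γ(1 + ω)) ^ α` of the approximation. -/
noncomputable def gammaFactor (α : ℕ) (ω : ℂ) : ℂ :=
  ((Real.sqrt (2 * Real.pi) : ℝ) * (Complex.Gamma (1 + ω))⁻¹) ^ α

theorem continuous_inv_gamma_one_add : Continuous fun ω : ℂ => (Complex.Gamma (1 + ω))⁻¹ :=
  Complex.differentiable_one_div_Gamma.continuous.comp (continuous_const.add continuous_id)

theorem norm_gammaFactor_le (α : ℕ) (R : ℝ) :
    ∃ B : ℝ, 0 ≤ B ∧ ∀ ω : ℂ, ‖ω‖ ≤ R → ‖gammaFactor α ω‖ ≤ B := by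
  have hc : Continuous (gammaFactor α) := by
    have := continuous_inv_gamma_one_add
    unfold gammaFactor
    fun_prop
  obtain ⟨B, hB⟩ := (isCompact_closedBall (0 : ℂ) R).exists_bound_of_continuousOn hc.continuousOn
  exact ⟨|B|, abs_nonneg _, fun ω hω => (hB ω (by simpa using hω)).trans (le_abs_self _)⟩

theorem norm_mul_half_add_le (α : ℕ) {R : ℝ} {ω : ℂ} (hω : ‖ω‖ ≤ R) :
    ‖(α : ℂ) * (1 / 2 + ω)‖ ≤ α * (1 + R) := by
  rw [norm_mul, Complex.norm_natCast]
  gcongr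
  refine (norm_add_le _ _).trans (add_le_add ?_ hω)
  norm_num

/-- The error for `k ≥ η n`. Of the exponent `-3/2`, a part `-1` is the relative error of the
summand and `-1/2` comes from the integration over `θ`. -/
theorem coeff_summand_sub_approxCoeff_le {α : ℕ} (hα : 1 ≤ α) {d e : PowerSeries ℂ}
    (hd : IsSubfactorial d) (he : IsSubfactorial e) (hd0 : PowerSeries.constantCoeff d = 1)
    (he0 : PowerSeries.constantCoeff e = 1) (he1 : PowerSeries.coeff 1 e ≠ 0) (R : ℝ) {η : ℝ}
    (hη : 0 < η) :
    ∃ C : ℝ, 0 ≤ C ∧ ∃ N : ℕ, 1 ≤ N ∧ ∀ n : ℕ, N ≤ n → ∀ k : ℕ, η * n ≤ k →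
      ∀ ω₀ ω : ℂ, ‖ω₀‖ ≤ R → ‖ω‖ ≤ R →
        ‖2 * Real.pi * PowerSeries.coeff n (summand α d e ω₀ ω k) -
          PowerSeries.coeff 1 e ^ n * gammaFactor α ω *
            approxCoeff α (PowerSeries.coeff 1 d / PowerSeries.coeff 1 e)
              (α * (PowerSeries.coeff 2 e / PowerSeries.coeff 1 e ^ 2 - 1 / 2))
              (α * (1 / 2 + ω)) n k‖ ≤
          C * (‖PowerSeries.coeff 1 e‖ / Real.log 2) ^ n *
            ((k : ℝ) ^ (n + ((α * (1 / 2 + ω)).re - 3 / 2)) * Real.exp (-(decay α * k))) := by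
  obtain ⟨C, hC, N, hN, h⟩ := summandFun_asymp α hd he hd0 he0 he1 R hη
  set e₁ := PowerSeries.coeff 1 e with hee1
  set δ := PowerSeries.coeff 1 d / e₁ with hδ
  set γ := α * (PowerSeries.coeff 2 e / e₁ ^ 2 - 1 / 2) with hγ
  obtain ⟨B, hB, hB'⟩ := integral_norm_approxFun_le hα δ γ (α * (1 + R))
  obtain ⟨G, hG, hG'⟩ := norm_gammaFactor_le α R
  refine ⟨C * G * B, by positivity, N, hN, fun n hn k hk ω₀ ω hω₀ hω => ?_⟩
  obtain ⟨hdiff, hasym⟩ := h n hn k hk ω₀ ω hω₀ hω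
  set β := (α : ℂ) * (1 / 2 + ω) with hβ
  have hn0 : (0 : ℝ) < n := by exact_mod_cast hN.trans hn
  have hk0 : (0 : ℝ) < k := lt_of_lt_of_le (by positivity) hk
  have hk1 : 1 ≤ k := by exact_mod_cast hk0
  have hkC : (k : ℂ) ≠ 0 := by exact_mod_cast hk0.ne'
  have hpi := Real.pi_pos
  have hl := log_two_pos
  set F := summandFun α d e ω₀ ω n k with hF
  set a : ℂ := 1 / (k * e₁) with ha
  have hcau := (isJet_summandFun α ω₀ ω n k hd0 he0).coeff_mul_pow_eq_integral a hl
    (fun z hz => hdiff z hz)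
  have hcont : Continuous fun θ : ℝ => F (a * circlePt θ) * circlePt θ ^ (-(n : ℤ)) := by
    refine Continuous.mul (continuous_iff_continuousAt.2 fun θ => ?_)
      (continuous_circlePt.zpow₀ _ fun θ => Or.inl (circlePt_ne_zero _))
    exact ContinuousAt.comp (f := fun θ : ℝ => a * circlePt θ)
      (hdiff _ (norm_circlePt θ).le).continuousAt
      (continuous_const.mul continuous_circlePt).continuousAt
  have hcont2 : Continuous fun θ : ℝ => gammaFactor α ω * approxFun α δ γ β k θ *
      circlePt θ ^ (-(n : ℤ)) :=
    (continuous_const.mul (continuous_approxFun α δ γ β k)).mul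
      (continuous_circlePt.zpow₀ _ fun θ => Or.inl (circlePt_ne_zero _))
  have e1 : 2 * Real.pi * PowerSeries.coeff n (summand α d e ω₀ ω k) -
      e₁ ^ n * gammaFactor α ω * approxCoeff α δ γ β n k = (k * e₁) ^ n *
      ∫ θ in (-Real.pi)..Real.pi, (F (a * circlePt θ) * circlePt θ ^ (-(n : ℤ)) -
        gammaFactor α ω * approxFun α δ γ β k θ * circlePt θ ^ (-(n : ℤ))) := by
    rw [intervalIntegral.integral_sub (hcont.intervalIntegrable _ _)
      (hcont2.intervalIntegrable _ _), mul_sub]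
    congr 1
    · have : ∫ θ in (-Real.pi)..Real.pi, F (a * circlePt θ) * circlePt θ ^ (-(n : ℤ)) =
          2 * Real.pi * (PowerSeries.coeff n (summand α d e ω₀ ω k) * a ^ n) := hcau.symm
      have hne : (k * e₁) ^ n ≠ 0 := pow_ne_zero _ (mul_ne_zero hkC he1)
      rw [this, ha, div_pow, one_pow]
      field_simp
    · rw [approxCoeff, ← intervalIntegral.integral_const_mul, ← intervalIntegral.integral_const_mul]
      refine intervalIntegral.integral_congr fun θ _ => ?_
      ring
  rw [e1, norm_mul, norm_pow, norm_mul, Complex.norm_natCast]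
  have hint : ‖∫ θ in (-Real.pi)..Real.pi, (F (a * circlePt θ) * circlePt θ ^ (-(n : ℤ)) -
        gammaFactor α ω * approxFun α δ γ β k θ * circlePt θ ^ (-(n : ℤ)))‖ ≤
      C / k * G * (Real.log 2)⁻¹ ^ n *
        (B * ((k : ℝ) ^ (β.re - 1 / 2) * Real.exp (-(decay α * k)))) := by
    refine (intervalIntegral.norm_integral_le_of_norm_le (by linarith)
      (g := fun θ => C / k * G * (Real.log 2)⁻¹ ^ n * ‖approxFun α δ γ β k θ‖) ?_ ?_).trans ?_
    · refine Eventually.of_forall fun θ _ => ?_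
      rw [← sub_mul, norm_mul, norm_zpow, norm_circlePt, zpow_neg, zpow_natCast, ← inv_pow]
      have h1 := hasym θ
      rw [norm_mul] at h1
      have h2 : ‖F (a * circlePt θ) - gammaFactor α ω * approxFun α δ γ β k θ‖ ≤
          C / k * (G * ‖approxFun α δ γ β k θ‖) := by
        refine h1.trans ?_
        gcongr
        exact hG' ω hω
      calc _ ≤ C / k * (G * ‖approxFun α δ γ β k θ‖) * (Real.log 2)⁻¹ ^ n := by gcongr
        _ = _ := by ring
    · exact (continuous_const.mul (continuous_approxFun α δ γ β k).norm).intervalIntegrable _ _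
    · rw [intervalIntegral.integral_const_mul]
      exact mul_le_mul_of_nonneg_left (hB' k hk1 β (norm_mul_half_add_le α hω)) (by positivity)
  have e2 : (k : ℝ) ^ (n + (β.re - 3 / 2)) = (k : ℝ) ^ n * (k : ℝ) ^ (β.re - 1 / 2) / k := by
    rw [← Real.rpow_natCast, ← Real.rpow_add hk0]
    nth_rewrite 3 [← Real.rpow_one (k : ℝ)]
    rw [← Real.rpow_sub hk0]
    congr 1; ring
  calc _ ≤ (k * ‖e₁‖) ^ n * (C / k * G * (Real.log 2)⁻¹ ^ n *
        (B * ((k : ℝ) ^ (β.re - 1 / 2) * Real.exp (-(decay α * k))))) := by gcongr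
    _ = _ := by
        rw [e2, div_pow, mul_pow, inv_pow]
        field_simp

/-! ### Small `k` -/

/-- For `k ≤ η n` the circle of radius `1 / (8 ‖e₁‖ η n)` keeps all factors of the product in the
unit disk. -/
theorem coeff_summand_le_of_le {α : ℕ} {d e : PowerSeries ℂ}
    (hd : IsSubfactorial d) (he : IsSubfactorial e) (hd0 : PowerSeries.constantCoeff d = 1)
    (he0 : PowerSeries.constantCoeff e = 1) (he1 : PowerSeries.coeff 1 e ≠ 0) (R : ℝ) {η : ℝ}
    (hη : 0 < η) :
    ∃ C : ℝ, 0 ≤ C ∧ ∃ N : ℕ, 1 ≤ N ∧ ∀ n : ℕ, N ≤ n → ∀ k : ℕ, k ≤ η * n →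
      ∀ ω₀ ω : ℂ, ‖ω₀‖ ≤ R → ‖ω‖ ≤ R →
        ‖2 * Real.pi * PowerSeries.coeff n (summand α d e ω₀ ω k)‖ ≤
          C * (8 * η * ‖PowerSeries.coeff 1 e‖ * n) ^ n := by
  set e₁ := PowerSeries.coeff 1 e with hee1
  have he1n : 0 < ‖e₁‖ := norm_pos_iff.2 he1
  set c := 1 / (8 * η * ‖e₁‖) with hc
  have hc0 : 0 < c := by positivity
  obtain ⟨Cd, hCd, Nd, hNd, hd'⟩ := hd.log_truncEval_sub_le hd0 hc0
  obtain ⟨Ce, hCe, Ne, hNe, he'⟩ := he.log_truncEval_sub_le he0 hc0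
  set d₁ := PowerSeries.coeff 1 d
  set d₂ := PowerSeries.coeff 2 d - d₁ ^ 2 / 2
  set e₂ := PowerSeries.coeff 2 e - e₁ ^ 2 / 2
  set P := ‖d₁‖ * c + ‖d₂‖ * c ^ 2 + Cd * c ^ 3 with hP
  set Q := ‖e₂‖ * c ^ 2 + Ce * c ^ 3 with hQ
  have hP0 : 0 ≤ P := by positivity
  have hQ0 : 0 ≤ Q := by positivity
  have hlog : ∀ (a b s z : ℂ) (K : ℝ) (n : ℕ), 0 ≤ K → 1 ≤ n → ‖z‖ ≤ c / n →
      ‖s - (a * z + b * z ^ 2)‖ ≤ K * ‖z‖ ^ 3 →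
      ‖s‖ ≤ ‖a‖ * (c / n) + (‖b‖ * c ^ 2 + K * c ^ 3) / n ^ 2 := by
    intro a b s z K n hK hn hz hs
    have hn1 : (1 : ℝ) ≤ n := by exact_mod_cast hn
    have e1 : s = (s - (a * z + b * z ^ 2)) + (a * z + b * z ^ 2) := by ring
    rw [e1]
    have h1 : ‖a * z + b * z ^ 2‖ ≤ ‖a‖ * ‖z‖ + ‖b‖ * ‖z‖ ^ 2 := by
      refine (norm_add_le _ _).trans (le_of_eq ?_)
      rw [norm_mul, norm_mul, norm_pow]
    refine (norm_add_le _ _).trans ((add_le_add hs h1).trans ?_)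
    calc K * ‖z‖ ^ 3 + (‖a‖ * ‖z‖ + ‖b‖ * ‖z‖ ^ 2)
        ≤ K * (c / n) ^ 3 + (‖a‖ * (c / n) + ‖b‖ * (c / n) ^ 2) := by gcongr
      _ = K * c ^ 3 / n ^ 3 + (‖a‖ * (c / n) + ‖b‖ * c ^ 2 / n ^ 2) := by ring
      _ ≤ K * c ^ 3 / n ^ 2 + (‖a‖ * (c / n) + ‖b‖ * c ^ 2 / n ^ 2) := by
          gcongr
          norm_num
      _ = _ := by ring
  obtain ⟨N₁, hN₁⟩ := exists_nat_ge (8 * (η * Q + |R| * (‖e₁‖ * c + Q)))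
  refine ⟨2 * Real.pi * Real.exp ((η + |R|) * P), by positivity, Nd + Ne + N₁, by omega,
    fun n hn k hk ω₀ ω hω₀ hω => ?_⟩
  have hn1 : (1 : ℝ) ≤ n := by exact_mod_cast (by omega : 1 ≤ n)
  have hn0 : (0 : ℝ) < n := by linarith
  have hr : 0 < c / n := by positivity
  have hpi := Real.pi_pos
  -- on the circle of radius `c / n` the exponents `(j + ω) log e` have modulus at most `1 / 2`
  have hcau := (isJet_summandFun α ω₀ ω n k hd0 he0).coeff_mul_pow_eq_integral 1 hr
    (fun z hz => by
      rw [one_mul]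
      exact differentiableAt_summandFun (hd' n (by omega) z hz).1 (he' n (by omega) z hz).1)
  rw [one_pow, mul_one] at hcau
  rw [hcau]
  have hbound : ∀ z : ℂ, ‖z‖ ≤ c / n → ‖summandFun α d e ω₀ ω n k z‖ ≤
      Real.exp ((η + |R|) * P) := by
    intro z hz
    have hσ := hlog _ _ _ z Cd n hCd (by omega) hz (hd' n (by omega) z hz).2
    have hτ := hlog _ _ _ z Ce n hCe (by omega) hz (he' n (by omega) z hz).2
    have hσ' : ‖Complex.log (truncEval n d z)‖ ≤ P / n := by
      refine hσ.trans ?_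
      have e1 : P / n = ‖d₁‖ * (c / n) + (‖d₂‖ * c ^ 2 + Cd * c ^ 3) / n := by rw [hP]; ring
      rw [e1]
      gcongr
      nlinarith
    have hkR : ∀ (j : ℕ) (x : ℂ), j ≤ k → ‖x‖ ≤ R → ‖(j : ℂ) + x‖ ≤ η * n + |R| := by
      intro j x hj hx
      refine (norm_add_le _ _).trans (add_le_add ?_ (hx.trans (le_abs_self _)))
      rw [Complex.norm_natCast]
      exact le_trans (by exact_mod_cast hj) hk
    rw [summandFun, norm_mul, norm_prod, ← mul_one (Real.exp _)]
    refine mul_le_mul ?_ ?_ (Finset.prod_nonneg fun j _ => norm_nonneg _) (Real.exp_pos _).le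
    · rw [Complex.norm_exp]
      refine Real.exp_le_exp.2 ((Complex.re_le_norm _).trans ?_)
      rw [norm_mul]
      calc _ ≤ (η * n + |R|) * (P / n) := by gcongr; exact hkR k ω₀ le_rfl hω₀
        _ = (η + |R| / n) * P := by field_simp
        _ ≤ (η + |R|) * P := by
          gcongr
          exact div_le_self (abs_nonneg _) hn1
    · refine Finset.prod_le_one (fun j _ => norm_nonneg _) fun j hj => ?_
      rw [norm_pow]
      refine pow_le_one₀ (norm_nonneg _) ?_
      have hx : ‖((j : ℂ) + ω) * Complex.log (truncEval n e z)‖ ≤ 1 / 2 := by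
        rw [norm_mul]
        have hjk := hkR j ω (Finset.mem_Icc.1 hj).2 hω
        have hNn : 8 * (η * Q + |R| * (‖e₁‖ * c + Q)) ≤ n := by
          refine hN₁.trans ?_
          exact_mod_cast (by omega : N₁ ≤ n)
        have hce : η * (‖e₁‖ * c) = 1 / 8 := by rw [hc]; field_simp
        calc _ ≤ (η * n + |R|) * (‖e₁‖ * (c / n) + Q / n ^ 2) := by gcongr
          _ = η * (‖e₁‖ * c) + (η * Q + |R| * (‖e₁‖ * c + Q / n)) / n := by field_simp; ring
          _ ≤ 1 / 8 + (η * Q + |R| * (‖e₁‖ * c + Q)) / n := by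
            rw [hce]
            gcongr
            exact div_le_self hQ0 hn1
          _ ≤ 1 / 8 + 1 / 8 := by
            refine add_le_add le_rfl ?_
            rw [div_le_iff₀ hn0]
            linarith
          _ ≤ 1 / 2 := by norm_num
      refine (Complex.norm_exp_sub_one_le (by linarith)).trans ?_
      linarith
  have hint := intervalIntegral.norm_integral_le_of_norm_le_const (a := -Real.pi) (b := Real.pi)
    (C := Real.exp ((η + |R|) * P) * (8 * η * ‖e₁‖ * n) ^ n)
    (f := fun θ : ℝ => summandFun α d e ω₀ ω n k (1 * ((c / n : ℝ) * Complex.exp (θ * Complex.I))) *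
      ((c / n : ℝ) * Complex.exp (θ * Complex.I)) ^ (-(n : ℤ))) (fun θ _ => by
      have hz : ‖((c / n : ℝ) : ℂ) * Complex.exp (θ * Complex.I)‖ = c / n := by
        rw [norm_mul, Complex.norm_exp_ofReal_mul_I, mul_one, Complex.norm_real,
          Real.norm_of_nonneg hr.le]
      rw [norm_mul, norm_zpow, hz, one_mul, zpow_neg, zpow_natCast, ← inv_pow]
      have e1 : (c / n)⁻¹ = 8 * η * ‖e₁‖ * n := by rw [hc]; field_simp
      rw [e1]
      gcongr
      exact hbound _ hz.le)
  refine hint.trans (le_of_eq ?_)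
  rw [sub_neg_eq_add, abs_of_pos (a := Real.pi + Real.pi) (by linarith)]
  ring

/-- An exponentially small factor absorbs all powers of `n`. -/
theorem half_pow_le (M : ℝ) :
    ∃ C : ℝ, 0 ≤ C ∧ ∀ n : ℕ, 1 ≤ n → ∀ σ : ℝ, -M ≤ σ →
      ((n : ℝ) + 1) * ((1 / 2) ^ n * (n : ℝ) ^ M) ≤ C / n * (n : ℝ) ^ σ := by
  obtain ⟨m, hm⟩ := exists_nat_ge (2 * M + 2)
  obtain ⟨B, hB⟩ := (tendsto_pow_const_mul_const_pow_of_lt_one m (r := (1 / 2 : ℝ)) (by norm_num)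
    (by norm_num)).bddAbove_range
  have hB' : ∀ n : ℕ, (n : ℝ) ^ m * (1 / 2) ^ n ≤ |B| := fun n =>
    (hB ⟨n, rfl⟩).trans (le_abs_self B)
  refine ⟨2 * |B|, by positivity, fun n hn σ hσ => ?_⟩
  have hn1 : (1 : ℝ) ≤ n := by exact_mod_cast hn
  have hn0 : (0 : ℝ) < n := by linarith
  have h1 : (n : ℝ) ^ M * n ≤ (n : ℝ) ^ m * ((n : ℝ) ^ σ / n) := by
    have e1 : (n : ℝ) ^ M * n = (n : ℝ) ^ (M + 1) := by rw [Real.rpow_add hn0, Real.rpow_one]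
    have e2 : (n : ℝ) ^ m * ((n : ℝ) ^ σ / n) = (n : ℝ) ^ (m + (σ - 1)) := by
      rw [Real.rpow_add hn0, Real.rpow_sub hn0, Real.rpow_one, Real.rpow_natCast]
    rw [e1, e2]
    exact Real.rpow_le_rpow_of_exponent_le hn1 (by linarith)
  calc ((n : ℝ) + 1) * ((1 / 2) ^ n * (n : ℝ) ^ M)
      ≤ (2 * n) * ((1 / 2) ^ n * (n : ℝ) ^ M) := by gcongr; linarith
    _ = 2 * (1 / 2) ^ n * ((n : ℝ) ^ M * n) := by ring
    _ ≤ 2 * (1 / 2) ^ n * ((n : ℝ) ^ m * ((n : ℝ) ^ σ / n)) := by gcongr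
    _ = 2 * ((n : ℝ) ^ m * (1 / 2) ^ n) * ((n : ℝ) ^ σ / n) := by ring
    _ ≤ 2 * |B| * ((n : ℝ) ^ σ / n) := by gcongr; exact hB' n
    _ = _ := by ring

/-- Both sides of the approximation are exponentially small relative to the growth scale for
`k ≤ η n` when `η` is small. -/
theorem coeff_summand_sub_approxCoeff_le_of_le {α : ℕ} (hα : 1 ≤ α) {d e : PowerSeries ℂ}
    (hd : IsSubfactorial d) (he : IsSubfactorial e) (hd0 : PowerSeries.constantCoeff d = 1)
    (he0 : PowerSeries.constantCoeff e = 1) (he1 : PowerSeries.coeff 1 e ≠ 0) {R : ℝ} (hR : 0 ≤ R)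
    {η : ℝ} (hη : 0 < η) (hη1 : η ≤ 1)
    (hη2 : 8 * η * Real.exp 1 ≤ 1 / 2 * (12 / (α * Real.pi ^ 2))) :
    ∃ C : ℝ, 0 ≤ C ∧ ∃ N : ℕ, 1 ≤ N ∧ ∀ n : ℕ, N ≤ n → ∀ k : ℕ, k ≤ η * n →
      ∀ ω₀ ω : ℂ, ‖ω₀‖ ≤ R → ‖ω‖ ≤ R →
        ‖2 * Real.pi * PowerSeries.coeff n (summand α d e ω₀ ω k) -
          PowerSeries.coeff 1 e ^ n * gammaFactor α ω *
            approxCoeff α (PowerSeries.coeff 1 d / PowerSeries.coeff 1 e)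
              (α * (PowerSeries.coeff 2 e / PowerSeries.coeff 1 e ^ 2 - 1 / 2))
              (α * (1 / 2 + ω)) n k‖ ≤
          C * ((‖PowerSeries.coeff 1 e‖ * (12 / (α * Real.pi ^ 2))) ^ n * (n / Real.exp 1) ^ n) *
            ((1 / 2) ^ n * (n : ℝ) ^ (α * (1 + R))) := by
  obtain ⟨C, hC, N, hN, h⟩ := coeff_summand_le_of_le (α := α) hd he hd0 he0 he1 R hη
  set e₁ := PowerSeries.coeff 1 e with hee1
  set δ := PowerSeries.coeff 1 d / e₁ with hδ
  set γ := α * (PowerSeries.coeff 2 e / e₁ ^ 2 - 1 / 2) with hγ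
  obtain ⟨B, hB, hB'⟩ := norm_approxCoeff_le hα δ γ (α * (1 + R))
  obtain ⟨G, hG, hG'⟩ := norm_gammaFactor_le α R
  have hl := log_two_pos
  have hα0 : (0 : ℝ) < α := by exact_mod_cast hα
  have he1n : 0 < ‖e₁‖ := norm_pos_iff.2 he1
  refine ⟨C + G * B, by positivity, N, hN, fun n hn k hk ω₀ ω hω₀ hω => ?_⟩
  set β := (α : ℂ) * (1 / 2 + ω) with hβ
  have hn1 : (1 : ℝ) ≤ n := by exact_mod_cast hN.trans hn
  have hn0 : (0 : ℝ) < n := by linarith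
  set S := (‖e₁‖ * (12 / (α * Real.pi ^ 2))) ^ n * (n / Real.exp 1) ^ n with hS
  have hS0 : 0 ≤ S := by positivity
  have hM : 0 ≤ α * (1 + R) := by positivity
  have hnM : 1 ≤ (n : ℝ) ^ (α * (1 + R)) := Real.one_le_rpow hn1 hM
  have hpow : (8 * η * ‖e₁‖ * n) ^ n ≤ S * (1 / 2) ^ n := by
    rw [hS, ← mul_pow, ← mul_pow]
    refine pow_le_pow_left₀ (by positivity) ?_ n
    have he := Real.exp_pos 1
    calc 8 * η * ‖e₁‖ * n = (8 * η * Real.exp 1) * (‖e₁‖ * n / Real.exp 1) := by field_simp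
      _ ≤ (1 / 2 * (12 / (α * Real.pi ^ 2))) * (‖e₁‖ * n / Real.exp 1) := by gcongr
      _ = _ := by ring
  have h1 := (h n hn k hk ω₀ ω hω₀ hω).trans (mul_le_mul_of_nonneg_left hpow hC)
  have h2 : ‖e₁ ^ n * gammaFactor α ω * approxCoeff α δ γ β n k‖ ≤
      G * B * (S * (1 / 2) ^ n) * (n : ℝ) ^ (α * (1 + R)) := by
    rcases Nat.eq_zero_or_pos k with rfl | hk1
    · have : approxCoeff α δ γ β n 0 = 0 := by
        have hn' : n ≠ 0 := by exact_mod_cast hn0.ne'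
        simp [approxCoeff, hn']
      rw [this, mul_zero, norm_zero]
      positivity
    have hk1' : (1 : ℝ) ≤ k := by exact_mod_cast hk1
    have hβM := norm_mul_half_add_le α hω
    have h3 := hB' n k hk1 β hβM
    have hkn : (k : ℝ) ≤ n := hk.trans (by nlinarith)
    have h4 : (k : ℝ) ^ β.re ≤ (n : ℝ) ^ (α * (1 + R)) :=
      (Real.rpow_le_rpow_of_exponent_le hk1' ((Complex.re_le_norm _).trans hβM)).trans
        (Real.rpow_le_rpow (by positivity) hkn hM)
    have h5 : (‖e₁‖ * (η * n) * (Real.log 2)⁻¹) ^ n ≤ (8 * η * ‖e₁‖ * n) ^ n := by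
      refine pow_le_pow_left₀ (by positivity) ?_ n
      have : (Real.log 2)⁻¹ ≤ 8 := by
        rw [inv_le_comm₀ hl (by norm_num)]
        have := Real.log_two_gt_d9
        linarith
      calc _ ≤ ‖e₁‖ * (η * n) * 8 := by gcongr
        _ = _ := by ring
    rw [norm_mul, norm_mul, norm_pow]
    calc ‖e₁‖ ^ n * ‖gammaFactor α ω‖ * ‖approxCoeff α δ γ β n k‖
        ≤ ‖e₁‖ ^ n * G * (B * ((k : ℝ) ^ n * (k : ℝ) ^ β.re) * (Real.log 2)⁻¹ ^ n) := by
          gcongr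
          exact hG' ω hω
      _ ≤ ‖e₁‖ ^ n * G * (B * ((η * n) ^ n * (n : ℝ) ^ (α * (1 + R))) * (Real.log 2)⁻¹ ^ n) := by
          gcongr
      _ = G * B * (‖e₁‖ * (η * n) * (Real.log 2)⁻¹) ^ n * (n : ℝ) ^ (α * (1 + R)) := by
          rw [mul_pow, mul_pow]; ring
      _ ≤ _ := by
          have := h5.trans hpow
          gcongr
  refine (norm_sub_le _ _).trans ((add_le_add h1 h2).trans ?_)
  have h6 : C * (S * (1 / 2) ^ n) ≤ C * (S * (1 / 2) ^ n) * (n : ℝ) ^ (α * (1 + R)) :=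
    le_mul_of_one_le_right (by positivity) hnM
  calc _ ≤ C * (S * (1 / 2) ^ n) * (n : ℝ) ^ (α * (1 + R)) +
      G * B * (S * (1 / 2) ^ n) * (n : ℝ) ^ (α * (1 + R)) := by linarith
    _ = _ := by ring

/-! ### The sum of the approximations -/

/-- Summation of the approximations over all `k`; for `k > n` the coefficient vanishes and the
bound for `k ≥ η n` applies to the approximation itself. -/
theorem sumCoeff_sub_tsum_approxCoeff_le {α : ℕ} (hα : 1 ≤ α) {d e : PowerSeries ℂ}
    (hd : IsSubfactorial d) (he : IsSubfactorial e) (hd0 : PowerSeries.constantCoeff d = 1)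
    (he0 : PowerSeries.constantCoeff e = 1) (he1 : PowerSeries.coeff 1 e ≠ 0) {R : ℝ}
    (hR : 0 ≤ R) :
    ∃ C : ℝ, 0 ≤ C ∧ ∃ N : ℕ, 1 ≤ N ∧ ∀ n : ℕ, N ≤ n →
      ∀ ω₀ ω : ℂ, ‖ω₀‖ ≤ R → ‖ω‖ ≤ R →
        ‖2 * Real.pi * sumCoeff α d e ω₀ ω n - PowerSeries.coeff 1 e ^ n * gammaFactor α ω *
            ∑' k : ℕ, approxCoeff α (PowerSeries.coeff 1 d / PowerSeries.coeff 1 e)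
              (α * (PowerSeries.coeff 2 e / PowerSeries.coeff 1 e ^ 2 - 1 / 2))
              (α * (1 / 2 + ω)) n k‖ ≤ C / n * ‖growthScale α e ω n‖ := by
  have hα0 : (0 : ℝ) < α := by exact_mod_cast hα
  -- with this `η` the terms with `k ≤ η n` are smaller than the growth scale by a factor `2 ^ (-n)`
  set η : ℝ := 12 / (16 * Real.exp 1 * (α * Real.pi ^ 2)) with hη
  have hη0 : 0 < η := by positivity
  have hη1 : η ≤ 1 := by
    rw [hη, div_le_one (by positivity)]
    have h1 : (1 : ℝ) ≤ Real.exp 1 := Real.one_le_exp zero_le_one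
    have h2 : (1 : ℝ) ≤ α * Real.pi ^ 2 := by
      have : (1 : ℝ) ≤ α := by exact_mod_cast hα
      nlinarith [Real.pi_gt_three]
    nlinarith
  have hη2 : 8 * η * Real.exp 1 ≤ 1 / 2 * (12 / (α * Real.pi ^ 2)) := by
    rw [hη]
    have := Real.exp_pos 1
    apply le_of_eq
    field_simp
    norm_num
  obtain ⟨C₁, hC₁, N₁, hN₁, h₁⟩ := coeff_summand_sub_approxCoeff_le hα hd he hd0 he0 he1 R hη0
  obtain ⟨C₂, hC₂, N₂, hN₂, h₂⟩ :=
    coeff_summand_sub_approxCoeff_le_of_le hα hd he hd0 he0 he1 hR hη0 hη1 hη2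
  obtain ⟨C₃, hC₃, N₃, hN₃, h₃⟩ := tsum_rpow_mul_exp_le (decay_pos hα) (α * (1 + R) + 3 / 2)
  obtain ⟨C₄, hC₄, N₄, hN₄, h₄⟩ := errorScale_le hα e
  obtain ⟨C₅, hC₅, h₅⟩ := half_pow_le (α * (1 + R))
  set e₁ := PowerSeries.coeff 1 e with hee1
  set δ := PowerSeries.coeff 1 d / e₁ with hδ
  set γ := α * (PowerSeries.coeff 2 e / e₁ ^ 2 - 1 / 2) with hγ
  have hl := log_two_pos
  refine ⟨C₁ * C₃ * C₄ + C₂ * C₅, by positivity, N₁ + N₂ + N₃ + N₄, by omega,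
    fun n hn ω₀ ω hω₀ hω => ?_⟩
  have hn1 : 1 ≤ n := by omega
  have hn1' : (1 : ℝ) ≤ n := by exact_mod_cast hn1
  have hn0 : (0 : ℝ) < n := by linarith
  set β := (α : ℂ) * (1 / 2 + ω) with hβ
  have hβM := norm_mul_half_add_le α hω
  have hσ := abs_le.1 ((Complex.abs_re_le_norm _).trans hβM)
  obtain ⟨hs, hs'⟩ := h₃ n (by omega) (β.re - 3 / 2) (abs_le.2 ⟨by linarith [hσ.1], by linarith [hσ.2]⟩)
  set S := (‖e₁‖ * (12 / (α * Real.pi ^ 2))) ^ n * (n / Real.exp 1) ^ n with hS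
  have hS0 : 0 ≤ S := by positivity
  set q : ℕ → ℝ := fun k => (k : ℝ) ^ (n + (β.re - 3 / 2)) * Real.exp (-(decay α * k)) with hq
  set X := C₂ * S * ((1 / 2) ^ n * (n : ℝ) ^ (α * (1 + R))) with hX
  have hX0 : 0 ≤ X := by positivity
  -- the bound for small `k`, which is charged to all `k ≤ n`
  set E₂ : ℕ → ℝ := fun k => if k ∈ Finset.range (n + 1) then X else 0 with hE₂
  have hE₂s : HasSum E₂ (((n : ℝ) + 1) * X) := by
    have h : HasSum E₂ (∑ k ∈ Finset.range (n + 1), E₂ k) :=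
      hasSum_sum_of_ne_finset_zero fun k hk => by simp only [hE₂, if_neg hk]
    have e1 : ∑ k ∈ Finset.range (n + 1), E₂ k = ((n : ℝ) + 1) * X := by
      rw [Finset.sum_congr rfl (fun k hk => by simp only [hE₂, if_pos hk] : ∀ k ∈ Finset.range (n + 1),
        E₂ k = X)]
      simp
    rwa [e1] at h
  have hE₁s := (hs.hasSum.mul_left (C₁ * (‖e₁‖ / Real.log 2) ^ n)).add hE₂s
  set D : ℕ → ℂ := fun k => 2 * Real.pi * PowerSeries.coeff n (summand α d e ω₀ ω k) -
          e₁ ^ n * gammaFactor α ω * approxCoeff α δ γ β n k with hD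
  have hDle : ∀ k, ‖D k‖ ≤ C₁ * (‖e₁‖ / Real.log 2) ^ n * q k + E₂ k := by
    intro k
    have hq0 : 0 ≤ C₁ * (‖e₁‖ / Real.log 2) ^ n * q k := by positivity
    have hE0 : 0 ≤ E₂ k := by simp only [hE₂]; split_ifs <;> simp [hX0]
    rcases le_total (η * n) k with hk | hk
    · exact (h₁ n (by omega) k hk ω₀ ω hω₀ hω).trans (le_add_of_nonneg_right hE0)
    · refine (h₂ n (by omega) k hk ω₀ ω hω₀ hω).trans ?_
      have hkn : k ∈ Finset.range (n + 1) := by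
        rw [Finset.mem_range, Nat.lt_succ_iff]
        exact_mod_cast hk.trans (by nlinarith : η * n ≤ n)
      have : E₂ k = X := by simp only [hE₂, if_pos hkn]
      rw [this]
      exact le_add_of_nonneg_left hq0
  have hDs : Summable D := Summable.of_norm_bounded hE₁s.summable hDle
  have hcs : HasSum (fun k => 2 * Real.pi * PowerSeries.coeff n (summand α d e ω₀ ω k))
      (2 * Real.pi * sumCoeff α d e ω₀ ω n) := by
    refine HasSum.mul_left _ ?_
    rw [sumCoeff]
    refine hasSum_sum_of_ne_finset_zero fun k hk => ?_
    rw [Finset.mem_range, not_lt] at hk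
    exact coeff_summand_eq_zero hα d e ω₀ ω (by omega)
  have hDt : ∑' k, D k = 2 * Real.pi * sumCoeff α d e ω₀ ω n - e₁ ^ n * gammaFactor α ω *
      ∑' k, approxCoeff α δ γ β n k := by
    have hA : Summable fun k => e₁ ^ n * gammaFactor α ω * approxCoeff α δ γ β n k := by
      refine (hcs.summable.sub hDs).congr fun k => ?_
      simp only [hD]; ring
    rw [← hcs.tsum_eq, ← tsum_mul_left, ← hcs.summable.tsum_sub hA]
  rw [← hDt]
  refine (tsum_of_norm_bounded hE₁s hDle).trans ?_
  have h6 := h₄ n (by omega) ω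
  have h7 := h₅ n hn1 β.re hσ.1
  have hg := norm_growthScale α e ω hn1
  rw [← hee1, ← hS] at hg
  calc C₁ * (‖e₁‖ / Real.log 2) ^ n * (∑' k, q k) + ((n : ℝ) + 1) * X
      ≤ C₁ * (‖e₁‖ / Real.log 2) ^ n * (C₃ * (n.factorial * (n : ℝ) ^ (β.re - 3 / 2) *
          ((decay α)⁻¹) ^ n)) + C₂ * S * (((n : ℝ) + 1) * ((1 / 2) ^ n * (n : ℝ) ^ (α * (1 + R)))) := by
        refine add_le_add (by gcongr) (le_of_eq ?_)
        rw [hX]; ring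
    _ = C₁ * C₃ * ((‖e₁‖ / Real.log 2) ^ n * (n.factorial * (n : ℝ) ^ (β.re - 3 / 2) *
          ((decay α)⁻¹) ^ n)) + C₂ * S * (((n : ℝ) + 1) * ((1 / 2) ^ n * (n : ℝ) ^ (α * (1 + R)))) := by
        ring
    _ ≤ C₁ * C₃ * (C₄ / n * ‖growthScale α e ω n‖) + C₂ * S * (C₅ / n * (n : ℝ) ^ β.re) := by
        gcongr
    _ = _ := by rw [hg]; ring

/-- The imaginary part of the rate vanishes at `θ = 0`, since `rate 0` is real. -/
theorem rate_re_im_bounds (α : ℕ) :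
    ∃ B : ℝ, 0 ≤ B ∧ ∀ θ : ℝ, |θ| ≤ Real.pi →
      (α * (rate θ).re) ^ 2 ≤ B ∧ (α * (rate θ).im) ^ 2 ≤ B * θ ^ 2 := by
  obtain ⟨B₁, hB₁⟩ := (isCompact_Icc (a := -Real.pi) (b := Real.pi)).exists_bound_of_continuousOn
    continuous_rate.continuousOn
  have hO : (fun θ : ℝ => rate θ - rate 0) =O[nhds 0] fun θ : ℝ => θ ^ 1 := by
    have h1 : (fun ζ : ℂ => rate ζ - rate 0) =O[nhds 0] fun ζ : ℂ => ζ - 0 := by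
      have := (analyticAt_rate 0).differentiableAt
      rw [Complex.ofReal_zero] at this
      exact this.isBigO_sub
    have h2 : Tendsto (fun θ : ℝ => (θ : ℂ)) (nhds 0) (nhds 0) := by
      simpa using Complex.continuous_ofReal.tendsto 0
    have h3 := h1.comp_tendsto h2
    refine h3.trans (IsBigO.of_bound 1 (Eventually.of_forall fun θ => ?_))
    simp
  obtain ⟨B₂, hB₂0, hB₂⟩ := exists_bound_of_isBigO_pow (a := Real.pi)
    (f := fun θ : ℝ => rate θ - rate 0) 1
    (continuous_rate.sub continuous_const) hO
  refine ⟨(α * B₁) ^ 2 + (α * B₂) ^ 2, by positivity, fun θ hθ => ⟨?_, ?_⟩⟩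
  · have h1 := (Complex.abs_re_le_norm _).trans (hB₁ θ (abs_le.1 hθ))
    have h2 : (α * (rate θ).re) ^ 2 ≤ (α * B₁) ^ 2 := by
      rw [mul_pow, mul_pow, ← sq_abs (rate θ).re]
      gcongr
    nlinarith [sq_nonneg (α * B₂)]
  · have h1 := (Complex.abs_im_le_norm _).trans (hB₂ θ hθ)
    rw [rate_zero, Complex.sub_im, Complex.ofReal_im, sub_zero, pow_one] at h1
    have h2 : (α * (rate θ).im) ^ 2 ≤ (α * B₂) ^ 2 * θ ^ 2 := by
      calc (α * (rate θ).im) ^ 2 = (α : ℝ) ^ 2 * |(rate θ).im| ^ 2 := by rw [mul_pow, sq_abs]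
        _ ≤ (α : ℝ) ^ 2 * (B₂ * |θ|) ^ 2 := by gcongr
        _ = _ := by rw [mul_pow B₂, sq_abs]; ring
    nlinarith [mul_nonneg (sq_nonneg (α * B₁)) (sq_nonneg θ)]

theorem integral_sq_add_mul_exp_le {c : ℝ} (hc : 0 < c) :
    ∃ C : ℝ, 0 ≤ C ∧ ∀ n : ℕ, 1 ≤ n →
      ∫ θ in (-Real.pi)..Real.pi, (1 / n + θ ^ 2) * Real.exp (-(c * n) * θ ^ 2) ≤
        C * (n : ℝ) ^ (-(3 / 2) : ℝ) := by
  refine ⟨(1 + 2 / c) * Real.sqrt (Real.pi / (c / 2)), by positivity, fun n hn => ?_⟩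
  have hn0 : (0 : ℝ) < n := by exact_mod_cast hn
  have hpi := Real.pi_pos
  have hpt : ∀ θ : ℝ, (1 / n + θ ^ 2) * Real.exp (-(c * n) * θ ^ 2) ≤
      (1 + 2 / c) / n * Real.exp (-(c / 2 * n) * θ ^ 2) := by
    intro θ
    have e1 : Real.exp (-(c * n) * θ ^ 2) =
        Real.exp (-(c / 2 * n) * θ ^ 2) * Real.exp (-(c / 2 * n) * θ ^ 2) := by
      rw [← Real.exp_add]; congr 1; ring
    set x := c / 2 * n * θ ^ 2 with hx
    have hx0 : 0 ≤ x := by positivity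
    have e2 : -(c / 2 * n) * θ ^ 2 = -x := by rw [hx]; ring
    rw [e1, e2, ← mul_assoc]
    refine mul_le_mul_of_nonneg_right ?_ (Real.exp_pos _).le
    have h1 : Real.exp (-x) ≤ 1 := Real.exp_le_one_iff.2 (by linarith)
    have h2 : x * Real.exp (-x) ≤ 1 := by
      rw [Real.exp_neg, ← div_eq_mul_inv, div_le_one (Real.exp_pos _)]
      linarith [Real.add_one_le_exp x]
    have e3 : θ ^ 2 = 2 / c / n * x := by rw [hx]; field_simp
    calc (1 / n + θ ^ 2) * Real.exp (-x) = 1 / n * Real.exp (-x) + 2 / c / n * (x * Real.exp (-x)) := by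
          rw [e3]; ring
      _ ≤ 1 / n * 1 + 2 / c / n * 1 := by gcongr
      _ = _ := by ring
  have h1 : ∫ θ in (-Real.pi)..Real.pi, (1 / n + θ ^ 2) * Real.exp (-(c * n) * θ ^ 2) ≤
      ∫ θ in (-Real.pi)..Real.pi, (1 + 2 / c) / n * Real.exp (-(c / 2 * n) * θ ^ 2) :=
    intervalIntegral.integral_mono_on (by linarith)
      ((by fun_prop : Continuous fun θ : ℝ =>
        (1 / n + θ ^ 2) * Real.exp (-(c * n) * θ ^ 2)).intervalIntegrable _ _)
      ((by fun_prop : Continuous fun θ : ℝ =>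
        (1 + 2 / c) / n * Real.exp (-(c / 2 * n) * θ ^ 2)).intervalIntegrable _ _)
      fun θ _ => hpt θ
  rw [intervalIntegral.integral_const_mul] at h1
  have h2 := integral_exp_neg_sq_le (b := c / 2 * n) (by positivity) Real.pi hpi.le
  have e : Real.sqrt (Real.pi / (c / 2 * n)) / n =
      Real.sqrt (Real.pi / (c / 2)) * (n : ℝ) ^ (-(3 / 2) : ℝ) := by
    have e3 : (n : ℝ) ^ (-(3 / 2) : ℝ) = (n : ℝ) ^ (-(1 / 2) : ℝ) / n := by
      nth_rewrite 3 [← Real.rpow_one (n : ℝ)]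
      rw [← Real.rpow_sub hn0]; norm_num
    rw [← div_div, Real.sqrt_div (by positivity), e3, Real.rpow_neg hn0.le, ← Real.sqrt_eq_rpow]
    ring
  calc _ ≤ (1 + 2 / c) / n * Real.sqrt (Real.pi / (c / 2 * n)) :=
        h1.trans (by gcongr)
    _ = (1 + 2 / c) * (Real.sqrt (Real.pi / (c / 2 * n)) / n) := by ring
    _ = _ := by rw [e]; ring

/-- Interchange of summation and integration, by dominated convergence. The term `k = 0` vanishes
on both sides because `Re (n + β) > 0`. -/
theorem tsum_approxCoeff_eq_integral {α : ℕ} (hα : 1 ≤ α) (δ η β : ℂ) {n : ℕ}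
    (hn : 1 ≤ n + β.re) (hn0 : n ≠ 0) :
    Continuous (fun θ : ℝ => ∑' k : ℕ, (k : ℂ) ^ (n + β) * Complex.exp (-(α * rate θ * k))) ∧
    ∑' k : ℕ, approxCoeff α δ η β n k = ∫ θ in (-Real.pi)..Real.pi,
      (∑' k : ℕ, (k : ℂ) ^ (n + β) * Complex.exp (-(α * rate θ * k))) *
        (Complex.exp (corr δ η θ + β * logExpQuot (circlePt θ)) * circlePt θ ^ (-(n : ℤ))) := by
  have hdec := decay_pos hα
  have hα0 : (0 : ℝ) < α := by exact_mod_cast hα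
  have hpi := Real.pi_pos
  have hs : (n + β : ℂ) ≠ 0 := fun h => by
    have := congrArg Complex.re h
    simp at this
    linarith
  set f : ℕ → ℝ → ℂ := fun k θ => (k : ℂ) ^ (n + β) * Complex.exp (-(α * rate θ * k)) with hf
  set g : ℝ → ℂ := fun θ => Complex.exp (corr δ η θ + β * logExpQuot (circlePt θ)) *
    circlePt θ ^ (-(n : ℤ)) with hg
  have hfc : ∀ k, Continuous (f k) := fun k => by
    have := continuous_rate
    simp only [hf]
    fun_prop
  have hgc : Continuous g := by
    have h1 := continuous_corr δ η
    have h2 := continuous_logExpQuot_circlePt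
    exact (by fun_prop : Continuous fun θ : ℝ =>
      Complex.exp (corr δ η θ + β * logExpQuot (circlePt θ))).mul
      (continuous_circlePt.zpow₀ _ fun θ => Or.inl (circlePt_ne_zero _))
  set u : ℕ → ℝ := fun k => ‖(k : ℂ) ^ (n + β : ℂ) * Complex.exp (-((decay α : ℂ) * k))‖ with hu
  have hus : Summable u := (summable_cpow_mul_exp (s := n + β) (lam := (decay α : ℂ))
    (by simpa using hdec)).norm
  have hfu : ∀ k θ, ‖f k θ‖ ≤ u k := by
    intro k θ
    simp only [hf, hu, norm_mul, Complex.norm_exp]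
    refine mul_le_mul_of_nonneg_left (Real.exp_le_exp.2 ?_) (norm_nonneg _)
    have h1 := mul_le_mul_of_nonneg_left (rate_re_ge θ) (mul_nonneg hα0.le (Nat.cast_nonneg k))
    have e1 : (-(α * rate θ * k) : ℂ).re = -(α * (rate θ).re * k) := by simp
    have e2 : (-((decay α : ℂ) * k)).re = -(decay α * k) := by simp
    rw [e1, e2, decay]
    linarith
  have hcont : Continuous fun θ => ∑' k, f k θ := continuous_tsum hfc hus hfu
  refine ⟨hcont, ?_⟩
  obtain ⟨B, hB⟩ := (isCompact_Icc (a := -Real.pi) (b := Real.pi)).exists_bound_of_continuousOn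
    hgc.continuousOn
  have hsum := intervalIntegral.hasSum_integral_of_dominated_convergence (μ := MeasureTheory.volume)
    (a := -Real.pi) (b := Real.pi) (F := fun k θ => f k θ * g θ)
    (f := fun θ => (∑' k, f k θ) * g θ) (fun k _ => u k * B)
    (fun k => ((hfc k).mul hgc).aestronglyMeasurable)
    (fun k => Eventually.of_forall fun θ hθ => by
      rw [norm_mul]
      rw [Set.uIoc_of_le (by linarith)] at hθ
      exact mul_le_mul (hfu k θ) (hB θ ⟨hθ.1.le, hθ.2⟩) (norm_nonneg _) (norm_nonneg _))
    (Eventually.of_forall fun θ _ => hus.mul_right B)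
    (by simp)
    (Eventually.of_forall fun θ _ =>
      (Summable.of_norm_bounded hus (fun k => hfu k θ)).hasSum.mul_right (g θ))
  rw [← hsum.tsum_eq]
  refine tsum_congr fun k => ?_
  rw [approxCoeff]
  refine intervalIntegral.integral_congr fun θ _ => ?_
  have e1 : (k : ℂ) ^ n * (k : ℂ) ^ β = (k : ℂ) ^ (n + β) := by
    rcases Nat.eq_zero_or_pos k with rfl | hk
    · simp [hn0, Complex.zero_cpow hs]
    · rw [Complex.cpow_add _ _ (by exact_mod_cast hk.ne'), Complex.cpow_natCast]
  simp only [approxFun, hf, hg]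
  rw [← e1, add_assoc, Complex.exp_add]
  ring

/-- The sum over `k` under the integral is replaced by the Gamma integral. The relative error is
`O(1/n + θ²)`, and `θ²` is of order `1/n` under the Gaussian weight. -/
theorem tsum_approxCoeff_sub_gamma_le {α : ℕ} (hα : 1 ≤ α) (δ η : ℂ) (M : ℝ) :
    ∃ C : ℝ, 0 ≤ C ∧ ∃ N : ℕ, 1 ≤ N ∧ ∀ n : ℕ, N ≤ n → ∀ β : ℂ, ‖β‖ ≤ M →
      ‖∑' k : ℕ, approxCoeff α δ η β n k - Complex.Gamma (n + 1 + β) *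
        ∫ θ in (-Real.pi)..Real.pi, (α * rate θ) ^ (-(n + β + 1)) *
          (Complex.exp (corr δ η θ + β * logExpQuot (circlePt θ)) * circlePt θ ^ (-(n : ℤ)))‖ ≤
      C * ((Real.log 2)⁻¹ ^ n * (n.factorial * (n : ℝ) ^ (β.re - 3 / 2) * (decay α)⁻¹ ^ n)) := by
  obtain ⟨c, hc, hlog'⟩ := exists_log_rate_re_ge
  obtain ⟨B, hB, hrate⟩ := rate_re_im_bounds α
  obtain ⟨C₁, hC₁, h₁⟩ := integral_sq_add_mul_exp_le (c := c / 2) (by positivity)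
  obtain ⟨G, hG, hG'⟩ := norm_exp_corr_le δ η M
  obtain ⟨C₂, hC₂, N₂, hN₂, h₂⟩ := realGamma_nat_add_le M
  obtain ⟨N₁, hN₁⟩ := exists_nat_ge (2 * M + 3)
  have hdec := decay_pos hα
  have hα0 : (0 : ℝ) < α := by exact_mod_cast hα
  have hpi := Real.pi_pos
  have hl := log_two_pos
  -- `D` bounds `decay α ^ (-(1 + Re β))` whether `decay α` is larger or smaller than `1`
  set D := max (decay α ^ (-(1 + M))) (decay α ^ (-(1 - M))) with hD
  have hD0 : 0 ≤ D := le_max_of_le_left (by positivity)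
  have hlog : ∀ θ : ℝ, |θ| ≤ Real.pi →
      Real.log (decay α) + c * θ ^ 2 ≤ Real.log (α * (rate θ).re) := fun θ hθ => by
    rw [decay, Real.log_mul hα0.ne' rateZero_pos.ne', Real.log_mul hα0.ne' (rate_re_pos θ).ne']
    linarith [hlog' θ hθ]
  set A := B * (2 * (3 + 4 * M ^ 2 + |M|)) + B with hA
  have hA0 : 0 ≤ A := by positivity
  refine ⟨A * D * C₂ * G * C₁, by positivity, N₁ + N₂, by omega, fun n hn β hβ => ?_⟩
  have hn1 : 1 ≤ n := by omega
  have hn0 : (0 : ℝ) < n := by exact_mod_cast hn1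
  have hM0 : 0 ≤ M := (norm_nonneg _).trans hβ
  have hnM : 2 * M + 3 ≤ n := hN₁.trans (by exact_mod_cast (by omega : N₁ ≤ n))
  have hre := abs_le.1 ((Complex.abs_re_le_norm _).trans hβ)
  have hσ : (n : ℝ) / 2 ≤ n + β.re := by linarith [hre.1]
  obtain ⟨hcont, heq⟩ := tsum_approxCoeff_eq_integral hα δ η β (n := n) (by linarith [hre.1]) (by omega)
  set S : ℝ → ℂ := fun θ => ∑' k : ℕ, (k : ℂ) ^ (n + β) * Complex.exp (-(α * rate θ * k)) with hS
  set g : ℝ → ℂ := fun θ => Complex.exp (corr δ η θ + β * logExpQuot (circlePt θ)) *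
    circlePt θ ^ (-(n : ℤ)) with hg
  have hgc : Continuous g := by
    have h1 := continuous_corr δ η
    have h2 := continuous_logExpQuot_circlePt
    exact (by fun_prop : Continuous fun θ : ℝ =>
      Complex.exp (corr δ η θ + β * logExpQuot (circlePt θ))).mul
      (continuous_circlePt.zpow₀ _ fun θ => Or.inl (circlePt_ne_zero _))
  have hre' : ∀ θ : ℝ, (α * rate θ : ℂ).re = α * (rate θ).re := fun θ => by simp
  have him' : ∀ θ : ℝ, (α * rate θ : ℂ).im = α * (rate θ).im := fun θ => by simp
  have hpos : ∀ θ : ℝ, 0 < (α * rate θ : ℂ).re := fun θ => by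
    rw [hre']; exact mul_pos hα0 (rate_re_pos θ)
  have hpc : Continuous fun θ : ℝ => (α * rate θ : ℂ) ^ (-(n + β + 1)) :=
    (continuous_const.mul continuous_rate).cpow continuous_const fun θ => Or.inl (hpos θ)
  have hi₁ : IntervalIntegrable (fun θ => S θ * g θ) MeasureTheory.volume (-Real.pi) Real.pi :=
    (hcont.mul hgc).intervalIntegrable _ _
  have hi₂ : IntervalIntegrable (fun θ : ℝ => Complex.Gamma (n + 1 + β) *
      ((α * rate θ) ^ (-(n + β + 1)) * g θ)) MeasureTheory.volume (-Real.pi) Real.pi :=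
    (continuous_const.mul (hpc.mul hgc)).intervalIntegrable _ _
  have hsub := intervalIntegral.integral_sub hi₁ hi₂
  rw [intervalIntegral.integral_const_mul] at hsub
  rw [heq, ← hsub]
  set Γr := Real.Gamma (n + β.re + 1) with hΓ
  have hΓ0 : 0 ≤ Γr := (Real.Gamma_pos_of_pos (by linarith [hre.1])).le
  have hpt : ∀ θ : ℝ, |θ| ≤ Real.pi → ‖S θ * g θ - Complex.Gamma (n + 1 + β) *
      ((α * rate θ) ^ (-(n + β + 1)) * g θ)‖ ≤
      A * (D * (decay α)⁻¹ ^ n) * Γr * G * (Real.log 2)⁻¹ ^ n *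
        ((1 / n + θ ^ 2) * Real.exp (-(c / 2 * n) * θ ^ 2)) := by
    intro θ hθ
    have hsre : ((n : ℂ) + β).re = n + β.re := by simp
    have h3 := norm_tsum_cpow_mul_exp_sub_le (s := n + β) (lam := α * rate θ) (M := M)
      (by rw [hsre]; linarith [hre.1])
      (by simpa using (Complex.abs_im_le_norm β).trans hβ) (hpos θ)
    rw [hsre, hre', him'] at h3
    obtain ⟨hr1, hr2⟩ := hrate θ hθ
    have hMa : M ≤ |M| := le_abs_self M
    have h4 : (α * (rate θ).re) ^ 2 * (3 + 4 * M ^ 2 + M) / (n + β.re) + (α * (rate θ).im) ^ 2 ≤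
        A * (1 / n + θ ^ 2) := by
      calc _ ≤ B * (3 + 4 * M ^ 2 + |M|) / (n / 2) + B * θ ^ 2 := by gcongr
        _ = B * (2 * (3 + 4 * M ^ 2 + |M|)) * (1 / n) + B * θ ^ 2 := by field_simp
        _ ≤ A * (1 / n) + A * θ ^ 2 := by
          have : 0 ≤ B * (2 * (3 + 4 * M ^ 2 + |M|)) := by positivity
          gcongr
          · linarith
          · linarith
        _ = _ := by ring
    have h5 : (α * (rate θ).re) ^ (-(n + β.re + 1)) ≤
        D * (decay α)⁻¹ ^ n * Real.exp (-(c / 2 * n) * θ ^ 2) := by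
      have hp : 0 < α * (rate θ).re := mul_pos hα0 (rate_re_pos θ)
      have e3 : decay α ^ (-(n + β.re + 1)) = decay α ^ (-(1 + β.re)) * (decay α)⁻¹ ^ n := by
        rw [← Real.rpow_natCast, Real.inv_rpow hdec.le, ← Real.rpow_neg hdec.le,
          ← Real.rpow_add hdec]
        congr 1; ring
      have h6 : decay α ^ (-(1 + β.re)) ≤ D := by
        rcases le_total 1 (decay α) with h1 | h1
        · exact (Real.rpow_le_rpow_of_exponent_le h1 (by linarith [hre.1])).trans (le_max_right _ _)
        · exact (Real.rpow_le_rpow_of_exponent_ge hdec h1 (by linarith [hre.2])).trans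
            (le_max_left _ _)
      have h7 : (α * (rate θ).re) ^ (-(n + β.re + 1)) ≤
          decay α ^ (-(n + β.re + 1)) * Real.exp (-(c / 2 * n) * θ ^ 2) := by
        rw [Real.rpow_def_of_pos hp, Real.rpow_def_of_pos hdec, ← Real.exp_add, Real.exp_le_exp]
        have h8 := mul_le_mul_of_nonneg_left (hlog θ hθ) (by linarith : 0 ≤ n + β.re + 1)
        have h9 : n / 2 * (c * θ ^ 2) ≤ (n + β.re + 1) * (c * θ ^ 2) := by
          have : 0 ≤ c * θ ^ 2 := by positivity
          gcongr
          linarith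
        linarith
      refine h7.trans ?_
      rw [e3]
      gcongr
    have e5 : Complex.Gamma (n + 1 + β) = Complex.Gamma (n + β + 1) := by congr 1; ring
    have e6 : S θ * g θ - Complex.Gamma (n + 1 + β) * ((α * rate θ) ^ (-(n + β + 1)) * g θ) =
        (S θ - (α * rate θ) ^ (-(n + β + 1)) * Complex.Gamma (n + β + 1)) * g θ := by
      rw [e5]; ring
    have h10 : ‖g θ‖ ≤ G * (Real.log 2)⁻¹ ^ n := by
      simp only [hg]
      rw [norm_mul, norm_zpow, norm_circlePt, zpow_neg, zpow_natCast, ← inv_pow]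
      gcongr
      exact hG' θ hθ β hβ
    rw [e6, norm_mul]
    calc _ ≤ (A * (1 / n + θ ^ 2) * ((D * (decay α)⁻¹ ^ n * Real.exp (-(c / 2 * n) * θ ^ 2)) * Γr)) *
          (G * (Real.log 2)⁻¹ ^ n) := by
          refine mul_le_mul (h3.trans ?_) h10 (norm_nonneg _) (by positivity)
          gcongr
          exact mul_nonneg (Real.rpow_nonneg (mul_pos hα0 (rate_re_pos θ)).le _) hΓ0
      _ = _ := by ring
  have hbound := intervalIntegral.norm_integral_le_of_norm_le (μ := MeasureTheory.volume)
    (a := -Real.pi) (b := Real.pi) (by linarith)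
    (f := fun θ : ℝ => S θ * g θ - Complex.Gamma (n + 1 + β) *
      ((α * rate θ) ^ (-(n + β + 1)) * g θ))
    (g := fun θ => A * (D * (decay α)⁻¹ ^ n) * Γr * G * (Real.log 2)⁻¹ ^ n *
        ((1 / n + θ ^ 2) * Real.exp (-(c / 2 * n) * θ ^ 2)))
    (Eventually.of_forall fun θ hθ => hpt θ (abs_le.2 ⟨hθ.1.le, hθ.2⟩))
    ((by fun_prop : Continuous fun θ : ℝ => A * (D * (decay α)⁻¹ ^ n) * Γr * G * (Real.log 2)⁻¹ ^ n *
        ((1 / n + θ ^ 2) * Real.exp (-(c / 2 * n) * θ ^ 2))).intervalIntegrable _ _)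
  refine hbound.trans ?_
  rw [intervalIntegral.integral_const_mul]
  have h11 : Γr ≤ C₂ * (n.factorial * (n : ℝ) ^ β.re) := by
    have := h₂ n (by omega) β.re (abs_le.2 hre)
    refine le_trans (le_of_eq ?_) this
    rw [hΓ]; congr 1; ring
  have e7 : (n : ℝ) ^ (β.re - 3 / 2) = (n : ℝ) ^ β.re * (n : ℝ) ^ (-(3 / 2) : ℝ) := by
    rw [← Real.rpow_add hn0]; rfl
  have h12 : 0 ≤ ∫ θ in (-Real.pi)..Real.pi, (1 / n + θ ^ 2) * Real.exp (-(c / 2 * n) * θ ^ 2) :=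
    intervalIntegral.integral_nonneg (by linarith) fun θ _ => by positivity
  calc _ ≤ A * (D * (decay α)⁻¹ ^ n) * (C₂ * (n.factorial * (n : ℝ) ^ β.re)) * G *
        (Real.log 2)⁻¹ ^ n * (C₁ * (n : ℝ) ^ (-(3 / 2) : ℝ)) := by
        gcongr
        exact h₁ n hn1
    _ = _ := by rw [e7]; ring

/-! ### The saddle point integral and the constants -/

/-- Stirling's formula for `Γ(n + 1 + β)`, uniformly for bounded `β`. -/
theorem gamma_nat_add_stirling (M : ℝ) :
    ∃ C : ℝ, 0 ≤ C ∧ ∃ N : ℕ, 1 ≤ N ∧ ∀ n : ℕ, N ≤ n → ∀ β : ℂ, ‖β‖ ≤ M →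
      ‖Complex.Gamma (n + 1 + β) -
          ((Real.sqrt (2 * Real.pi * n) * (n / Real.exp 1) ^ n : ℝ) : ℂ) * (n : ℂ) ^ β‖ ≤
        C / n * (Real.sqrt (2 * Real.pi * n) * (n / Real.exp 1) ^ n * (n : ℝ) ^ β.re) := by
  obtain ⟨C₁, hC₁, N₁, hN₁, h₁⟩ := gamma_nat_add_asymp M
  obtain ⟨C₂, hC₂, N₂, hN₂, h₂⟩ := factorial_asymp
  refine ⟨C₁ * (1 + C₂) + C₂, by positivity, N₁ + N₂, by omega, fun n hn β hβ => ?_⟩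
  have hn1 : 1 ≤ n := by omega
  have hn1' : (1 : ℝ) ≤ n := by exact_mod_cast hn1
  have hn0 : (0 : ℝ) < n := by linarith
  have h3 := h₁ n (by omega) β hβ
  have h4 := h₂ n (by omega)
  set St := Real.sqrt (2 * Real.pi * n) * (n / Real.exp 1) ^ n with hSt
  have hSt0 : 0 ≤ St := by positivity
  set p := (n : ℝ) ^ β.re with hp
  have hp0 : 0 ≤ p := by positivity
  have hnp : ‖(n : ℂ) ^ β‖ = p := Complex.norm_natCast_cpow_of_pos hn1 β
  rw [norm_mul, hnp, Complex.norm_natCast] at h3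
  have h5 : (n.factorial : ℝ) ≤ (1 + C₂) * St := by
    have h6 := (le_abs_self _).trans h4
    have h7 : C₂ / n ≤ C₂ := div_le_self hC₂ hn1'
    nlinarith
  have h8 : ‖(n.factorial : ℂ) * (n : ℂ) ^ β - (St : ℂ) * (n : ℂ) ^ β‖ ≤ C₂ / n * St * p := by
    rw [← sub_mul, norm_mul, hnp, ← Complex.ofReal_natCast, ← Complex.ofReal_sub,
      Complex.norm_real, Real.norm_eq_abs]
    gcongr
  have e : Complex.Gamma (n + 1 + β) - (St : ℂ) * (n : ℂ) ^ β =
      (Complex.Gamma (n + 1 + β) - n.factorial * (n : ℂ) ^ β) +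
        (n.factorial * (n : ℂ) ^ β - (St : ℂ) * (n : ℂ) ^ β) := by ring
  rw [e]
  refine (norm_add_le _ _).trans ((add_le_add h3 h8).trans ?_)
  calc _ ≤ C₁ / n * ((1 + C₂) * St * p) + C₂ / n * St * p := by gcongr
    _ = _ := by ring

theorem corr_zero (δ η : ℂ) :
    corr δ η 0 = δ * (Real.log 2 : ℝ) + η * (Real.pi ^ 2 / 12 : ℝ) := by
  rw [corr, circlePt_zero, logExpQuot_log_two, meanLog_log_two]
  push_cast
  ring

/-- The value at `θ = 0` of the integrand of `tsum_approxCoeff_sub_gamma_le`, in closed form. -/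
noncomputable def saddleValue (α : ℕ) (δ η β : ℂ) (n : ℕ) : ℂ :=
  ((12 / (α * Real.pi ^ 2) : ℝ) : ℂ) ^ n * ((12 / (α * Real.pi ^ 2) : ℝ) : ℂ) ^ β *
    ((decay α)⁻¹ : ℝ) * Complex.exp (δ * (Real.log 2 : ℝ) + η * (Real.pi ^ 2 / 12 : ℝ))

/-- The integrand as an exponential, normalized at the saddle point. -/
theorem integrand_eq_saddleValue_mul {α : ℕ} (hα : 1 ≤ α) (δ η β : ℂ) (n : ℕ) (θ : ℝ) :
    (α * rate θ) ^ (-(n + β + 1)) *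
        (Complex.exp (corr δ η θ + β * logExpQuot (circlePt θ)) * circlePt θ ^ (-(n : ℤ))) =
      saddleValue α δ η β n * Complex.exp (-n * (phase θ - phase 0) +
          β * (expA θ - expA 0) + (expB δ η θ - expB δ η 0)) := by
  have hα0 : (0 : ℝ) < α := by exact_mod_cast hα
  have hl := log_two_pos
  have hr := rateZero_pos
  have hq : (0 : ℝ) < 12 / (α * Real.pi ^ 2) := by positivity
  have hrθ : rate θ ≠ 0 := fun h => by
    have := rate_re_pos θ
    simp [h] at this
  set a := Real.log α with ha
  set b := Real.log (Real.log 2) with hb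
  set r := Real.log (Real.pi ^ 2 / (12 * Real.log 2)) with hrr
  have hlogq : Real.log (12 / (α * Real.pi ^ 2)) = -(a + b + r) := by
    rw [ha, hb, hrr, ← Real.log_mul hα0.ne' hl.ne', ← Real.log_mul (by positivity) hr.ne',
      ← Real.log_inv]
    congr 1
    field_simp
  have hlogr : Complex.log (rate 0) = (r : ℂ) := by
    rw [rate_zero, ← Complex.ofReal_log hr.le]
  have h1 : (α * rate θ) ^ (-(n + β + 1)) =
      Complex.exp ((a + Complex.log (rate θ)) * (-(n + β + 1))) := by
    have h2 := Complex.log_ofReal_mul hα0 hrθ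
    rw [Complex.ofReal_natCast] at h2
    rw [Complex.cpow_def_of_ne_zero (mul_ne_zero (by exact_mod_cast hα0.ne') hrθ), h2]
  have h2 : circlePt θ ^ (-(n : ℤ)) = Complex.exp (-(n * (b + θ * Complex.I))) := by
    have hw : circlePt θ = Complex.exp (b + θ * Complex.I) := by
      rw [Complex.exp_add, ← Complex.ofReal_exp, hb, Real.exp_log hl]; rfl
    rw [hw, zpow_neg, zpow_natCast, ← Complex.exp_nat_mul, Complex.exp_neg]
  have h3 : saddleValue α δ η β n = Complex.exp (-(n * (a + b + r)) + -(β * (a + b + r)) -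
      (a + r) + corr δ η 0) := by
    have e1 : ((12 / (α * Real.pi ^ 2) : ℝ) : ℂ) = Complex.exp (-(a + b + r)) := by
      rw [← Real.exp_log hq, hlogq]
      push_cast
      rfl
    have e2 : ((12 / (α * Real.pi ^ 2) : ℝ) : ℂ) ^ β = Complex.exp (-(β * (a + b + r))) := by
      rw [Complex.cpow_def_of_ne_zero (by exact_mod_cast hq.ne'), ← Complex.ofReal_log hq.le, hlogq]
      congr 1
      push_cast
      ring
    have e3 : (((decay α)⁻¹ : ℝ) : ℂ) = Complex.exp (-(a + r)) := by
      rw [← Real.exp_log (inv_pos.2 (decay_pos hα)), Real.log_inv, decay,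
        Real.log_mul hα0.ne' hr.ne', ← ha, ← hrr]
      push_cast
      rfl
    rw [saddleValue, e2, e1, e3, corr_zero, ← Complex.exp_nat_mul, ← Complex.exp_add,
      ← Complex.exp_add, ← Complex.exp_add]
    congr 1
    ring
  have hA0 : expA 0 = -(b : ℂ) - r := by
    rw [expA, circlePt_zero, logExpQuot_log_two, hlogr]
  have hB0 : expB δ η 0 = corr δ η 0 - r := by rw [expB, hlogr]
  have hP0 : phase 0 = r := by rw [phase, hlogr, zero_mul, zero_add]
  rw [h1, h2, h3, hA0, hB0, hP0, ← Complex.exp_add, ← Complex.exp_add, ← Complex.exp_add]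
  congr 1
  rw [expA, expB, phase]
  ring

theorem norm_saddleValue_le {α : ℕ} (hα : 1 ≤ α) (δ η : ℂ) (M : ℝ) :
    ∃ B : ℝ, 0 ≤ B ∧ ∀ n : ℕ, ∀ β : ℂ, ‖β‖ ≤ M →
      ‖saddleValue α δ η β n‖ ≤ B * (12 / (α * Real.pi ^ 2)) ^ n := by
  have hα0 : (0 : ℝ) < α := by exact_mod_cast hα
  set q := 12 / (α * Real.pi ^ 2) with hq
  have hq0 : (0 : ℝ) < q := by positivity
  have hdec := decay_pos hα
  refine ⟨Real.exp (|Real.log q| * M) * (decay α)⁻¹ *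
    ‖Complex.exp (δ * (Real.log 2 : ℝ) + η * (Real.pi ^ 2 / 12 : ℝ))‖, by positivity,
    fun n β hβ => ?_⟩
  have h1 : ‖(q : ℂ) ^ β‖ ≤ Real.exp (|Real.log q| * M) := by
    rw [Complex.norm_cpow_eq_rpow_re_of_pos hq0, Real.rpow_def_of_pos hq0, Real.exp_le_exp]
    calc Real.log q * β.re ≤ |Real.log q * β.re| := le_abs_self _
      _ = |Real.log q| * |β.re| := abs_mul _ _
      _ ≤ _ := by
        gcongr
        exact (Complex.abs_re_le_norm β).trans hβ
  rw [saddleValue, norm_mul, norm_mul, norm_mul, norm_pow, Complex.norm_real, Complex.norm_real,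
    Real.norm_of_nonneg hq0.le, Real.norm_of_nonneg (inv_pos.2 hdec).le]
  calc _ ≤ q ^ n * Real.exp (|Real.log q| * M) * (decay α)⁻¹ *
        ‖Complex.exp (δ * (Real.log 2 : ℝ) + η * (Real.pi ^ 2 / 12 : ℝ))‖ := by gcongr
    _ = _ := by ring

/-- The product of the Gamma factor with the normalized saddle point integral. -/
theorem gamma_mul_saddle_integral_asymp (δ η : ℂ) (M : ℝ) :
    ∃ C : ℝ, 0 ≤ C ∧ ∃ N : ℕ, 1 ≤ N ∧ ∀ n : ℕ, N ≤ n → ∀ β : ℂ, ‖β‖ ≤ M →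
      ‖Complex.Gamma (n + 1 + β) * (∫ θ in (-Real.pi)..Real.pi,
          Complex.exp (-n * (phase θ - phase 0) + β * (expA θ - expA 0) +
            (expB δ η θ - expB δ η 0))) -
        ((Real.pi ^ 2 / (Real.sqrt 6 * Real.log 2) * (n / Real.exp 1) ^ n : ℝ) : ℂ) * (n : ℂ) ^ β‖ ≤
      C / n * ((n / Real.exp 1) ^ n * (n : ℝ) ^ β.re) := by
  obtain ⟨C₁, hC₁, N₁, hN₁, h₁⟩ := gamma_nat_add_stirling M
  obtain ⟨C₂, hC₂, h₂⟩ := saddle_integral_phase δ η M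
  have hl := log_two_pos
  have hpi := Real.pi_pos
  set κ := Real.pi ^ 2 / (Real.sqrt 6 * Real.log 2) with hκ
  have hκ0 : 0 < κ := by positivity
  refine ⟨(1 + C₁) * Real.sqrt (2 * Real.pi) * C₂ + C₁ * κ, by positivity, N₁, hN₁,
    fun n hn β hβ => ?_⟩
  have hn1 : 1 ≤ n := hN₁.trans hn
  have hn1' : (1 : ℝ) ≤ n := by exact_mod_cast hn1
  have hn0 : (0 : ℝ) < n := by linarith
  have h3 := h₁ n hn β hβ
  have h4 := h₂ n hn1 β hβ
  set I := ∫ θ in (-Real.pi)..Real.pi, Complex.exp (-n * (phase θ - phase 0) +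
    β * (expA θ - expA 0) + (expB δ η θ - expB δ η 0)) with hI
  set J := Real.sqrt (2 * Real.pi / (24 * Real.log 2 ^ 2 / Real.pi ^ 2 * n)) with hJ
  set E := (n / Real.exp 1) ^ n with hE
  have hE0 : 0 ≤ E := by positivity
  set p := (n : ℝ) ^ β.re with hp
  have hp0 : 0 ≤ p := by positivity
  have hnp : ‖(n : ℂ) ^ β‖ = p := Complex.norm_natCast_cpow_of_pos hn1 β
  have hJκ : Real.sqrt (2 * Real.pi * n) * J = κ := by
    rw [hJ, ← Real.sqrt_mul (by positivity), hκ]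
    rw [Real.sqrt_eq_iff_mul_self_eq (by positivity) (by positivity)]
    have h6 : Real.sqrt 6 * Real.sqrt 6 = 6 := Real.mul_self_sqrt (by norm_num)
    field_simp
    rw [sq (Real.sqrt 6), h6]
    norm_num
  have hsq : Real.sqrt (2 * Real.pi * n) = Real.sqrt (2 * Real.pi) * Real.sqrt n :=
    Real.sqrt_mul (by positivity) _
  have hΓ : ‖Complex.Gamma (n + 1 + β)‖ ≤ (1 + C₁) * (Real.sqrt (2 * Real.pi * n) * E * p) := by
    have h5 := (norm_le_norm_add_norm_sub' _ _).trans (add_le_add le_rfl h3)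
    rw [norm_mul, hnp, Complex.norm_real, Real.norm_of_nonneg (by positivity)] at h5
    have h7 : C₁ / n ≤ C₁ := div_le_self hC₁ hn1'
    have h8 : 0 ≤ Real.sqrt (2 * Real.pi * n) * E * p := by positivity
    nlinarith
  have e : Complex.Gamma (n + 1 + β) * I - ((κ * E : ℝ) : ℂ) * (n : ℂ) ^ β =
      Complex.Gamma (n + 1 + β) * (I - (J : ℂ)) + (Complex.Gamma (n + 1 + β) -
        ((Real.sqrt (2 * Real.pi * n) * E : ℝ) : ℂ) * (n : ℂ) ^ β) * (J : ℂ) := by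
    rw [← hJκ]
    push_cast
    ring
  rw [e]
  refine (norm_add_le _ _).trans ?_
  rw [norm_mul, norm_mul, Complex.norm_real, Real.norm_of_nonneg (Real.sqrt_nonneg _)]
  calc _ ≤ (1 + C₁) * (Real.sqrt (2 * Real.pi * n) * E * p) * (C₂ / n * (1 / Real.sqrt n)) +
        C₁ / n * (Real.sqrt (2 * Real.pi * n) * E * p) * J := by gcongr
    _ = (1 + C₁) * (Real.sqrt (2 * Real.pi * n) * E * p) * (C₂ / n * (1 / Real.sqrt n)) +
        C₁ / n * (E * p) * (Real.sqrt (2 * Real.pi * n) * J) := by ring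
    _ = _ := by
      rw [hJκ, hsq]
      have : Real.sqrt n ≠ 0 := (Real.sqrt_pos.2 hn0).ne'
      field_simp

/-- The identity of constants: `√(2π) √(12 / (α π²)) = 2√6 / √(α π)` explains the factor with
exponent `α`. -/
theorem cConst_mul_growthScale_eq {α : ℕ} (hα : 1 ≤ α) (d e : PowerSeries ℂ) (ω : ℂ) {n : ℕ}
    (hn : 1 ≤ n) :
    PowerSeries.coeff 1 e ^ n * gammaFactor α ω *
      saddleValue α (PowerSeries.coeff 1 d / PowerSeries.coeff 1 e)
        (α * (PowerSeries.coeff 2 e / PowerSeries.coeff 1 e ^ 2 - 1 / 2)) (α * (1 / 2 + ω)) n *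
      (((Real.pi ^ 2 / (Real.sqrt 6 * Real.log 2) * (n / Real.exp 1) ^ n : ℝ) : ℂ) *
        (n : ℂ) ^ (α * (1 / 2 + ω))) =
      2 * Real.pi * (cConst α d e ω * growthScale α e ω n) := by
  have hα0 : (0 : ℝ) < α := by exact_mod_cast hα
  have hl := log_two_pos
  have hpi := Real.pi_pos
  have hn0 : (n : ℂ) ≠ 0 := by exact_mod_cast (by omega : n ≠ 0)
  set q : ℝ := 12 / (α * Real.pi ^ 2) with hq
  have hq0 : 0 < q := by positivity
  have hqC : (q : ℂ) ≠ 0 := by exact_mod_cast hq0.ne'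
  set e₁ := PowerSeries.coeff 1 e with he₁
  set δ := PowerSeries.coeff 1 d / e₁ with hδ
  set γ := PowerSeries.coeff 2 e / e₁ ^ 2 - 1 / 2 with hγ
  -- the growth scale
  have h1 : growthScale α e ω n = e₁ ^ n * (q : ℂ) ^ n * (((n / Real.exp 1) ^ n : ℝ) : ℂ) *
      (n : ℂ) ^ (α * (1 / 2 + ω)) := by
    rw [growthScale, Complex.cpow_add _ _ hn0, Complex.cpow_natCast, rhoConst, ← mul_assoc]
    congr 1
    rw [hq]
    push_cast
    rw [← mul_pow, ← mul_pow, ← mul_pow, ← he₁]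
    congr 1
    field_simp
  -- the factors with exponent `α`
  have h2 : gammaFactor α ω * (q : ℂ) ^ (α * (1 / 2 + ω)) =
      (((2 * Real.sqrt 6 / Real.sqrt (α * Real.pi) : ℝ) : ℂ) * (Complex.Gamma (1 + ω))⁻¹ *
        (q : ℂ) ^ ω) ^ α := by
    rw [gammaFactor, Complex.cpow_nat_mul, ← mul_pow, Complex.cpow_add _ _ hqC]
    congr 1
    have h3 : (q : ℂ) ^ (1 / 2 : ℂ) = (Real.sqrt q : ℝ) := by
      rw [Real.sqrt_eq_rpow, Complex.ofReal_cpow hq0.le]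
      norm_num
    have h4 : Real.sqrt (2 * Real.pi) * Real.sqrt q = 2 * Real.sqrt 6 / Real.sqrt (α * Real.pi) := by
      rw [← Real.sqrt_mul (by positivity), Real.sqrt_eq_iff_mul_self_eq (by positivity)
        (by positivity), div_mul_div_comm, Real.mul_self_sqrt (by positivity), hq]
      have h6 : Real.sqrt 6 * Real.sqrt 6 = 6 := Real.mul_self_sqrt (by norm_num)
      rw [mul_mul_mul_comm, h6]
      field_simp
      norm_num
    rw [h3, ← h4]
    push_cast
    ring
  have h5 : (2 : ℂ) ^ δ * Complex.exp (α * (Real.pi : ℂ) ^ 2 / 12 * γ) =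
      Complex.exp (δ * (Real.log 2 : ℝ) + α * γ * (Real.pi ^ 2 / 12 : ℝ)) := by
    rw [Complex.cpow_def_of_ne_zero two_ne_zero, ← Complex.exp_add, Complex.ofReal_log (by norm_num)]
    congr 1
    push_cast
    ring
  have h6 : ((decay α)⁻¹ : ℝ) * (Real.pi ^ 2 / (Real.sqrt 6 * Real.log 2)) =
      2 * Real.pi * (Real.sqrt 6 / (α * Real.pi)) := by
    have h7 : Real.sqrt 6 * Real.sqrt 6 = 6 := Real.mul_self_sqrt (by norm_num)
    rw [decay]
    field_simp
    rw [sq, h7]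
    norm_num
  have h6' : (((decay α)⁻¹ : ℝ) : ℂ) * ((Real.pi ^ 2 / (Real.sqrt 6 * Real.log 2) : ℝ) : ℂ) =
      2 * Real.pi * ((Real.sqrt 6 / (α * Real.pi) : ℝ) : ℂ) := by
    rw [← Complex.ofReal_mul, h6]
    push_cast
    rfl
  rw [saddleValue, cConst, h1, ← h2, ← hδ, ← hγ, ← hq, ← h5, Complex.ofReal_mul]
  linear_combination (e₁ ^ n * gammaFactor α ω * (q : ℂ) ^ n * (q : ℂ) ^ (α * (1 / 2 + ω)) *
    (2 : ℂ) ^ δ * Complex.exp (α * (Real.pi : ℂ) ^ 2 / 12 * γ) *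
    (((n / Real.exp 1) ^ n : ℝ) : ℂ) * (n : ℂ) ^ (α * (1 / 2 + ω))) * h6'

/-! ### The asymptotic formula -/

/-- The estimate relative to the growth scale, uniformly for all bounded `ω₀` and `ω`. -/
theorem sumCoeff_asymp {α : ℕ} (hα : 1 ≤ α) {d e : PowerSeries ℂ}
    (hd : IsSubfactorial d) (he : IsSubfactorial e) (hd0 : PowerSeries.constantCoeff d = 1)
    (he0 : PowerSeries.constantCoeff e = 1) (he1 : PowerSeries.coeff 1 e ≠ 0) {R : ℝ}
    (hR : 0 ≤ R) :
    ∃ C : ℝ, 0 ≤ C ∧ ∃ N : ℕ, 1 ≤ N ∧ ∀ n : ℕ, N ≤ n →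
      ∀ ω₀ ω : ℂ, ‖ω₀‖ ≤ R → ‖ω‖ ≤ R →
        ‖sumCoeff α d e ω₀ ω n - cConst α d e ω * growthScale α e ω n‖ ≤
          C / n * ‖growthScale α e ω n‖ := by
  set e₁ := PowerSeries.coeff 1 e with hee1
  set δ := PowerSeries.coeff 1 d / e₁ with hδ
  set γ := α * (PowerSeries.coeff 2 e / e₁ ^ 2 - 1 / 2) with hγ
  obtain ⟨C₁, hC₁, N₁, hN₁, h₁⟩ := sumCoeff_sub_tsum_approxCoeff_le hα hd he hd0 he0 he1 hR
  obtain ⟨C₂, hC₂, N₂, hN₂, h₂⟩ := tsum_approxCoeff_sub_gamma_le hα δ γ (α * (1 + R))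
  obtain ⟨C₃, hC₃, N₃, hN₃, h₃⟩ := gamma_mul_saddle_integral_asymp δ γ (α * (1 + R))
  obtain ⟨C₄, hC₄, N₄, hN₄, h₄⟩ := errorScale_le hα e
  obtain ⟨B, hB, hB'⟩ := norm_saddleValue_le hα δ γ (α * (1 + R))
  obtain ⟨G, hG, hG'⟩ := norm_gammaFactor_le α R
  have hpi := Real.pi_pos
  have hα0 : (0 : ℝ) < α := by exact_mod_cast hα
  refine ⟨C₁ + G * C₂ * C₄ + G * B * C₃, by positivity, N₁ + N₂ + N₃ + N₄, by omega,
    fun n hn ω₀ ω hω₀ hω => ?_⟩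
  have hn1 : 1 ≤ n := by omega
  have hβM := norm_mul_half_add_le α hω
  set β := (α : ℂ) * (1 / 2 + ω) with hβ
  have t1 := h₁ n (by omega) ω₀ ω hω₀ hω
  have t2 := h₂ n (by omega) β hβM
  have t3 := h₃ n (by omega) β hβM
  have t4 := h₄ n (by omega) ω
  simp only [integrand_eq_saddleValue_mul hα δ γ β n] at t2
  rw [intervalIntegral.integral_const_mul] at t2
  have hc := cConst_mul_growthScale_eq hα d e ω hn1
  have hg := norm_growthScale α e ω hn1
  rw [← hee1, ← hδ, ← hγ, ← hβ] at hc
  rw [← hee1, ← hβ] at hg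
  rw [← hee1, ← hδ, ← hγ, ← hβ] at t1
  rw [← hee1, ← hβ] at t4
  set T := ∑' k : ℕ, approxCoeff α δ γ β n k with hT
  set Γn := Complex.Gamma (n + 1 + β) with hΓ
  set I := ∫ θ in (-Real.pi)..Real.pi, Complex.exp (-n * (phase θ - phase 0) +
    β * (expA θ - expA 0) + (expB δ γ θ - expB δ γ 0)) with hI
  set K := saddleValue α δ γ β n with hK
  set V := gammaFactor α ω with hV
  set g := growthScale α e ω n with hgdef
  set S := ((Real.pi ^ 2 / (Real.sqrt 6 * Real.log 2) * (n / Real.exp 1) ^ n : ℝ) : ℂ) *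
    (n : ℂ) ^ β with hS
  have s2 : ‖e₁ ^ n * V * (T - Γn * (K * I))‖ ≤ G * C₂ * C₄ / n * ‖g‖ := by
    rw [norm_mul, norm_mul, norm_pow]
    calc _ ≤ ‖e₁‖ ^ n * G * (C₂ * ((Real.log 2)⁻¹ ^ n * (n.factorial *
          (n : ℝ) ^ (β.re - 3 / 2) * (decay α)⁻¹ ^ n))) := by
          gcongr
          exact hG' ω hω
      _ = G * C₂ * ((‖e₁‖ / Real.log 2) ^ n * (n.factorial *
          (n : ℝ) ^ (β.re - 3 / 2) * (decay α)⁻¹ ^ n)) := by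
          rw [div_eq_mul_inv ‖e₁‖, mul_pow]; ring
      _ ≤ G * C₂ * (C₄ / n * ‖g‖) := by gcongr
      _ = _ := by ring
  have s3 : ‖e₁ ^ n * V * K * (Γn * I - S)‖ ≤ G * B * C₃ / n * ‖g‖ := by
    rw [norm_mul, norm_mul, norm_mul, norm_pow]
    calc _ ≤ ‖e₁‖ ^ n * G * (B * (12 / (α * Real.pi ^ 2)) ^ n) *
          (C₃ / n * ((n / Real.exp 1) ^ n * (n : ℝ) ^ β.re)) := by
          gcongr
          · exact hG' ω hω
          · exact hB' n β hβM
      _ = _ := by rw [hg, mul_pow]; ring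
  have e1 : 2 * Real.pi * (sumCoeff α d e ω₀ ω n - cConst α d e ω * g) =
      (2 * Real.pi * sumCoeff α d e ω₀ ω n - e₁ ^ n * V * T) + e₁ ^ n * V * (T - Γn * (K * I)) +
        e₁ ^ n * V * K * (Γn * I - S) := by
    linear_combination hc
  have h6 : ‖2 * Real.pi * (sumCoeff α d e ω₀ ω n - cConst α d e ω * g)‖ ≤
      (C₁ + G * C₂ * C₄ + G * B * C₃) / n * ‖g‖ := by
    rw [e1, add_div, add_div, add_mul, add_mul]
    exact (norm_add_le _ _).trans (add_le_add ((norm_add_le _ _).trans (add_le_add t1 s2)) s3)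
  refine le_trans ?_ h6
  rw [norm_mul, norm_mul, Complex.norm_ofNat, Complex.norm_real, Real.norm_of_nonneg hpi.le]
  exact le_mul_of_one_le_left (norm_nonneg _) (by linarith [Real.pi_gt_three])

/-- Away from the zeros of `1 / Γ(1 + ω)` the leading constant is bounded below. -/
theorem exists_one_le_mul_norm_cConst {α : ℕ} (hα : 1 ≤ α) (d e : PowerSeries ℂ) (R : ℝ) {δ : ℝ}
    (hδ : 0 < δ) :
    ∃ B : ℝ, 0 ≤ B ∧ ∀ ω : ℂ, ‖ω‖ ≤ R → (∀ m : ℕ, 1 ≤ m → δ ≤ ‖ω + m‖) →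
      1 ≤ B * ‖cConst α d e ω‖ := by
  have hα0 : (0 : ℝ) < α := by exact_mod_cast hα
  have hq : (0 : ℝ) < 12 / (α * Real.pi ^ 2) := by positivity
  have hqC : ((12 / (α * Real.pi ^ 2) : ℝ) : ℂ) ≠ 0 := by exact_mod_cast hq.ne'
  set s : Set ℂ := Metric.closedBall 0 R ∩ {ω | ∀ m : ℕ, 1 ≤ m → δ ≤ ‖ω + m‖} with hs
  have hsc : IsCompact s := by
    refine (isCompact_closedBall 0 R).inter_right ?_
    simp only [Set.ofPred_forall]
    exact isClosed_iInter fun m => isClosed_iInter fun _ =>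
      isClosed_le continuous_const (by fun_prop)
  have hc : Continuous (cConst α d e) := by
    have h1 := continuous_inv_gamma_one_add
    have h2 : Continuous fun ω : ℂ => ((12 / (α * Real.pi ^ 2) : ℝ) : ℂ) ^ ω :=
      continuous_id.const_cpow (Or.inl hqC)
    unfold cConst
    fun_prop
  have hne : ∀ ω ∈ s, cConst α d e ω ≠ 0 := by
    rintro ω ⟨-, hω⟩
    have hΓ : (Complex.Gamma (1 + ω))⁻¹ ≠ 0 := by
      refine inv_ne_zero (Complex.Gamma_ne_zero fun m hm => ?_)
      have h := hω (m + 1) (by omega)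
      have h0 : ω + ((m + 1 : ℕ) : ℂ) = 0 := by
        push_cast
        linear_combination hm
      rw [h0, norm_zero] at h
      linarith
    have h1 : ((Real.sqrt 6 / (α * Real.pi) : ℝ) : ℂ) ≠ 0 := by
      have : 0 < Real.sqrt 6 / (α * Real.pi) := by positivity
      exact_mod_cast this.ne'
    have h2 : ((2 * Real.sqrt 6 / Real.sqrt (α * Real.pi) : ℝ) : ℂ) ≠ 0 := by
      have : 0 < 2 * Real.sqrt 6 / Real.sqrt (α * Real.pi) := by positivity
      exact_mod_cast this.ne'
    have h3 : ((12 / (α * Real.pi ^ 2) : ℝ) : ℂ) ^ ω ≠ 0 := by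
      rw [Ne, Complex.cpow_eq_zero_iff]
      exact fun h => hqC h.1
    have h4 : (2 : ℂ) ^ (PowerSeries.coeff 1 d / PowerSeries.coeff 1 e) ≠ 0 := by
      simp [Complex.cpow_eq_zero_iff]
    exact mul_ne_zero (mul_ne_zero (mul_ne_zero h1
      (pow_ne_zero _ (mul_ne_zero (mul_ne_zero h2 hΓ) h3))) h4) (Complex.exp_ne_zero _)
  obtain ⟨B, hB⟩ := hsc.exists_bound_of_continuousOn (hc.continuousOn.inv₀ hne)
  refine ⟨|B|, abs_nonneg _, fun ω hω hm => ?_⟩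
  have hωs : ω ∈ s := ⟨by simpa using hω, hm⟩
  have h1 := (hB ω hωs).trans (le_abs_self B)
  rw [Pi.inv_apply, norm_inv] at h1
  have h2 : 0 < ‖cConst α d e ω‖ := norm_pos_iff.2 (hne ω hωs)
  calc (1 : ℝ) = ‖cConst α d e ω‖⁻¹ * ‖cConst α d e ω‖ := (inv_mul_cancel₀ h2.ne').symm
    _ ≤ _ := by gcongr

theorem mainTheorem2 (α : ℕ) (hα : 1 ≤ α) (d e : PowerSeries ℂ)
    (hd : IsSubfactorial d) (he : IsSubfactorial e)
    (hd0 : PowerSeries.constantCoeff d = 1) (he0 : PowerSeries.constantCoeff e = 1)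
    (he1 : PowerSeries.coeff 1 e ≠ 0) (R : ℝ) :
    -- relative error `O(1/n)`, uniformly for bounded `ω₀`, `ω` with `ω` away from `-1, -2, …`
    (∀ δ : ℝ, 0 < δ → ∃ C : ℝ, ∃ N : ℕ, ∀ n : ℕ, N ≤ n →
      ∀ ω₀ ω : ℂ, ‖ω₀‖ ≤ R → ‖ω‖ ≤ R → (∀ m : ℕ, 1 ≤ m → δ ≤ ‖ω + m‖) →
        ‖sumCoeff α d e ω₀ ω n - cConst α d e ω * growthScale α e ω n‖ ≤
          C / n * ‖cConst α d e ω * growthScale α e ω n‖) ∧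
    -- uniformly for all bounded `ω₀`, `ω`, with the error measured against the scale
    (∃ C : ℝ, ∃ N : ℕ, ∀ n : ℕ, N ≤ n →
      ∀ ω₀ ω : ℂ, ‖ω₀‖ ≤ R → ‖ω‖ ≤ R →
        ‖sumCoeff α d e ω₀ ω n - cConst α d e ω * growthScale α e ω n‖ ≤
          C / n * ‖growthScale α e ω n‖) := by
  obtain ⟨C, hC, N, -, h⟩ := sumCoeff_asymp hα hd he hd0 he0 he1 (abs_nonneg R)
  have hR := le_abs_self R
  refine ⟨fun δ hδ => ?_, C, N, fun n hn ω₀ ω hω₀ hω =>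
    h n hn ω₀ ω (hω₀.trans hR) (hω.trans hR)⟩
  obtain ⟨B, hB, hB'⟩ := exists_one_le_mul_norm_cConst hα d e R hδ
  refine ⟨C * B, N, fun n hn ω₀ ω hω₀ hω hm =>
    (h n hn ω₀ ω (hω₀.trans hR) (hω.trans hR)).trans ?_⟩
  rw [norm_mul]
  calc C / n * ‖growthScale α e ω n‖ = C / n * (1 * ‖growthScale α e ω n‖) := by rw [one_mul]
    _ ≤ C / n * (B * ‖cConst α d e ω‖ * ‖growthScale α e ω n‖) := by
      gcongr
      exact hB' ω hω hm
    _ = _ := by ring
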